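/- For $\kappa\in\{0,1,-1\}$ let $M_\kappa$ be the oriented three-dimensional space form of curvature $\kappa$ (so $M_0=\mathbb R^3$, $M_1=S^3$, $M_{-1}=H^3$), and let $\mathcal G_\kappa$ be the four-dimensional smooth manifold of all complete oriented geodesics of $M_\kappa$, i.e. of unit speed geodesics $\sigma:\mathbb R\to M_\kappa$ up to translations of the parameter, with the differentiable structure induced by the transitive action of the isometry group. Let $\alpha\in\mathbb R$. Given $\ell\in\mathcal G_\kappa$, a point $p\in\ell$ and a unit vector $A\in T_pM_\kappa$ orthogonal to $\ell$, let $\sigma$ be the parametrization of $\ell$ with $\sigma(0)=p$, let $B=A\times\sigma'(0)$, let $\gamma_A$ be the geodesic with initial velocity $A$, and let $V_t$, $B_t$ be the parallel vector fields along $\gamma_A$ with initial values $\sigma'(0)$ and $B$. The $\alpha$-helicoidal curve with initial ray $\ell$ and axis $\gamma_A$ is the curve $\Gamma:\mathbb R\to\mathcal G_\kappa$ for which $\Gamma(t)$ is the oriented geodesic with initial velocity $\cos(\alpha t)V_t+\sin(\alpha t)B_t$ at $\gamma_A(t)$. Let $\mathcal A_\kappa^\alpha\subset T\mathcal G_\kappa$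 be the set of initial velocities of all $\alpha$-helicoidal curves in $\mathcal G_\kappa$. A smooth curve $\gamma$ in $\mathcal G_\kappa$, defined on an open interval, is $\alpha$-admissible if $\gamma'(t)\in\mathcal A_\kappa^\alpha$ for all $t$; the $\alpha$-helicoidal control system $\mathcal A_\kappa^\alpha$ is controllable if any two points of $\mathcal G_\kappa$ are joined by a piecewise $\alpha$-admissible curve. A subset of a real vector space is substantial if it is not contained in any proper affine subspace. Theorem. Let $\alpha\in\mathbb R$. For each $\kappa\in\{0,1,-1\}$ the following assertions are equivalent: a) the control system $\mathcal A_\kappa^\alpha$ on $\mathcal G_\kappa$ is controllable; b) $\alpha^2\neq\kappa$; c) for every $\ell\in\mathcal G_\kappa$, the fiber $\mathcal A_\kappa^\alpha\cap T_\ell\mathcal G_\kappa$ of $\mathcal A_\kappa^\alpha$ over $\ell$ is substantial in $T_\ell\mathcal G_\kappa$. Moreover, for $\kappa=0$ and $\alpha=0$, the image of every $0$-admissible curve consists of pairwise parallel lines (with the same direction); and for $\kappa=1$ and $\alpha=\pm1$, the image of every $\alpha$-admissible curve is contained in the set of fibers of a single Hopf fibration of $S^3$, where a Hopf fibration is one that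 is congruent, by an element of $O(4)$, to the fibration of $S^3\subset\mathbb C^2$ by the oriented great circles $s\mapsto e^{is}q$. -/

import Mathlib

open scoped Manifold ContDiff

noncomputable section

namespace Helicoidal

/-- The ambient vector space `ℝ⁴`, with coordinates `x 0, x 1, x 2, x 3`.  It also serves as the
model space of four-dimensional manifolds. -/
abbrev R4 : Type := Fin 4 → ℝ

/-- The form `⟨x, y⟩_κ = κ x₀ y₀ + x₁ y₁ + x₂ y₂ + x₃ y₃`, which restricts to the Riemannian
metric on the tangent spaces of the space form of curvature `κ`. -/
def form (κ : SignType) (x y : R4) : ℝ :=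
  (κ : ℝ) * (x 0 * y 0) + x 1 * y 1 + x 2 * y 2 + x 3 * y 3

/-- The companion form `x₀ y₀ + κ (x₁ y₁ + x₂ y₂ + x₃ y₃)`.  For `κ = ±1` it equals
`κ ⟨x, y⟩_κ`; for `κ = 0` it equals `x₀ y₀`. -/
def coform (κ : SignType) (x y : R4) : ℝ :=
  x 0 * y 0 + (κ : ℝ) * (x 1 * y 1 + x 2 * y 2 + x 3 * y 3)

/-- The three-dimensional space form `M_κ ⊆ ℝ⁴` of curvature `κ ∈ {0, 1, -1}`: the affine
hyperplane `x₀ = 1` for `κ = 0`, the unit sphere for `κ = 1`, and the sheet `x₀ > 0` of the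
hyperboloid `-x₀² + x₁² + x₂² + x₃² = -1` for `κ = -1`. -/
def SpaceForm (κ : SignType) : Set R4 :=
  {x | coform κ x x = 1 ∧ (κ ≠ 1 → 0 < x 0)}

/-- The tangent space of `M_κ` at `p`, as a subset of `ℝ⁴` (the kernel of the differential at `p`
of the equation that defines `M_κ`). -/
def TangentTo (κ : SignType) (p : R4) : Set R4 := {w | coform κ p w = 0}

/-- `V` is a smooth vector field along the curve `c` in `M_κ` that is parallel for the Levi-Civita
connection: the tangential part of its derivative in `ℝ⁴` vanishes. -/
def IsParallelAlong (κ : SignType) (c V : ℝ → R4) : Prop :=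
  ContDiff ℝ ∞ V ∧ ∀ t, V t ∈ TangentTo κ (c t) ∧
    ∀ w ∈ TangentTo κ (c t), form κ (deriv V t) w = 0

/-- `σ : ℝ → M_κ` is a (complete) geodesic. -/
def IsGeodesic (κ : SignType) (σ : ℝ → R4) : Prop :=
  ContDiff ℝ ∞ σ ∧ (∀ t, σ t ∈ SpaceForm κ) ∧ IsParallelAlong κ σ (deriv σ)

/-- `σ : ℝ → M_κ` is a (complete) unit speed geodesic. -/
def IsUnitGeodesic (κ : SignType) (σ : ℝ → R4) : Prop :=
  IsGeodesic κ σ ∧ ∀ t, form κ (deriv σ t) (deriv σ t) = 1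

/-- The set of all unit speed geodesics of `M_κ`. -/
def UnitGeodesic (κ : SignType) : Type := {σ : ℝ → R4 // IsUnitGeodesic κ σ}

/-- Two unit speed geodesics are equivalent if they differ by a translation of the parameter. -/
instance geodesicSetoid (κ : SignType) : Setoid (UnitGeodesic κ) where
  r σ τ := ∃ t₀ : ℝ, ∀ t, σ.1 t = τ.1 (t + t₀)
  iseqv :=
    { refl := fun _ => ⟨0, fun t => by simp⟩
      symm := fun {σ τ} ⟨a, h⟩ => ⟨-a, fun t => by rw [h]; simp⟩
      trans := fun {σ τ ρ} ⟨a, h⟩ ⟨b, h'⟩ => ⟨a + b, fun t => by rw [h, h', add_assoc]⟩ }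

/-- The space `𝒢_κ` of all complete oriented geodesics of `M_κ`. -/
def OrientedGeodesic (κ : SignType) : Type := Quotient (geodesicSetoid κ)

/-- `σ` is a unit speed parametrization of the oriented geodesic `ℓ`. -/
def Parametrizes {κ : SignType} (σ : ℝ → R4) (ℓ : OrientedGeodesic κ) : Prop :=
  ∃ h : IsUnitGeodesic κ σ, (Quotient.mk (geodesicSetoid κ) ⟨σ, h⟩ : OrientedGeodesic κ) = ℓ

/-! ### Geodesics are determined by, and exist for, given initial data -/

/-- The function `sin_κ`. -/
def sinK : SignType → ℝ → ℝ
  | .zero => fun s => s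
  | .pos => Real.sin
  | .neg => Real.sinh

/-- The function `cos_κ`, the derivative of `sin_κ`. -/
def cosK : SignType → ℝ → ℝ
  | .zero => fun _ => 1
  | .pos => Real.cos
  | .neg => Real.cosh

lemma cast_zero' : ((SignType.zero : SignType) : ℝ) = 0 := rfl
lemma cast_pos' : ((SignType.pos : SignType) : ℝ) = 1 := rfl
lemma cast_neg' : ((SignType.neg : SignType) : ℝ) = -1 := rfl

lemma hasDerivAt_sinK (κ : SignType) (s : ℝ) : HasDerivAt (sinK κ) (cosK κ s) s := by
  cases κ
  · exact hasDerivAt_id s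
  · exact Real.hasDerivAt_sinh s
  · exact Real.hasDerivAt_sin s

lemma hasDerivAt_cosK (κ : SignType) (s : ℝ) :
    HasDerivAt (cosK κ) (-((κ : ℝ) * sinK κ s)) s := by
  cases κ
  · simpa [cosK, cast_zero'] using hasDerivAt_const s (1 : ℝ)
  · simpa [cosK, sinK, cast_neg'] using Real.hasDerivAt_cosh s
  · simpa [cosK, sinK, cast_pos'] using Real.hasDerivAt_cos s

lemma cosK_sq (κ : SignType) (s : ℝ) : cosK κ s ^ 2 + (κ : ℝ) * sinK κ s ^ 2 = 1 := by
  cases κ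
  · simp [cosK]
  · simpa [cosK, sinK, cast_neg', sub_eq_add_neg] using Real.cosh_sq_sub_sinh_sq s
  · simp [cosK, sinK]

lemma sinK_zero (κ : SignType) : sinK κ 0 = 0 := by cases κ <;> simp [sinK]
lemma cosK_zero (κ : SignType) : cosK κ 0 = 1 := by cases κ <;> simp [cosK]

lemma contDiff_sinK (κ : SignType) : ContDiff ℝ ∞ (sinK κ) := by
  cases κ
  · exact contDiff_id
  · exact Real.contDiff_sinh
  · exact Real.contDiff_sin

lemma contDiff_cosK (κ : SignType) : ContDiff ℝ ∞ (cosK κ) := by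
  cases κ
  · exact contDiff_const
  · exact Real.contDiff_cosh
  · exact Real.contDiff_cos

/-- The form is positive definite on the tangent spaces of `M_κ`. -/
lemma eq_zero_of_form_self {κ : SignType} {p w : R4} (hp : p ∈ SpaceForm κ)
    (hw : w ∈ TangentTo κ p) (h : form κ w w = 0) : w = 0 := by
  obtain ⟨h1, h2⟩ := hp
  simp only [TangentTo, Set.mem_ofPred_eq, coform, form] at *
  have key : w 0 = 0 ∧ w 1 = 0 ∧ w 2 = 0 ∧ w 3 = 0 := by
    cases κ
    · have h0 : 0 < p 0 := h2 (by decide)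
      simp only [cast_zero', zero_mul, zero_add, add_zero] at *
      have : w 0 = 0 := by
        rcases mul_eq_zero.1 hw with h' | h'
        · exact absurd h' h0.ne'
        · exact h'
      refine ⟨this, ?_, ?_, ?_⟩ <;>
        nlinarith [mul_self_nonneg (w 1), mul_self_nonneg (w 2), mul_self_nonneg (w 3)]
    · have h0 : 0 < p 0 := h2 (by decide)
      simp only [cast_neg'] at *
      have e0 : w 0 * w 0 = w 1 * w 1 + w 2 * w 2 + w 3 * w 3 := by linarith
      have e1 : p 0 * w 0 = p 1 * w 1 + p 2 * w 2 + p 3 * w 3 := by linarith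
      have e2 : p 0 * p 0 = 1 + (p 1 * p 1 + p 2 * p 2 + p 3 * p 3) := by linarith
      have cs : (p 1 * w 1 + p 2 * w 2 + p 3 * w 3) ^ 2 ≤
          (p 1 * p 1 + p 2 * p 2 + p 3 * p 3) * (w 1 * w 1 + w 2 * w 2 + w 3 * w 3) := by
        nlinarith [sq_nonneg (p 1 * w 2 - p 2 * w 1), sq_nonneg (p 1 * w 3 - p 3 * w 1),
          sq_nonneg (p 2 * w 3 - p 3 * w 2)]
      have e3 : (p 0 * p 0) * (w 0 * w 0) ≤ (p 0 * p 0 - 1) * (w 0 * w 0) := by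
        calc (p 0 * p 0) * (w 0 * w 0) = (p 1 * w 1 + p 2 * w 2 + p 3 * w 3) ^ 2 := by
              rw [← e1]; ring
          _ ≤ _ := cs
          _ = _ := by rw [e2, e0]; ring
      have e4 : w 0 * w 0 = 0 := by nlinarith [mul_self_nonneg (w 0)]
      rw [e4] at e0
      refine ⟨?_, ?_, ?_, ?_⟩ <;>
        nlinarith [mul_self_nonneg (w 1), mul_self_nonneg (w 2), mul_self_nonneg (w 3)]
    · simp only [cast_pos', one_mul] at *
      refine ⟨?_, ?_, ?_, ?_⟩ <;>
        nlinarith [mul_self_nonneg (w 0), mul_self_nonneg (w 1), mul_self_nonneg (w 2),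
          mul_self_nonneg (w 3)]
  ext i
  fin_cases i
  · exact key.1
  · exact key.2.1
  · exact key.2.2.1
  · exact key.2.2.2

/-- A curve tangent to `M_κ` has `κ`-form and companion form proportional. -/
lemma coform_self_of_tangent {κ : SignType} {p v : R4} (hp : p ∈ SpaceForm κ)
    (hv : v ∈ TangentTo κ p) : coform κ v v = (κ : ℝ) * form κ v v := by
  obtain ⟨h1, h2⟩ := hp
  simp only [TangentTo, Set.mem_ofPred_eq, coform, form] at *
  cases κ
  · have h0 : 0 < p 0 := h2 (by decide)
    simp only [cast_zero', zero_mul, add_zero] at *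
    rcases mul_eq_zero.1 hv with h' | h'
    · exact absurd h' h0.ne'
    · simp [h']
  · simp only [cast_neg'] at *; ring
  · simp only [cast_pos'] at *; ring

/-- The geodesic equation `σ'' = -κ σ`. -/
lemma IsUnitGeodesic.deriv_deriv {κ : SignType} {σ : ℝ → R4} (h : IsUnitGeodesic κ σ) (t : ℝ) :
    deriv (deriv σ) t = -((κ : ℝ) • σ t) := by
  obtain ⟨⟨hs, hM, hd, hT⟩, hu⟩ := h
  have hdσ : ∀ s, HasDerivAt σ (deriv σ s) s := fun s =>
    (hs.differentiable (by simp) s).hasDerivAt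
  have hddσ : ∀ s, HasDerivAt (deriv σ) (deriv (deriv σ) s) s := fun s =>
    (hd.differentiable (by simp) s).hasDerivAt
  have c1 : ∀ i s, HasDerivAt (fun s => σ s i) (deriv σ s i) s := fun i s =>
    hasDerivAt_pi.1 (hdσ s) i
  have c2 : ∀ i s, HasDerivAt (fun s => deriv σ s i) (deriv (deriv σ) s i) s := fun i s =>
    hasDerivAt_pi.1 (hddσ s) i
  -- differentiate the tangency relation
  have e1 : coform κ (deriv σ t) (deriv σ t) + coform κ (σ t) (deriv (deriv σ) t) = 0 := by
    have hz : (fun s => coform κ (σ s) (deriv σ s)) = fun _ => 0 := by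
      funext s; exact (hT s).1
    have hder : HasDerivAt (fun s => coform κ (σ s) (deriv σ s))
        (coform κ (deriv σ t) (deriv σ t) + coform κ (σ t) (deriv (deriv σ) t)) t := by
      unfold coform
      convert! (((c1 0 t).mul (c2 0 t)).add (((((c1 1 t).mul (c2 1 t)).add
        ((c1 2 t).mul (c2 2 t))).add ((c1 3 t).mul (c2 3 t))).const_mul (κ : ℝ))) using 1
      ring
    rw [hz] at hder
    exact hder.unique (hasDerivAt_const t 0)
  have e2 := coform_self_of_tangent (hM t) (hT t).1
  rw [hu t, mul_one] at e2
  have e3 : coform κ (σ t) (deriv (deriv σ) t) = -(κ : ℝ) := by linarith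
  have hw : deriv (deriv σ) t + (κ : ℝ) • σ t ∈ TangentTo κ (σ t) := by
    have := (hM t).1
    simp only [TangentTo, Set.mem_ofPred_eq, coform, Pi.add_apply, Pi.smul_apply,
      smul_eq_mul] at *
    linear_combination e3 + (κ : ℝ) * this
  have hk : (κ : ℝ) * form κ (σ t) (deriv (deriv σ) t + (κ : ℝ) • σ t) = 0 := by
    simp only [TangentTo, Set.mem_ofPred_eq, coform, form] at hw ⊢
    cases κ
    · simp only [cast_zero']; ring
    · simp only [cast_neg'] at *; linarith
    · simp only [cast_pos'] at *; linarith
  have hn : form κ (deriv (deriv σ) t + (κ : ℝ) • σ t) (deriv (deriv σ) t + (κ : ℝ) • σ t) = 0 := by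
    have h1 := (hT t).2 _ hw
    have : form κ (deriv (deriv σ) t + (κ : ℝ) • σ t) (deriv (deriv σ) t + (κ : ℝ) • σ t) =
        form κ (deriv (deriv σ) t) (deriv (deriv σ) t + (κ : ℝ) • σ t) +
        (κ : ℝ) * form κ (σ t) (deriv (deriv σ) t + (κ : ℝ) • σ t) := by
      simp only [form, Pi.add_apply, Pi.smul_apply, smul_eq_mul]; ring
    rw [this, h1, hk, add_zero]
  exact eq_neg_of_add_eq_zero_left (eq_zero_of_form_self (hM t) hw hn)

/-- The explicit form of a unit speed geodesic in terms of its initial data. -/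
lemma IsUnitGeodesic.eq_formula {κ : SignType} {σ : ℝ → R4} (h : IsUnitGeodesic κ σ) (s : ℝ) :
    σ s = cosK κ s • σ 0 + sinK κ s • deriv σ 0 ∧
    deriv σ s = -((κ : ℝ) * sinK κ s) • σ 0 + cosK κ s • deriv σ 0 := by
  have hdσ : ∀ s, HasDerivAt σ (deriv σ s) s := fun s =>
    (h.1.1.differentiable (by simp) s).hasDerivAt
  have hddσ : ∀ s, HasDerivAt (deriv σ) (-((κ : ℝ) • σ s)) s := fun s => by
    rw [← h.deriv_deriv s]
    exact (h.1.2.2.1.differentiable (by simp) s).hasDerivAt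
  have A : ∀ s, HasDerivAt (fun s => cosK κ s • σ s - sinK κ s • deriv σ s) 0 s := by
    intro s
    convert! ((hasDerivAt_cosK κ s).smul (hdσ s)).sub ((hasDerivAt_sinK κ s).smul (hddσ s)) using 1
    module
  have B : ∀ s, HasDerivAt (fun s => ((κ : ℝ) * sinK κ s) • σ s + cosK κ s • deriv σ s) 0 s := by
    intro s
    convert! (((hasDerivAt_sinK κ s).const_mul (κ : ℝ)).smul (hdσ s)).add
      ((hasDerivAt_cosK κ s).smul (hddσ s)) using 1
    module
  have A' : cosK κ s • σ s - sinK κ s • deriv σ s = σ 0 := by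
    have := is_const_of_deriv_eq_zero (fun s => (A s).differentiableAt) (fun s => (A s).deriv) s 0
    simpa [sinK_zero, cosK_zero] using this
  have B' : ((κ : ℝ) * sinK κ s) • σ s + cosK κ s • deriv σ s = deriv σ 0 := by
    have := is_const_of_deriv_eq_zero (fun s => (B s).differentiableAt) (fun s => (B s).deriv) s 0
    simpa [sinK_zero, cosK_zero] using this
  have hc := cosK_sq κ s
  rw [← A', ← B']
  constructor
  · have : σ s = (cosK κ s ^ 2 + (κ : ℝ) * sinK κ s ^ 2) • σ s := by rw [hc, one_smul]
    nth_rewrite 1 [this]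
    module
  · have : deriv σ s = (cosK κ s ^ 2 + (κ : ℝ) * sinK κ s ^ 2) • deriv σ s := by
      rw [hc, one_smul]
    nth_rewrite 1 [this]
    module

/-- The curve `s ↦ cos_κ(s) p + sin_κ(s) v`. -/
def geod (κ : SignType) (p v : R4) (s : ℝ) : R4 := cosK κ s • p + sinK κ s • v

lemma hasDerivAt_geod (κ : SignType) (p v : R4) (s : ℝ) :
    HasDerivAt (geod κ p v) (-((κ : ℝ) * sinK κ s) • p + cosK κ s • v) s := by
  unfold geod
  exact ((hasDerivAt_cosK κ s).smul_const p).add ((hasDerivAt_sinK κ s).smul_const v)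

lemma deriv_geod (κ : SignType) (p v : R4) :
    deriv (geod κ p v) = fun s => -((κ : ℝ) * sinK κ s) • p + cosK κ s • v :=
  funext fun s => (hasDerivAt_geod κ p v s).deriv

lemma contDiff_geod (κ : SignType) (p v : R4) : ContDiff ℝ ∞ (geod κ p v) :=
  ((contDiff_cosK κ).smul contDiff_const).add ((contDiff_sinK κ).smul contDiff_const)

lemma isUnitGeodesic_geod {κ : SignType} {p v : R4} (hp : p ∈ SpaceForm κ)
    (hv : v ∈ TangentTo κ p) (hu : form κ v v = 1) : IsUnitGeodesic κ (geod κ p v) := by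
  have hQ := coform_self_of_tangent hp hv
  rw [hu, mul_one] at hQ
  have hp1 := hp.1
  have hp2 := hp.2
  have hv' : coform κ p v = 0 := hv
  have hM : ∀ t, geod κ p v t ∈ SpaceForm κ := by
    intro t
    have hc := cosK_sq κ t
    refine ⟨?_, fun hκ => ?_⟩
    · have : coform κ (geod κ p v t) (geod κ p v t) =
          cosK κ t ^ 2 * coform κ p p + 2 * cosK κ t * sinK κ t * coform κ p v +
          sinK κ t ^ 2 * coform κ v v := by
        simp only [coform, geod, Pi.add_apply, Pi.smul_apply, smul_eq_mul]; ring
      rw [this, hp1, hv', hQ]; linarith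
    · have h0 := hp2 hκ
      simp only [geod, Pi.add_apply, Pi.smul_apply, smul_eq_mul]
      cases κ
      · simp only [coform, cast_zero', zero_mul, add_zero] at *
        have : v 0 = 0 := by
          rcases mul_eq_zero.1 hv' with h' | h'
          · exact absurd h' h0.ne'
          · exact h'
        simp [cosK, this, h0]
      · simp only [cosK, sinK]
        simp only [coform, form, cast_neg'] at *
        have hcs : (p 1 * v 1 + p 2 * v 2 + p 3 * v 3) ^ 2 ≤
          (p 1 * p 1 + p 2 * p 2 + p 3 * p 3) * (v 1 * v 1 + v 2 * v 2 + v 3 * v 3) := by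
          nlinarith [sq_nonneg (p 1 * v 2 - p 2 * v 1), sq_nonneg (p 1 * v 3 - p 3 * v 1),
            sq_nonneg (p 2 * v 3 - p 3 * v 2)]
        have e1 : p 1 * v 1 + p 2 * v 2 + p 3 * v 3 = p 0 * v 0 := by linarith
        have e2 : p 1 * p 1 + p 2 * p 2 + p 3 * p 3 = p 0 ^ 2 - 1 := by linarith
        have e3 : v 1 * v 1 + v 2 * v 2 + v 3 * v 3 = 1 + v 0 ^ 2 := by linarith
        rw [e1, e2, e3] at hcs
        have hlt : v 0 ^ 2 < p 0 ^ 2 := by nlinarith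
        have habs : |v 0| < p 0 := abs_lt_of_sq_lt_sq hlt h0.le
        have hch := Real.cosh_pos t
        have hsh : |Real.sinh t| < Real.cosh t := by
          apply abs_lt_of_sq_lt_sq _ hch.le
          have := Real.cosh_sq_sub_sinh_sq t
          linarith
        have : |Real.sinh t * v 0| < Real.cosh t * p 0 := by
          rw [abs_mul]
          exact mul_lt_mul'' hsh habs (abs_nonneg _) (abs_nonneg _)
        have := (abs_lt.1 this).1
        linarith
      · exact absurd rfl hκ
  have hcd := contDiff_geod κ p v
  refine ⟨⟨hcd, hM, ?_, fun t => ⟨?_, fun w hw => ?_⟩⟩, fun t => ?_⟩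
  · rw [deriv_geod]
    exact (((contDiff_const.mul (contDiff_sinK κ)).neg).smul contDiff_const).add
      ((contDiff_cosK κ).smul contDiff_const)
  · have : coform κ (geod κ p v t) (deriv (geod κ p v) t) =
        cosK κ t * sinK κ t * (coform κ v v - (κ : ℝ) * coform κ p p) +
        (cosK κ t ^ 2 - (κ : ℝ) * sinK κ t ^ 2) * coform κ p v := by
      rw [deriv_geod]
      simp only [coform, geod, Pi.add_apply, Pi.smul_apply, smul_eq_mul]; ring
    simp only [TangentTo, Set.mem_ofPred_eq]
    rw [this, hp1, hv', hQ]; ring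
  · have hdd : deriv (deriv (geod κ p v)) t = -((κ : ℝ) • geod κ p v t) := by
      rw [deriv_geod]
      have := ((((hasDerivAt_sinK κ t).const_mul (κ : ℝ)).neg).smul_const p).add
        ((hasDerivAt_cosK κ t).smul_const v)
      refine this.deriv.trans ?_
      simp only [geod]
      module
    rw [hdd]
    have : coform κ (geod κ p v t) w = 0 := hw
    simp only [coform, form, Pi.neg_apply, Pi.smul_apply, smul_eq_mul] at *
    cases κ
    · simp
    · simp only [cast_neg'] at *; linarith
    · simp only [cast_pos'] at *; linarith
  · have hpv : (κ : ℝ) * form κ p v = 0 := by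
      simp only [coform, form] at *
      cases κ
      · simp
      · simp only [cast_neg'] at *; linarith
      · simp only [cast_pos'] at *; linarith
    have hpp : (κ : ℝ) ^ 2 * form κ p p = κ := by
      simp only [coform, form] at *
      cases κ
      · simp
      · simp only [cast_neg'] at *; linarith
      · simp only [cast_pos'] at *; linarith
    have hc := cosK_sq κ t
    have : form κ (deriv (geod κ p v) t) (deriv (geod κ p v) t) =
        sinK κ t ^ 2 * ((κ : ℝ) ^ 2 * form κ p p) - 2 * cosK κ t * sinK κ t * ((κ : ℝ) * form κ p v)
        + cosK κ t ^ 2 * form κ v v := by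
      rw [deriv_geod]
      simp only [form, Pi.add_apply, Pi.smul_apply, smul_eq_mul]; ring
    rw [this, hpv, hpp, hu]; linarith

/-- Initial data `p ∈ M_κ`, `v` a unit tangent vector at `p`. -/
def IsFrame (κ : SignType) (p v : R4) : Prop :=
  p ∈ SpaceForm κ ∧ v ∈ TangentTo κ p ∧ form κ v v = 1

lemma IsUnitGeodesic.isFrame {κ : SignType} {σ : ℝ → R4} (h : IsUnitGeodesic κ σ) (t : ℝ) :
    IsFrame κ (σ t) (deriv σ t) :=
  ⟨h.1.2.1 t, (h.1.2.2.2 t).1, h.2 t⟩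

/-- Two future time-like unit vectors have positive companion product. -/
lemma coform_neg_pos {p q : R4} (hp : 0 < p 0) (hq : 0 < q 0)
    (hp1 : coform SignType.neg p p = 1) (hq1 : coform SignType.neg q q = 1) :
    0 < coform SignType.neg p q := by
  simp only [coform, cast_neg'] at *
  have hcs : (p 1 * q 1 + p 2 * q 2 + p 3 * q 3) ^ 2 ≤
      (p 1 * p 1 + p 2 * p 2 + p 3 * p 3) * (q 1 * q 1 + q 2 * q 2 + q 3 * q 3) := by
    nlinarith [sq_nonneg (p 1 * q 2 - p 2 * q 1), sq_nonneg (p 1 * q 3 - p 3 * q 1),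
      sq_nonneg (p 2 * q 3 - p 3 * q 2)]
  have e1 : p 1 * p 1 + p 2 * p 2 + p 3 * p 3 = p 0 ^ 2 - 1 := by linarith
  have e2 : q 1 * q 1 + q 2 * q 2 + q 3 * q 3 = q 0 ^ 2 - 1 := by linarith
  have e3 : 0 ≤ q 1 * q 1 + q 2 * q 2 + q 3 * q 3 :=
    add_nonneg (add_nonneg (mul_self_nonneg _) (mul_self_nonneg _)) (mul_self_nonneg _)
  rw [e1, e2] at hcs
  rw [e2] at e3
  have h3 : (p 1 * q 1 + p 2 * q 2 + p 3 * q 3) ^ 2 < (p 0 * q 0) ^ 2 := by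
    have : 0 < p 0 ^ 2 := by positivity
    have h5 : (p 0 * q 0) ^ 2 = p 0 ^ 2 * q 0 ^ 2 := by ring
    rw [h5]
    nlinarith
  have h4 := (abs_lt.1 (abs_lt_of_sq_lt_sq h3 (mul_pos hp hq).le)).2
  linarith

/-- Two frames that span the same oriented plane of `ℝ⁴` are initial data of the same oriented
geodesic. -/
lemma frame_unique {κ : SignType} {p v p' v' : R4} (h : IsFrame κ p v) (h' : IsFrame κ p' v')
    {c : ℝ} (hc : 0 < c) (H : ∀ i j, p' i * v' j - p' j * v' i = c * (p i * v j - p j * v i)) :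
    ∃ t, p' = geod κ p v t ∧ v' = deriv (geod κ p v) t := by
  obtain ⟨⟨hp1, hp2⟩, hv, hu⟩ := h
  obtain ⟨⟨hp1', hp2'⟩, hv', hu'⟩ := h'
  simp only [deriv_geod, geod]
  have K1 : v' = (c * coform κ p' p) • v - (c * coform κ p' v) • p := by
    funext j
    simp only [TangentTo, Set.mem_ofPred_eq, coform, Pi.sub_apply, Pi.smul_apply,
      smul_eq_mul] at *
    linear_combination (-v' j) * hp1' + (p' j) * hv' + p' 0 * H 0 j + (κ : ℝ) * p' 1 * H 1 j +
      (κ : ℝ) * p' 2 * H 2 j + (κ : ℝ) * p' 3 * H 3 j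
  have K2 : p' = (c * form κ v' v) • p - (c * form κ v' p) • v + (form κ v' p') • v' := by
    funext j
    simp only [TangentTo, Set.mem_ofPred_eq, form, Pi.sub_apply, Pi.add_apply, Pi.smul_apply,
      smul_eq_mul] at *
    linear_combination (-p' j) * hu' + (κ : ℝ) * v' 0 * H j 0 + v' 1 * H j 1 +
      v' 2 * H j 2 + v' 3 * H j 3
  have hQ := coform_self_of_tangent ⟨hp1, hp2⟩ hv
  have hQ' := coform_self_of_tangent ⟨hp1', hp2'⟩ hv'
  rw [hu, mul_one] at hQ
  rw [hu', mul_one] at hQ'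
  rcases eq_or_ne κ 0 with hκ | hκ
  · subst hκ
    have k0 : ((0 : SignType) : ℝ) = 0 := rfl
    simp only [TangentTo, Set.mem_ofPred_eq, coform, k0, zero_mul, add_zero] at hp1 hp1' hv hv'
    have q0 : 0 < p 0 := hp2 (by decide)
    have q0' : 0 < p' 0 := hp2' (by decide)
    have p1 : p 0 = 1 := by nlinarith
    have p1' : p' 0 = 1 := by nlinarith
    have v0 : v 0 = 0 := by simpa [p1] using hv
    have v0' : v' 0 = 0 := by simpa [p1'] using hv'
    have e1 : v' = c • v := by
      rw [K1]; simp [coform, p1, p1', v0, k0]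
    have c1 : c = 1 := by
      rw [e1] at hu'
      have : form 0 (c • v) (c • v) = c ^ 2 * form 0 v v := by
        simp only [form, Pi.smul_apply, smul_eq_mul]; ring
      rw [this, hu, mul_one] at hu'
      nlinarith
    subst c1
    rw [one_smul] at e1
    subst e1
    refine ⟨form 0 v' p' - form 0 v' p, ?_, ?_⟩
    · show p' = (1 : ℝ) • p + (form 0 v' p' - form 0 v' p) • v'
      rw [one_mul, one_mul, hu] at K2
      nth_rewrite 1 [K2]
      module
    · show v' = -(((0 : SignType) : ℝ) * _) • p + (1 : ℝ) • v'
      rw [k0]; module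
  · obtain ⟨k, hk⟩ : ∃ k : ℝ, k = κ := ⟨_, rfl⟩
    have kk : k * k = 1 := by
      cases κ
      · exact absurd rfl hκ
      · rw [hk, cast_neg']; norm_num
      · rw [hk, cast_pos']; norm_num
    have fc : ∀ x y, form κ x y = k * coform κ x y := by
      intro x y
      simp only [form, coform, ← hk]
      linear_combination (-(x 1 * y 1) - x 2 * y 2 - x 3 * y 3) * kk
    have f0 : form κ v' p' = 0 := by
      have : coform κ p' v' = 0 := hv'
      rw [fc]
      have e : coform κ v' p' = coform κ p' v' := by simp only [coform]; ring
      rw [e, this, mul_zero]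
    rw [f0, zero_smul, add_zero] at K2
    obtain ⟨x, hx⟩ : ∃ x, x = c * form κ v' v := ⟨_, rfl⟩
    obtain ⟨y, hy⟩ : ∃ y, y = -(c * form κ v' p) := ⟨_, rfl⟩
    obtain ⟨z, hz⟩ : ∃ z, z = -(c * coform κ p' v) := ⟨_, rfl⟩
    obtain ⟨w, hw⟩ : ∃ w, w = c * coform κ p' p := ⟨_, rfl⟩
    have P : p' = x • p + y • v := by rw [hx, hy]; nth_rewrite 1 [K2]; module
    have V : v' = z • p + w • v := by rw [hz, hw]; nth_rewrite 1 [K1]; module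
    have hpv : coform κ p v = 0 := hv
    have hpv' : coform κ p' v' = 0 := hv'
    have bil : ∀ a b a' b' : ℝ, coform κ (a • p + b • v) (a' • p + b' • v) =
        a * a' * coform κ p p + (a * b' + b * a') * coform κ p v + b * b' * coform κ v v := by
      intro a b a' b'
      simp only [coform, Pi.add_apply, Pi.smul_apply, smul_eq_mul]; ring
    have E1 : x ^ 2 + k * y ^ 2 = 1 := by
      rw [P, bil, hp1, hpv, hQ, ← hk] at hp1'; linarith
    have E2 : x * z + k * y * w = 0 := by
      rw [P, V, bil, hp1, hpv, hQ, ← hk] at hpv'; linarith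
    have E3 : z ^ 2 + k * w ^ 2 = k := by
      rw [V, bil, hp1, hpv, hQ, ← hk] at hQ'; linarith
    have b1 : coform κ p' p = x := by
      have := bil x y 1 0
      rw [hp1, hpv] at this
      rw [P]; simpa using this
    have b2 : coform κ p' v = k * y := by
      have := bil x y 0 1
      rw [hpv, hQ, ← hk] at this
      rw [P]
      simpa [mul_comm] using this
    have W : w = c * x := by rw [hw, b1]
    have Z : z = -(c * (k * y)) := by rw [hz, b2]
    have c1 : c = 1 := by
      have : c ^ 2 * k = k := by
        rw [Z, W] at E3
        linear_combination E3 - c ^ 2 * k * E1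
      have hc2 : c ^ 2 = 1 := by linear_combination k * this - (c ^ 2 - 1) * kk
      nlinarith
    rw [c1, one_mul] at W Z
    have main : ∃ t, cosK κ t = x ∧ sinK κ t = y := by
      cases κ
      · exact absurd rfl hκ
      · rw [cast_neg'] at hk
        subst hk
        have xpos : 0 < x := by
          have q0 : 0 < p 0 := hp2 (by decide)
          have q0' : 0 < p' 0 := hp2' (by decide)
          rw [← b1]
          exact coform_neg_pos q0' q0 hp1' hp1
        refine ⟨Real.arsinh y, ?_, Real.sinh_arsinh y⟩
        show Real.cosh _ = x
        rw [Real.cosh_arsinh, ← Real.sqrt_sq xpos.le]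
        congr 1; linarith
      · rw [cast_pos'] at hk
        subst hk
        have hn : ‖(⟨x, y⟩ : ℂ)‖ = 1 := by
          rw [Complex.norm_eq_sqrt_sq_add_sq]
          simp only
          rw [show x ^ 2 + y ^ 2 = 1 by linarith, Real.sqrt_one]
        have hne : (⟨x, y⟩ : ℂ) ≠ 0 := by
          intro h; rw [h] at hn; simp at hn
        refine ⟨Complex.arg ⟨x, y⟩, ?_, ?_⟩
        · show Real.cos _ = x
          rw [Complex.cos_arg hne, hn]; simp
        · show Real.sin _ = y
          rw [Complex.sin_arg, hn]; simp
    obtain ⟨t, ht1, ht2⟩ := main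
    refine ⟨t, by rw [ht1, ht2]; exact P, ?_⟩
    rw [ht1, ht2, ← hk, ← Z, ← W]; exact V

/-! ### The differentiable structure of the space of oriented geodesics

A geodesic is the intersection of `M_κ` with the oriented plane of `ℝ⁴` spanned by `σ(0)` and
`σ'(0)`.  The charts below are the graph charts of the Grassmannian of oriented planes, with
respect to all linear coordinate systems `Φ` of `ℝ⁴`.  The resulting smooth structure is
invariant under the linear isometries of `M_κ` and is the one for which
`G_κ → 𝒢_κ, g ↦ g ℓ`, is a submersion. -/

/-- The `2 × 2` minors of the pair `(p, v)` in the linear coordinates `Φ`. -/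
def minor (Φ : R4 ≃ₗ[ℝ] R4) (p v : R4) (i j : Fin 4) : ℝ := Φ p i * Φ v j - Φ p j * Φ v i

lemma minor_comb (Φ : R4 ≃ₗ[ℝ] R4) (p v : R4) (a b c d : ℝ) (i j : Fin 4) :
    minor Φ (a • p + b • v) (c • p + d • v) i j = (a * d - b * c) * minor Φ p v i j := by
  simp only [minor, map_add, map_smul, Pi.add_apply, Pi.smul_apply, smul_eq_mul]; ring

/-- The Plücker coordinates of an oriented geodesic, in the linear coordinates `Φ` of `ℝ⁴`. -/
def plucker {κ : SignType} (Φ : R4 ≃ₗ[ℝ] R4) (ℓ : OrientedGeodesic κ) (i j : Fin 4) : ℝ :=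
  Quotient.lift (fun σ : UnitGeodesic κ => minor Φ (σ.1 0) (deriv σ.1 0) i j) (by
    rintro ⟨σ, hσ⟩ ⟨τ, hτ⟩ ⟨t₀, h⟩
    simp only at h ⊢
    have e : σ = fun t => τ (t + t₀) := funext h
    have e1 : deriv σ 0 = deriv τ t₀ := by rw [e, deriv_comp_add_const, zero_add]
    have e2 : σ 0 = τ t₀ := by rw [h, zero_add]
    rw [e1, e2, (hτ.eq_formula t₀).1, (hτ.eq_formula t₀).2, minor_comb]
    have := cosK_sq κ t₀
    rw [show cosK κ t₀ * cosK κ t₀ - sinK κ t₀ * -((κ : ℝ) * sinK κ t₀) = 1 by linarith,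
      one_mul]) ℓ

/-- The oriented geodesic with given initial data. -/
def ofFrame {κ : SignType} {p v : R4} (h : IsFrame κ p v) : OrientedGeodesic κ :=
  Quotient.mk (geodesicSetoid κ) ⟨geod κ p v, isUnitGeodesic_geod h.1 h.2.1 h.2.2⟩

lemma geod_zero (κ : SignType) (p v : R4) : geod κ p v 0 = p := by
  simp [geod, sinK_zero, cosK_zero]

lemma deriv_geod_zero (κ : SignType) (p v : R4) : deriv (geod κ p v) 0 = v := by
  simp [deriv_geod, sinK_zero, cosK_zero]

lemma plucker_ofFrame {κ : SignType} {p v : R4} (h : IsFrame κ p v) (Φ : R4 ≃ₗ[ℝ] R4)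
    (i j : Fin 4) : plucker Φ (ofFrame h) i j = minor Φ p v i j := by
  show minor Φ (geod κ p v 0) (deriv (geod κ p v) 0) i j = _
  rw [geod_zero, deriv_geod_zero]

lemma exists_ofFrame {κ : SignType} (ℓ : OrientedGeodesic κ) :
    ∃ (p v : R4) (h : IsFrame κ p v), ofFrame h = ℓ := by
  induction ℓ using Quotient.inductionOn with
  | h σ =>
    refine ⟨σ.1 0, deriv σ.1 0, σ.2.isFrame 0, Quotient.sound ⟨0, fun t => ?_⟩⟩
    rw [add_zero]
    exact ((σ.2.eq_formula t).1).symm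

lemma ofFrame_eq {κ : SignType} {p v p' v' : R4} (h : IsFrame κ p v) (h' : IsFrame κ p' v')
    {c : ℝ} (hc : 0 < c) (H : ∀ i j, p' i * v' j - p' j * v' i = c * (p i * v j - p j * v i)) :
    ofFrame h' = ofFrame h := by
  obtain ⟨t, h1, h2⟩ := frame_unique h h' hc H
  refine Quotient.sound ⟨t, fun s => ?_⟩
  have g := isUnitGeodesic_geod h.1 h.2.1 h.2.2
  have g' := isUnitGeodesic_geod h'.1 h'.2.1 h'.2.2
  -- both sides are unit speed geodesics with the same initial data
  show geod κ p' v' s = geod κ p v (s + t)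
  have add1 : cosK κ (s + t) = cosK κ s * cosK κ t - (κ : ℝ) * sinK κ s * sinK κ t := by
    cases κ
    · simp [cosK]
    · simp [cosK, sinK, Real.cosh_add]
    · simp [cosK, sinK, Real.cos_add]
  have add2 : sinK κ (s + t) = sinK κ s * cosK κ t + cosK κ s * sinK κ t := by
    cases κ
    · simp [cosK, sinK]
    · simp [cosK, sinK, Real.sinh_add]
    · simp [cosK, sinK, Real.sin_add]
  rw [h1, h2, deriv_geod]
  simp only [geod, add1, add2]
  module

/-- The two vectors `a, b` that span the graph with coordinates `y`:
`Φ a = (1, 0, y₀, y₁)` and `Φ b = (0, 1, y₂, y₃)`. -/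
def graphA (Φ : R4 ≃ₗ[ℝ] R4) (y : R4) : R4 := Φ.symm ![1, 0, y 0, y 1]
/-- See `graphA`. -/
def graphB (Φ : R4 ≃ₗ[ℝ] R4) (y : R4) : R4 := Φ.symm ![0, 1, y 2, y 3]

/-- A positive multiple of the component of `b` that is orthogonal to `a`. -/
def graphC (κ : SignType) (Φ : R4 ≃ₗ[ℝ] R4) (y : R4) : R4 :=
  coform κ (graphA Φ y) (graphA Φ y) • graphB Φ y - coform κ (graphA Φ y) (graphB Φ y) • graphA Φ y

/-- The range of the graph chart: a positive multiple of `a` lies in `M_κ`, and the component of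
`b` orthogonal to `a` can be normalized. -/
def graphTarget (κ : SignType) (Φ : R4 ≃ₗ[ℝ] R4) : Set R4 :=
  {y | 0 < coform κ (graphA Φ y) (graphA Φ y) ∧ 0 < form κ (graphC κ Φ y) (graphC κ Φ y) ∧
    (κ ≠ 1 → 0 < graphA Φ y 0)}

lemma isFrame_graph {κ : SignType} {Φ : R4 ≃ₗ[ℝ] R4} {y : R4} (hy : y ∈ graphTarget κ Φ) :
    IsFrame κ ((√(coform κ (graphA Φ y) (graphA Φ y)))⁻¹ • graphA Φ y)
      ((√(form κ (graphC κ Φ y) (graphC κ Φ y)))⁻¹ • graphC κ Φ y) := by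
  obtain ⟨h1, h2, h3⟩ := hy
  have cs : ∀ (r s : ℝ) (x z : R4), coform κ (r • x) (s • z) = r * s * coform κ x z := by
    intro r s x z; simp only [coform, Pi.smul_apply, smul_eq_mul]; ring
  have fs : ∀ (r s : ℝ) (x z : R4), form κ (r • x) (s • z) = r * s * form κ x z := by
    intro r s x z; simp only [form, Pi.smul_apply, smul_eq_mul]; ring
  refine ⟨⟨?_, fun hκ => ?_⟩, ?_, ?_⟩
  · rw [cs, ← mul_inv, Real.mul_self_sqrt h1.le, inv_mul_cancel₀ h1.ne']
  · exact mul_pos (inv_pos.2 (Real.sqrt_pos.2 h1)) (h3 hκ)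
  · show coform κ _ _ = 0
    rw [cs]
    have : coform κ (graphA Φ y) (graphC κ Φ y) = 0 := by
      simp only [graphC, coform, Pi.sub_apply, Pi.smul_apply, smul_eq_mul]; ring
    rw [this, mul_zero]
  · rw [fs, ← mul_inv, Real.mul_self_sqrt h2.le, inv_mul_cancel₀ h2.ne']

/-- Graph coordinates: the plane with Plücker coordinates `m` is the graph with coordinates
`(m₂₁, m₃₁, m₀₂, m₀₃) / m₀₁`. -/
def graphCoord (m : Fin 4 → Fin 4 → ℝ) : R4 :=
  ![m 2 1 / m 0 1, m 3 1 / m 0 1, m 0 2 / m 0 1, m 0 3 / m 0 1]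

lemma graphCoord_smul {c : ℝ} (hc : c ≠ 0) (m : Fin 4 → Fin 4 → ℝ) :
    graphCoord (fun i j => c * m i j) = graphCoord m := by
  simp only [graphCoord, mul_div_mul_left _ _ hc]

lemma minor_graph_frame {κ : SignType} {Φ Ψ : R4 ≃ₗ[ℝ] R4} {y : R4} (hy : y ∈ graphTarget κ Φ) :
    ∃ c : ℝ, 0 < c ∧ ∀ i j, plucker Ψ (ofFrame (isFrame_graph hy)) i j =
      c * minor Ψ (graphA Φ y) (graphB Φ y) i j := by
  obtain ⟨h1, h2, h3⟩ := hy
  refine ⟨(√(coform κ (graphA Φ y) (graphA Φ y)))⁻¹ *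
    ((√(form κ (graphC κ Φ y) (graphC κ Φ y)))⁻¹ * coform κ (graphA Φ y) (graphA Φ y)), ?_, ?_⟩
  · have := Real.sqrt_pos.2 h1
    have := Real.sqrt_pos.2 h2
    positivity
  · intro i j
    rw [plucker_ofFrame]
    simp only [minor, graphC, map_smul, map_sub, Pi.sub_apply, Pi.smul_apply, smul_eq_mul]
    ring

lemma graphCoord_minor (Φ : R4 ≃ₗ[ℝ] R4) (y : R4) :
    graphCoord (minor Φ (graphA Φ y) (graphB Φ y)) = y := by
  ext i
  fin_cases i <;> simp [graphCoord, minor, graphA, graphB]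

lemma minor_graph_pos (Φ : R4 ≃ₗ[ℝ] R4) (y : R4) :
    minor Φ (graphA Φ y) (graphB Φ y) 0 1 = 1 := by
  simp [minor, graphA, graphB]

lemma graph_of_minor (Φ : R4 ≃ₗ[ℝ] R4) {p v : R4} (h : 0 < minor Φ p v 0 1) :
    graphA Φ (graphCoord (minor Φ p v)) =
      (Φ v 1 / minor Φ p v 0 1) • p + (-(Φ p 1) / minor Φ p v 0 1) • v ∧
    graphB Φ (graphCoord (minor Φ p v)) =
      (-(Φ v 0) / minor Φ p v 0 1) • p + (Φ p 0 / minor Φ p v 0 1) • v := by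
  have h' : Φ p 0 * Φ v 1 - Φ p 1 * Φ v 0 ≠ 0 := h.ne'
  constructor
  · rw [graphA, LinearEquiv.symm_apply_eq]
    ext i
    fin_cases i <;> simp [graphCoord, minor]
    · rw [div_mul_eq_mul_div, div_mul_eq_mul_div, ← add_div, eq_comm, div_eq_one_iff_eq h']; ring
    all_goals ring
  · rw [graphB, LinearEquiv.symm_apply_eq]
    ext i
    fin_cases i <;> simp [graphCoord, minor]
    · ring
    · rw [div_mul_eq_mul_div, div_mul_eq_mul_div, ← add_div, eq_comm, div_eq_one_iff_eq h']; ring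
    all_goals ring

open Classical in
/-- The graph chart of `𝒢_κ` in the linear coordinates `Φ` of `ℝ⁴`. -/
def graphChart (κ : SignType) (Φ : R4 ≃ₗ[ℝ] R4) : PartialEquiv (OrientedGeodesic κ) R4 where
  toFun ℓ := graphCoord (plucker Φ ℓ)
  invFun y := if hy : y ∈ graphTarget κ Φ then ofFrame (isFrame_graph hy) else
    ofFrame (κ := κ) (p := ![1, 0, 0, 0]) (v := ![0, 1, 0, 0])
      ⟨by simp [SpaceForm, coform], by simp [TangentTo, coform], by simp [form]⟩
  source := {ℓ | 0 < plucker Φ ℓ 0 1 ∧ graphCoord (plucker Φ ℓ) ∈ graphTarget κ Φ}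
  target := graphTarget κ Φ
  map_source' := fun _ h => h.2
  map_target' := by
    intro y hy
    obtain ⟨c, hc, H⟩ := minor_graph_frame (Ψ := Φ) hy
    have H' : plucker Φ (ofFrame (isFrame_graph hy)) =
      fun i j => c * minor Φ (graphA Φ y) (graphB Φ y) i j := by funext i j; exact H i j
    simp only [hy, dif_pos, Set.mem_ofPred_eq]
    rw [H', graphCoord_smul hc.ne', graphCoord_minor]
    refine ⟨?_, hy⟩
    show 0 < c * minor Φ (graphA Φ y) (graphB Φ y) 0 1
    rw [minor_graph_pos, mul_one]; exact hc
  left_inv' := by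
    rintro ℓ ⟨h0, hy⟩
    obtain ⟨p, v, hf, rfl⟩ := exists_ofFrame ℓ
    have e : plucker Φ (ofFrame hf) = minor Φ p v := by
      funext i j; exact plucker_ofFrame hf Φ i j
    rw [dif_pos hy]
    rw [e] at h0
    obtain ⟨c, hc, H⟩ := minor_graph_frame (Ψ := LinearEquiv.refl ℝ R4) hy
    refine ofFrame_eq hf (isFrame_graph hy) (c := c * (minor Φ p v 0 1)⁻¹)
      (mul_pos hc (inv_pos.2 h0)) fun i j => ?_
    have H1 := H i j
    rw [plucker_ofFrame] at H1
    refine H1.trans ?_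
    rw [e, (graph_of_minor Φ h0).1, (graph_of_minor Φ h0).2, minor_comb]
    have : minor (LinearEquiv.refl ℝ R4) p v i j = p i * v j - p j * v i := rfl
    rw [this, mul_assoc]
    congr 2
    have h' : Φ p 0 * Φ v 1 - Φ p 1 * Φ v 0 ≠ 0 := h0.ne'
    simp only [minor]
    field_simp
  right_inv' := by
    intro y hy
    obtain ⟨c, hc, H⟩ := minor_graph_frame (Ψ := Φ) hy
    have H' : plucker Φ (ofFrame (isFrame_graph hy)) =
      fun i j => c * minor Φ (graphA Φ y) (graphB Φ y) i j := by funext i j; exact H i j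
    rw [dif_pos hy, H', graphCoord_smul hc.ne', graphCoord_minor]

lemma graphChart_symm_plucker {κ : SignType} {Φ Ψ : R4 ≃ₗ[ℝ] R4} {y : R4}
    (hy : y ∈ graphTarget κ Φ) :
    ∃ c : ℝ, 0 < c ∧ plucker Ψ ((graphChart κ Φ).symm y) =
      fun i j => c * minor Ψ (graphA Φ y) (graphB Φ y) i j := by
  obtain ⟨c, hc, H⟩ := minor_graph_frame (Ψ := Ψ) hy
  refine ⟨c, hc, ?_⟩
  funext i j
  have : (graphChart κ Φ).symm y = ofFrame (isFrame_graph hy) := dif_pos hy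
  rw [this]; exact H i j

lemma contDiff_graphA (Φ : R4 ≃ₗ[ℝ] R4) : ContDiff ℝ ∞ (graphA Φ) := by
  have h1 : ContDiff ℝ ∞ (fun y : R4 => (![1, 0, y 0, y 1] : R4)) := by
    rw [contDiff_pi]
    intro i
    fin_cases i
    · exact contDiff_const
    · exact contDiff_const
    · exact contDiff_apply ℝ ℝ 0
    · exact contDiff_apply ℝ ℝ 1
  exact (LinearMap.toContinuousLinearMap Φ.symm.toLinearMap).contDiff.comp h1

lemma contDiff_graphB (Φ : R4 ≃ₗ[ℝ] R4) : ContDiff ℝ ∞ (graphB Φ) := by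
  have h1 : ContDiff ℝ ∞ (fun y : R4 => (![0, 1, y 2, y 3] : R4)) := by
    rw [contDiff_pi]
    intro i
    fin_cases i
    · exact contDiff_const
    · exact contDiff_const
    · exact contDiff_apply ℝ ℝ 2
    · exact contDiff_apply ℝ ℝ 3
  exact (LinearMap.toContinuousLinearMap Φ.symm.toLinearMap).contDiff.comp h1

lemma contDiff_minor_graph (Φ Ψ : R4 ≃ₗ[ℝ] R4) (i j : Fin 4) :
    ContDiff ℝ ∞ (fun y => minor Ψ (graphA Φ y) (graphB Φ y) i j) := by
  have hA : ContDiff ℝ ∞ (fun y => Ψ (graphA Φ y)) :=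
    (LinearMap.toContinuousLinearMap Ψ.toLinearMap).contDiff.comp (contDiff_graphA Φ)
  have hB : ContDiff ℝ ∞ (fun y => Ψ (graphB Φ y)) :=
    (LinearMap.toContinuousLinearMap Ψ.toLinearMap).contDiff.comp (contDiff_graphB Φ)
  rw [contDiff_pi] at hA hB
  exact ((hA i).mul (hB j)).sub ((hA j).mul (hB i))

lemma contDiffOn_graphCoord (Φ Ψ : R4 ≃ₗ[ℝ] R4) :
    ContDiffOn ℝ ∞ (fun y => graphCoord (minor Ψ (graphA Φ y) (graphB Φ y)))
      {y | 0 < minor Ψ (graphA Φ y) (graphB Φ y) 0 1} := by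
  have h := fun i j => (contDiff_minor_graph Φ Ψ i j).contDiffOn
    (s := {y | 0 < minor Ψ (graphA Φ y) (graphB Φ y) 0 1})
  have hd := fun i j => (h i j).div (h 0 1) (fun y hy => ne_of_gt hy)
  rw [contDiffOn_pi]
  intro i
  fin_cases i
  · exact hd 2 1
  · exact hd 3 1
  · exact hd 0 2
  · exact hd 0 3

lemma isOpen_graphTarget (κ : SignType) (Φ : R4 ≃ₗ[ℝ] R4) : IsOpen (graphTarget κ Φ) := by
  have hA := (contDiff_graphA Φ).continuous
  have hB := (contDiff_graphB Φ).continuous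
  have cf : ∀ f g : R4 → R4, Continuous f → Continuous g →
      Continuous fun y => coform κ (f y) (g y) := by
    intro f g hf hg; unfold coform; fun_prop
  have ff : ∀ f g : R4 → R4, Continuous f → Continuous g →
      Continuous fun y => form κ (f y) (g y) := by
    intro f g hf hg; unfold form; fun_prop
  have hC : Continuous (graphC κ Φ) :=
    ((cf _ _ hA hA).smul hB).sub ((cf _ _ hA hB).smul hA)
  refine (isOpen_lt continuous_const (cf _ _ hA hA)).inter
    ((isOpen_lt continuous_const (ff _ _ hC hC)).inter ?_)
  show IsOpen {y : R4 | κ ≠ 1 → 0 < graphA Φ y 0}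
  by_cases hκ : κ = 1
  · simp [hκ]
  · simp only [ne_eq, hκ, not_false_eq_true, true_imp_iff]
    exact isOpen_lt continuous_const ((continuous_apply 0).comp hA)

lemma graph_transition_source (κ : SignType) (Φ Ψ : R4 ≃ₗ[ℝ] R4) :
    ((graphChart κ Φ).symm.trans (graphChart κ Ψ)).source =
      graphTarget κ Φ ∩ ({y | 0 < minor Ψ (graphA Φ y) (graphB Φ y) 0 1} ∩
        (fun y => graphCoord (minor Ψ (graphA Φ y) (graphB Φ y))) ⁻¹' graphTarget κ Ψ) := by
  rw [PartialEquiv.trans_source]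
  ext y
  refine and_congr_right fun hy => ?_
  obtain ⟨c, hc, H⟩ := graphChart_symm_plucker (Ψ := Ψ) (κ := κ) (Φ := Φ) hy
  show (0 < plucker Ψ ((graphChart κ Φ).symm y) 0 1 ∧
    graphCoord (plucker Ψ ((graphChart κ Φ).symm y)) ∈ graphTarget κ Ψ) ↔ _
  rw [H, graphCoord_smul hc.ne']
  exact and_congr_left fun _ => mul_pos_iff_of_pos_left hc

lemma graph_transition_eqOn (κ : SignType) (Φ Ψ : R4 ≃ₗ[ℝ] R4) :
    Set.EqOn ((graphChart κ Φ).symm.trans (graphChart κ Ψ))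
      (fun y => graphCoord (minor Ψ (graphA Φ y) (graphB Φ y))) (graphTarget κ Φ) := by
  intro y hy
  obtain ⟨c, hc, H⟩ := graphChart_symm_plucker (Ψ := Ψ) (κ := κ) (Φ := Φ) hy
  show graphCoord (plucker Ψ ((graphChart κ Φ).symm y)) = _
  rw [H, graphCoord_smul hc.ne']

lemma contDiffOn_graph_transition (κ : SignType) (Φ Ψ : R4 ≃ₗ[ℝ] R4) :
    ContDiffOn ℝ ∞ ((graphChart κ Φ).symm.trans (graphChart κ Ψ))
      ((graphChart κ Φ).symm.trans (graphChart κ Ψ)).source := by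
  rw [graph_transition_source]
  refine ContDiffOn.congr ((contDiffOn_graphCoord Φ Ψ).mono fun y hy => hy.2.1) fun y hy =>
    graph_transition_eqOn κ Φ Ψ hy.1

lemma isOpen_graph_transition (κ : SignType) (Φ Ψ : R4 ≃ₗ[ℝ] R4) :
    IsOpen ((graphChart κ Φ).symm.trans (graphChart κ Ψ)).source := by
  rw [graph_transition_source]
  refine (isOpen_graphTarget κ Φ).inter ?_
  exact (contDiffOn_graphCoord Φ Ψ).continuousOn.isOpen_inter_preimage
    (isOpen_lt continuous_const (contDiff_minor_graph Φ Ψ 0 1).continuous)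
    (isOpen_graphTarget κ Ψ)

lemma IsFrame.linearIndependent {κ : SignType} {p v : R4} (h : IsFrame κ p v) :
    LinearIndependent ℝ ![p, v] := by
  rw [LinearIndependent.pair_iff]
  obtain ⟨⟨h1, _⟩, h3, h4⟩ := h
  have h3' : coform κ p v = 0 := h3
  intro s t hst
  have e1 : coform κ p (s • p + t • v) = s * coform κ p p + t * coform κ p v := by
    simp only [coform, Pi.add_apply, Pi.smul_apply, smul_eq_mul]; ring
  have hs : s = 0 := by
    rw [hst, h1, h3'] at e1
    simp [coform] at e1
    exact e1.symm
  subst hs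
  have e2 : form κ v ((0 : ℝ) • p + t • v) = t * form κ v v := by
    simp only [form, Pi.add_apply, Pi.smul_apply, smul_eq_mul]; ring
  rw [hst, h4] at e2
  simp [form] at e2
  exact ⟨rfl, e2.symm⟩

lemma exists_coordinates {p v : R4} (h : LinearIndependent ℝ ![p, v]) :
    ∃ Φ : R4 ≃ₗ[ℝ] R4, Φ p = ![1, 0, 0, 0] ∧ Φ v = ![0, 1, 0, 0] := by
  have : Fintype (Module.Basis.sumExtendIndex h) :=
    @Fintype.ofFinite _ (by
      have := Module.Finite.finite_basis (Module.Basis.sumExtend h)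
      exact Finite.of_injective (Sum.inr : _ → Fin 2 ⊕ Module.Basis.sumExtendIndex h)
        Sum.inr_injective)
  have hcard : Fintype.card (Module.Basis.sumExtendIndex h) = 2 := by
    have := Module.finrank_eq_card_basis (Module.Basis.sumExtend h)
    rw [Fintype.card_sum, Module.finrank_fin_fun, Fintype.card_fin] at this
    omega
  let e : Fin 2 ⊕ Module.Basis.sumExtendIndex h ≃ Fin 4 :=
    (Equiv.sumCongr (Equiv.refl _) (Fintype.equivFinOfCardEq hcard)).trans finSumFinEquiv
  let b := (Module.Basis.sumExtend h).reindex e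
  have b0 : b 0 = p := by
    have : e.symm 0 = Sum.inl 0 := by rw [Equiv.symm_apply_eq]; rfl
    show ((Module.Basis.sumExtend h).reindex e) 0 = p
    rw [Module.Basis.reindex_apply, this]
    simp [Module.Basis.sumExtend]
    rfl
  have b1 : b 1 = v := by
    have : e.symm 1 = Sum.inl 1 := by rw [Equiv.symm_apply_eq]; rfl
    show ((Module.Basis.sumExtend h).reindex e) 1 = v
    rw [Module.Basis.reindex_apply, this]
    simp [Module.Basis.sumExtend]
    rfl
  refine ⟨b.equivFun, ?_, ?_⟩
  · rw [← b0]; ext i; rw [Module.Basis.equivFun_self]; fin_cases i <;> simp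
  · rw [← b1]; ext i; rw [Module.Basis.equivFun_self]; fin_cases i <;> simp

lemma exists_mem_graphChart_source {κ : SignType} (ℓ : OrientedGeodesic κ) :
    ∃ Φ, ℓ ∈ (graphChart κ Φ).source := by
  obtain ⟨p, v, hf, rfl⟩ := exists_ofFrame ℓ
  obtain ⟨Φ, h1, h2⟩ := exists_coordinates hf.linearIndependent
  have e : plucker Φ (ofFrame hf) = minor Φ p v := by
    funext i j; exact plucker_ofFrame hf Φ i j
  have h0 : minor Φ p v 0 1 = 1 := by simp [minor, h1, h2]
  have hpos : 0 < minor Φ p v 0 1 := by rw [h0]; exact one_pos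
  refine ⟨Φ, ?_, ?_⟩
  · rw [e]; exact hpos
  · rw [e]
    have hA : graphA Φ (graphCoord (minor Φ p v)) = p := by
      rw [(graph_of_minor Φ hpos).1]; simp [h0, h1, h2]
    have hB : graphB Φ (graphCoord (minor Φ p v)) = v := by
      rw [(graph_of_minor Φ hpos).2]; simp [h0, h1, h2]
    have hp : coform κ p p = 1 := hf.1.1
    have hpv : coform κ p v = 0 := hf.2.1
    have hC : graphC κ Φ (graphCoord (minor Φ p v)) = v := by
      rw [graphC, hA, hB, hp, hpv]; simp
    refine ⟨?_, ?_, fun hκ => ?_⟩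
    · rw [hA, hp]; exact one_pos
    · rw [hC, hf.2.2]; exact one_pos
    · rw [hA]; exact hf.1.2 hκ

/-- The atlas of graph charts. -/
def geodesicAtlas (κ : SignType) : ChartedSpaceCore R4 (OrientedGeodesic κ) where
  atlas := Set.range (graphChart κ)
  chartAt ℓ := graphChart κ (exists_mem_graphChart_source ℓ).choose
  mem_chart_source ℓ := (exists_mem_graphChart_source ℓ).choose_spec
  chart_mem_atlas _ := ⟨_, rfl⟩
  open_source := by
    rintro _ _ ⟨Φ, rfl⟩ ⟨Ψ, rfl⟩
    exact isOpen_graph_transition κ Φ Ψ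
  continuousOn_toFun := by
    rintro _ _ ⟨Φ, rfl⟩ ⟨Ψ, rfl⟩
    exact (contDiffOn_graph_transition κ Φ Ψ).continuousOn

instance instTopologicalSpaceOrientedGeodesic (κ : SignType) :
    TopologicalSpace (OrientedGeodesic κ) :=
  (geodesicAtlas κ).toTopologicalSpace

instance instChartedSpaceOrientedGeodesic (κ : SignType) :
    ChartedSpace R4 (OrientedGeodesic κ) :=
  (geodesicAtlas κ).toChartedSpace

/-- `𝒢_κ` is a smooth four-dimensional manifold. -/
instance instIsManifoldOrientedGeodesic (κ : SignType) :
    IsManifold 𝓘(ℝ, R4) ∞ (OrientedGeodesic κ) := by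
  refine isManifold_of_contDiffOn 𝓘(ℝ, R4) ∞ (OrientedGeodesic κ) ?_
  intro e e' he he'
  have he : e ∈ ⋃ (f : PartialEquiv (OrientedGeodesic κ) R4) (hf : f ∈ (geodesicAtlas κ).atlas),
    {(geodesicAtlas κ).openPartialHomeomorph f hf} := he
  have he' : e' ∈ ⋃ (f : PartialEquiv (OrientedGeodesic κ) R4) (hf : f ∈ (geodesicAtlas κ).atlas),
    {(geodesicAtlas κ).openPartialHomeomorph f hf} := he'
  simp only [Set.mem_iUnion, Set.mem_singleton_iff] at he he'
  obtain ⟨_, ⟨Φ, rfl⟩, rfl⟩ := he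
  obtain ⟨_, ⟨Ψ, rfl⟩, rfl⟩ := he'
  have := contDiffOn_graph_transition κ Φ Ψ
  simp only [mfld_simps] at this ⊢
  exact this

/-! ### Control systems -/

/-- The velocity of a curve, as an element of the tangent bundle. -/
def velocity {E : Type*} [NormedAddCommGroup E] [NormedSpace ℝ E] {N : Type*} [TopologicalSpace N]
    [ChartedSpace E N] (γ : ℝ → N) (t : ℝ) : TangentBundle 𝓘(ℝ, E) N :=
  ⟨γ t, mfderiv 𝓘(ℝ, ℝ) 𝓘(ℝ, E) γ t (1 : ℝ)⟩

/-- `γ` is a smooth curve on the open interval `I` whose velocities all lie in `𝒜 ⊆ TN`. -/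
def IsAdmissibleCurve {E : Type*} [NormedAddCommGroup E] [NormedSpace ℝ E] {N : Type*}
    [TopologicalSpace N] [ChartedSpace E N] (𝒜 : Set (TangentBundle 𝓘(ℝ, E) N)) (I : Set ℝ)
    (γ : ℝ → N) : Prop :=
  IsOpen I ∧ I.OrdConnected ∧ ContMDiffOn 𝓘(ℝ, ℝ) 𝓘(ℝ, E) ∞ γ I ∧ ∀ t ∈ I, velocity γ t ∈ 𝒜

/-- `x` and `y` are joined by a piecewise admissible curve: a continuous curve on a compact
interval with a partition `t 0 < t 1 < ⋯ < t n` such that on each `[t i, t (i + 1)]` it is the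
restriction of an admissible curve defined on an open interval. -/
def PiecewiseJoined {E : Type*} [NormedAddCommGroup E] [NormedSpace ℝ E] {N : Type*}
    [TopologicalSpace N] [ChartedSpace E N] (𝒜 : Set (TangentBundle 𝓘(ℝ, E) N)) (x y : N) :
    Prop :=
  ∃ (n : ℕ) (t : ℕ → ℝ) (γ : ℝ → N), 0 < n ∧ (∀ i < n, t i < t (i + 1)) ∧
    ContinuousOn γ (Set.Icc (t 0) (t n)) ∧ γ (t 0) = x ∧ γ (t n) = y ∧
    ∀ i < n, ∃ (I : Set ℝ) (δ : ℝ → N), IsAdmissibleCurve 𝒜 I δ ∧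
      Set.Icc (t i) (t (i + 1)) ⊆ I ∧ Set.EqOn γ δ (Set.Icc (t i) (t (i + 1)))

/-- Any two points are joined by a piecewise admissible curve. -/
def IsControllable {E : Type*} [NormedAddCommGroup E] [NormedSpace ℝ E] {N : Type*}
    [TopologicalSpace N] [ChartedSpace E N] (𝒜 : Set (TangentBundle 𝓘(ℝ, E) N)) : Prop :=
  ∀ x y : N, PiecewiseJoined 𝒜 x y

/-- A subset of a real vector space is substantial if no proper affine subspace contains it. -/
def IsSubstantial {V : Type*} [AddCommGroup V] [Module ℝ V] (S : Set V) : Prop :=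
  ∀ F : AffineSubspace ℝ V, S ⊆ (F : Set V) → F = ⊤

/-! ### The helicoidal control system -/

/-- `w = u × v` for orthonormal `u, v ∈ T_p M_κ`: the unit vector of `T_p M_κ` that is orthogonal
to `u` and `v` and for which `(p, u, v, w)` is a positively oriented basis of `ℝ⁴`. -/
def IsCross (κ : SignType) (p u v w : R4) : Prop :=
  w ∈ TangentTo κ p ∧ form κ w u = 0 ∧ form κ w v = 0 ∧ form κ w w = 1 ∧
    0 < (Matrix.of ![p, u, v, w]).det

/-- `φ` is the `α`-helicoidal parametrized surface with initial ray `ℓ ∋ p` and axis `γ_A`, where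
`A` is a unit tangent vector at `p` orthogonal to `ℓ`.  Here `σ` is the parametrization of `ℓ`
with `σ 0 = p`, `B = A × σ'(0)`, `c = γ_A`, and `V`, `W` are the parallel fields along `c` with
initial values `σ'(0)` and `B`; the ray `s ↦ φ s t` is the geodesic whose initial velocity is
`cos (α t) V t + sin (α t) W t`. -/
def IsHelicoidalSurface (κ : SignType) (α : ℝ) (ℓ : OrientedGeodesic κ) (p A : R4)
    (φ : ℝ → ℝ → R4) : Prop :=
  ∃ (σ c V W : ℝ → R4) (B : R4),
    Parametrizes σ ℓ ∧ σ 0 = p ∧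
    A ∈ TangentTo κ p ∧ form κ A A = 1 ∧ form κ A (deriv σ 0) = 0 ∧
    IsCross κ p A (deriv σ 0) B ∧
    IsUnitGeodesic κ c ∧ c 0 = p ∧ deriv c 0 = A ∧
    IsParallelAlong κ c V ∧ V 0 = deriv σ 0 ∧
    IsParallelAlong κ c W ∧ W 0 = B ∧
    ∀ t, IsGeodesic κ (fun s => φ s t) ∧ φ 0 t = c t ∧
      deriv (fun s => φ s t) 0 = Real.cos (α * t) • V t + Real.sin (α * t) • W t

/-- `Γ` is the `α`-helicoidal curve in `𝒢_κ` with initial ray `ℓ ∋ p` and axis `γ_A`. -/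
def IsHelicoidalCurve (κ : SignType) (α : ℝ) (ℓ : OrientedGeodesic κ) (p A : R4)
    (Γ : ℝ → OrientedGeodesic κ) : Prop :=
  ∃ φ, IsHelicoidalSurface κ α ℓ p A φ ∧ ∀ t, Parametrizes (fun s => φ s t) (Γ t)

/-- The set `𝒜_κ^α ⊆ T𝒢_κ` of initial velocities of `α`-helicoidal curves. -/
def helicoidalSystem (κ : SignType) (α : ℝ) :
    Set (TangentBundle 𝓘(ℝ, R4) (OrientedGeodesic κ)) :=
  {X | ∃ (ℓ : OrientedGeodesic κ) (p A : R4) (Γ : ℝ → OrientedGeodesic κ),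
    IsHelicoidalCurve κ α ℓ p A Γ ∧ X = velocity Γ 0}

/-- The fiber of `𝒜_κ^α` over `ℓ`. -/
def helicoidalFiber (κ : SignType) (α : ℝ) (ℓ : OrientedGeodesic κ) :
    Set (TangentSpace 𝓘(ℝ, R4) ℓ) :=
  {v | (⟨ℓ, v⟩ : TangentBundle 𝓘(ℝ, R4) (OrientedGeodesic κ)) ∈ helicoidalSystem κ α}

/-! ### Parallel lines and Hopf fibrations -/

/-- Two oriented lines of Euclidean space are parallel, with the same orientation. -/
def AreParallel (ℓ ℓ' : OrientedGeodesic 0) : Prop :=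
  ∃ (σ τ : ℝ → R4) (_ : Parametrizes σ ℓ) (_ : Parametrizes τ ℓ'), deriv σ 0 = deriv τ 0

/-- Multiplication by a complex number on `ℂ² = ℝ⁴`, where `x` stands for
`(x₀ + i x₁, x₂ + i x₃)`. -/
def complexMul (z : ℂ) (x : R4) : R4 :=
  ![z.re * x 0 - z.im * x 1, z.re * x 1 + z.im * x 0,
    z.re * x 2 - z.im * x 3, z.re * x 3 + z.im * x 2]

/-- `H` is the set of fibers of a Hopf fibration of the sphere: the image under an isometry
`g ∈ O(4)` of the set of all great circles `s ↦ e^{is} q`. -/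
def IsHopfFibration (H : Set (OrientedGeodesic 1)) : Prop :=
  ∃ g ∈ Matrix.orthogonalGroup (Fin 4) ℝ,
    H = {ℓ | ∃ q ∈ SpaceForm 1,
      Parametrizes (fun s : ℝ => g.mulVec (complexMul (Complex.exp (s * Complex.I)) q)) ℓ}

end Helicoidal

end

open Helicoidal

/-!
# The helicoidal control system on the space of oriented geodesics

A frame `(p, A, v, B)`, formed by a point of `M_κ` and a positively oriented orthonormal basis of
its tangent space, determines the geodesic `[p, v]` and, by the screw motion `helix` along `A`, an
`α`-helicoidal curve that starts at it. Since a vector orthogonal to a geodesic is constant under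
parallel transport, as a vector of `ℝ⁴`, every helicoidal curve has this form
(`IsHelicoidalCurve.exists_frame`), and each of its arcs is admissible
(`isAdmissibleCurve_helix`). The frames of the same geodesic are obtained from each other by the
screw motions `turn` along `v`.

The initial velocity is the bivector `A ∧ v + α p ∧ B`. As `(p, A)` varies over the frames of a fixed
geodesic, these velocities span the tangent space whenever `α² ≠ κ`
(`eq_top_of_helixVelocity_mem`). They are symmetric about the origin, so the fibers are then
substantial (`isSubstantial_helicoidalFiber`). Moreover a composition of four helicoidal arcs depends
submersively on the four times, so that the sets of points that can be reached from a given one are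
open and closed (`isClopen_piecewiseJoined`), and the space of geodesics is connected
(`mem_of_isClopen`); this gives controllability.

If `α² = κ`, so that `κ = α = 0` or `κ = 1`, `α = ±1`, three components of `m - α ⋆m`, where
`m = p ∧ v`, are conserved (`IsAdmissibleCurve.dualityDefect_eq`), because `p ∧ B = ⋆(A ∧ v)` for
`κ = 1`, and because `A` and `v` have no component along the first coordinate axis for `κ = 0`.
As they are not locally constant functions, the system is not controllable and its fibers are not
all substantial. For `κ = 0` the conserved quantity is the direction of the line. For `κ = 1` it is
a unit imaginary quaternion `a` such that `v = p a` or `v = a p`, so that the great circle is an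
orbit of the complex structure `x ↦ x a` or `x ↦ a x`, that is, a fiber of a Hopf fibration.
-/

namespace Helicoidal

/-! ### Adapted frames -/

lemma form_comm (κ : SignType) (x y : R4) : form κ x y = form κ y x := by
  simp only [form]; ring

lemma coform_comm (κ : SignType) (x y : R4) : coform κ x y = coform κ y x := by
  simp only [coform]; ring

lemma form_add_left (κ : SignType) (x y z : R4) : form κ (x + y) z = form κ x z + form κ y z := by
  simp only [form, Pi.add_apply]; ring

lemma form_add_right (κ : SignType) (x y z : R4) : form κ x (y + z) = form κ x y + form κ x z := by
  simp only [form, Pi.add_apply]; ring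

lemma form_smul_left (κ : SignType) (a : ℝ) (x y : R4) : form κ (a • x) y = a * form κ x y := by
  simp only [form, Pi.smul_apply, smul_eq_mul]; ring

lemma form_smul_right (κ : SignType) (a : ℝ) (x y : R4) : form κ x (a • y) = a * form κ x y := by
  simp only [form, Pi.smul_apply, smul_eq_mul]; ring

lemma coform_add_left (κ : SignType) (x y z : R4) :
    coform κ (x + y) z = coform κ x z + coform κ y z := by
  simp only [coform, Pi.add_apply]; ring

lemma coform_add_right (κ : SignType) (x y z : R4) :
    coform κ x (y + z) = coform κ x y + coform κ x z := by
  simp only [coform, Pi.add_apply]; ring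

lemma coform_smul_left (κ : SignType) (a : ℝ) (x y : R4) :
    coform κ (a • x) y = a * coform κ x y := by
  simp only [coform, Pi.smul_apply, smul_eq_mul]; ring

lemma coform_smul_right (κ : SignType) (a : ℝ) (x y : R4) :
    coform κ x (a • y) = a * coform κ x y := by
  simp only [coform, Pi.smul_apply, smul_eq_mul]; ring

/-- A quadruple `(p, A, v, B)` of vectors of `ℝ⁴`. -/
abbrev Tetrad : Type := R4 × R4 × R4 × R4

/-- `(p, A, v, B)` consists of a point `p ∈ M_κ` and a positively oriented orthonormal basis
`A, v, B` of the tangent space at `p`; these are the frames with `B = A × v`. -/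
structure IsAdapted (κ : SignType) (f : Tetrad) : Prop where
  mem : f.1 ∈ SpaceForm κ
  tA : coform κ f.1 f.2.1 = 0
  tv : coform κ f.1 f.2.2.1 = 0
  tB : coform κ f.1 f.2.2.2 = 0
  AA : form κ f.2.1 f.2.1 = 1
  vv : form κ f.2.2.1 f.2.2.1 = 1
  BB : form κ f.2.2.2 f.2.2.2 = 1
  Av : form κ f.2.1 f.2.2.1 = 0
  AB : form κ f.2.1 f.2.2.2 = 0
  vB : form κ f.2.2.1 f.2.2.2 = 0
  det : 0 < (Matrix.of ![f.1, f.2.1, f.2.2.1, f.2.2.2]).det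

/-- The screw motion of a frame along its vector `A`: the point moves by `s` along the geodesic
with velocity `A`, the plane spanned by `v, B` turns by the angle `φ`. -/
noncomputable def screw (κ : SignType) (s φ : ℝ) (f : Tetrad) : Tetrad :=
  (cosK κ s • f.1 + sinK κ s • f.2.1, -((κ : ℝ) * sinK κ s) • f.1 + cosK κ s • f.2.1,
    Real.cos φ • f.2.2.1 + Real.sin φ • f.2.2.2, -Real.sin φ • f.2.2.1 + Real.cos φ • f.2.2.2)

/-- The screw motion of a frame along its vector `v`: the point moves by `s` along the geodesic
with velocity `v`, the plane spanned by `A, B` turns by the angle `θ`.  It does not move the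
oriented geodesic with initial data `p, v`. -/
noncomputable def turn (κ : SignType) (s θ : ℝ) (f : Tetrad) : Tetrad :=
  (cosK κ s • f.1 + sinK κ s • f.2.2.1, -Real.sin θ • f.2.2.2 + Real.cos θ • f.2.1,
    -((κ : ℝ) * sinK κ s) • f.1 + cosK κ s • f.2.2.1,
    Real.cos θ • f.2.2.2 + Real.sin θ • f.2.1)

/-- The motion of a frame along the `α`-helicoidal curve that it determines. -/
noncomputable def helix (κ : SignType) (α t : ℝ) (f : Tetrad) : Tetrad := screw κ t (α * t) f

lemma cosK_add (κ : SignType) (s t : ℝ) :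
    cosK κ (s + t) = cosK κ s * cosK κ t - (κ : ℝ) * sinK κ s * sinK κ t := by
  cases κ
  · simp [cosK]
  · simp [cosK, sinK, Real.cosh_add]
  · simp [cosK, sinK, Real.cos_add]

lemma sinK_add (κ : SignType) (s t : ℝ) :
    sinK κ (s + t) = sinK κ s * cosK κ t + cosK κ s * sinK κ t := by
  cases κ
  · simp [cosK, sinK]
  · simp [cosK, sinK, Real.sinh_add]
  · simp [cosK, sinK, Real.sin_add]

lemma cosK_neg (κ : SignType) (s : ℝ) : cosK κ (-s) = cosK κ s := by
  cases κ <;> simp [cosK]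

lemma sinK_neg (κ : SignType) (s : ℝ) : sinK κ (-s) = -sinK κ s := by
  cases κ <;> simp [sinK]

lemma sinK_one_ne_zero (κ : SignType) : sinK κ 1 ≠ 0 := by
  cases κ
  · exact one_ne_zero
  · exact (Real.sinh_pos_iff.2 one_pos).ne'
  · exact (Real.sin_pos_of_pos_of_le_one one_pos le_rfl).ne'

lemma screw_screw (κ : SignType) (s φ s' φ' : ℝ) (f : Tetrad) :
    screw κ s φ (screw κ s' φ' f) = screw κ (s + s') (φ + φ') f := by
  simp only [screw, cosK_add, sinK_add, Real.cos_add, Real.sin_add, Prod.mk.injEq]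
  refine ⟨?_, ?_, ?_, ?_⟩ <;> module

lemma screw_zero (κ : SignType) (f : Tetrad) : screw κ 0 0 f = f := by
  simp [screw, cosK_zero, sinK_zero]

lemma helix_helix (κ : SignType) (α s t : ℝ) (f : Tetrad) :
    helix κ α s (helix κ α t f) = helix κ α (s + t) f := by
  simp only [helix, screw_screw]; congr 1; ring

lemma helix_zero (κ : SignType) (α : ℝ) (f : Tetrad) : helix κ α 0 f = f := by
  simp [helix, screw_zero]

/-- The cyclic permutation `(p, A, v, B) ↦ (p, v, B, A)`. -/
def cyc (f : Tetrad) : Tetrad := (f.1, f.2.2.1, f.2.2.2, f.2.1)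

lemma cyc_turn (κ : SignType) (s θ : ℝ) (f : Tetrad) :
    cyc (turn κ s θ f) = screw κ s θ (cyc f) := rfl

lemma cyc_cyc_cyc (f : Tetrad) : cyc (cyc (cyc f)) = f := rfl

lemma turn_turn (κ : SignType) (s θ s' θ' : ℝ) (f : Tetrad) :
    turn κ s θ (turn κ s' θ' f) = turn κ (s + s') (θ + θ') f := by
  rw [← cyc_cyc_cyc (turn κ s θ _), cyc_turn, cyc_turn, screw_screw, ← cyc_turn, cyc_cyc_cyc]

lemma turn_zero (κ : SignType) (f : Tetrad) : turn κ 0 0 f = f := by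
  simp [turn, cosK_zero, sinK_zero]

namespace IsAdapted

variable {κ : SignType} {f : Tetrad}

lemma isFrame (h : IsAdapted κ f) : IsFrame κ f.1 f.2.2.1 := ⟨h.mem, h.tv, h.vv⟩

lemma cyc (h : IsAdapted κ f) : IsAdapted κ (cyc f) := by
  obtain ⟨h1, h2, h3, h4, h5, h6, h7, h8, h9, h10, h11⟩ := h
  refine ⟨h1, h3, h4, h2, h6, h7, h5, h10, ?_, ?_, ?_⟩
  · exact (form_comm _ _ _).trans h8
  · exact (form_comm _ _ _).trans h9
  · convert h11 using 1
    simp [Matrix.det_succ_row_zero, Fin.sum_univ_succ, Helicoidal.cyc, Fin.succAbove]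
    ring

lemma coform_of_tangent {p x y : R4} (hp : p ∈ SpaceForm κ) (hx : coform κ p x = 0)
    (hxy : form κ x y = 0) : coform κ x y = 0 := by
  obtain ⟨-, h⟩ := hp
  simp only [coform, form] at *
  cases κ
  · have h0 : p 0 ≠ 0 := (h (by decide)).ne'
    simp only [cast_zero', zero_mul, add_zero] at *
    rw [(mul_eq_zero.1 hx).resolve_left h0, zero_mul]
  · simp only [cast_neg'] at *; linarith
  · simp only [cast_pos'] at *; linarith

lemma form_smul_tangent {p w : R4} (h : coform κ p w = 0) : (κ : ℝ) * form κ p w = 0 := by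
  simp only [coform, form] at *
  cases κ
  · simp
  · simp only [cast_neg'] at *; linarith
  · simp only [cast_pos'] at *; linarith

lemma screw (h : IsAdapted κ f) (s φ : ℝ) : IsAdapted κ (screw κ s φ f) := by
  obtain ⟨h1, h2, h3, h4, h5, h6, h7, h8, h9, h10, h11⟩ := h
  have hg := (isUnitGeodesic_geod h1 h2 h5).isFrame s
  rw [deriv_geod] at hg
  have hAv : coform κ f.2.1 f.2.2.1 = 0 := coform_of_tangent h1 h2 h8
  have hAB : coform κ f.2.1 f.2.2.2 = 0 := coform_of_tangent h1 h2 h9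
  have kv := form_smul_tangent h3
  have kB := form_smul_tangent h4
  have hBv := (form_comm _ _ _).trans h10
  have tr := Real.sin_sq_add_cos_sq φ
  refine ⟨hg.1, hg.2.1, ?_, ?_, hg.2.2, ?_, ?_, ?_, ?_, ?_, ?_⟩
  · simp only [Helicoidal.screw, coform_add_left, coform_add_right, coform_smul_left,
      coform_smul_right, h3, h4, hAv, hAB]; ring
  · simp only [Helicoidal.screw, coform_add_left, coform_add_right, coform_smul_left,
      coform_smul_right, h3, h4, hAv, hAB]; ring
  · simp only [Helicoidal.screw, form_add_left, form_add_right, form_smul_left,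
      form_smul_right, h6, h7, h10, hBv]; linear_combination tr
  · simp only [Helicoidal.screw, form_add_left, form_add_right, form_smul_left,
      form_smul_right, h6, h7, h10, hBv]; linear_combination tr
  · simp only [Helicoidal.screw, form_add_left, form_add_right, form_smul_left,
      form_smul_right, h8, h9]
    linear_combination (-sinK κ s * Real.cos φ) * kv + (-sinK κ s * Real.sin φ) * kB
  · simp only [Helicoidal.screw, form_add_left, form_add_right, form_smul_left,
      form_smul_right, h8, h9]
    linear_combination (sinK κ s * Real.sin φ) * kv + (-sinK κ s * Real.cos φ) * kB
  · simp only [Helicoidal.screw, form_add_left, form_add_right, form_smul_left,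
      form_smul_right, h6, h7, h10, hBv]; ring
  · have e : Matrix.of ![cosK κ s • f.1 + sinK κ s • f.2.1,
        -((κ : ℝ) * sinK κ s) • f.1 + cosK κ s • f.2.1,
        Real.cos φ • f.2.2.1 + Real.sin φ • f.2.2.2,
        -Real.sin φ • f.2.2.1 + Real.cos φ • f.2.2.2] =
        !![cosK κ s, sinK κ s, 0, 0; -((κ : ℝ) * sinK κ s), cosK κ s, 0, 0;
          0, 0, Real.cos φ, Real.sin φ; 0, 0, -Real.sin φ, Real.cos φ] *
        Matrix.of ![f.1, f.2.1, f.2.2.1, f.2.2.2] := by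
      ext i j
      fin_cases i <;> simp [Matrix.mul_apply, Fin.sum_univ_four]
    have d : (!![cosK κ s, sinK κ s, 0, 0; -((κ : ℝ) * sinK κ s), cosK κ s, 0, 0;
          0, 0, Real.cos φ, Real.sin φ; 0, 0, -Real.sin φ, Real.cos φ]).det = 1 := by
      simp [Matrix.det_succ_row_zero, Fin.sum_univ_succ, Fin.succAbove]
      linear_combination (Real.cos φ ^ 2 + Real.sin φ ^ 2) * cosK_sq κ s + tr
    show 0 < (Matrix.of ![cosK κ s • f.1 + sinK κ s • f.2.1,
        -((κ : ℝ) * sinK κ s) • f.1 + cosK κ s • f.2.1,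
        Real.cos φ • f.2.2.1 + Real.sin φ • f.2.2.2,
        -Real.sin φ • f.2.2.1 + Real.cos φ • f.2.2.2]).det
    rw [e, Matrix.det_mul, d, one_mul]
    exact h11

lemma turn (h : IsAdapted κ f) (s θ : ℝ) : IsAdapted κ (turn κ s θ f) := by
  rw [← cyc_cyc_cyc (Helicoidal.turn κ s θ f), cyc_turn]
  exact (h.cyc.screw s θ).cyc.cyc

lemma helix (h : IsAdapted κ f) (α t : ℝ) : IsAdapted κ (helix κ α t f) := h.screw _ _

end IsAdapted

/-- A non-zero solution of three linear equations in `ℝ⁴`. -/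
lemma exists_ne_zero_of_three (a b c : R4) :
    ∃ w : R4, w ≠ 0 ∧ a ⬝ᵥ w = 0 ∧ b ⬝ᵥ w = 0 ∧ c ⬝ᵥ w = 0 := by
  have hd : (Matrix.of ![a, b, c, 0]).det = 0 :=
    Matrix.det_eq_zero_of_row_eq_zero 3 fun j => by simp
  obtain ⟨w, hw, h⟩ := Matrix.exists_mulVec_eq_zero_iff.2 hd
  exact ⟨w, hw, congrFun h 0, congrFun h 1, congrFun h 2⟩

lemma form_eq_dotProduct (κ : SignType) (x y : R4) :
    form κ x y = ![(κ : ℝ) * x 0, x 1, x 2, x 3] ⬝ᵥ y := by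
  simp [form, dotProduct, Fin.sum_univ_four]; ring

lemma coform_eq_dotProduct (κ : SignType) (x y : R4) :
    coform κ x y = ![x 0, (κ : ℝ) * x 1, (κ : ℝ) * x 2, (κ : ℝ) * x 3] ⬝ᵥ y := by
  simp [coform, dotProduct, Fin.sum_univ_four]; ring

lemma form_self_pos {κ : SignType} {p w : R4} (hp : p ∈ SpaceForm κ)
    (hw : coform κ p w = 0) (h0 : w ≠ 0) : 0 < form κ w w := by
  refine lt_of_le_of_ne ?_ fun h => h0 (eq_zero_of_form_self hp hw h.symm)
  obtain ⟨h1, h2⟩ := hp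
  simp only [coform, form] at *
  cases κ
  · simp only [cast_zero']
    nlinarith [mul_self_nonneg (w 1), mul_self_nonneg (w 2), mul_self_nonneg (w 3)]
  · have h0 : 0 < p 0 := h2 (by decide)
    simp only [cast_neg'] at *
    have e1 : p 0 * w 0 = p 1 * w 1 + p 2 * w 2 + p 3 * w 3 := by linarith
    have e2 : p 0 * p 0 = 1 + (p 1 * p 1 + p 2 * p 2 + p 3 * p 3) := by linarith
    have cs : (p 1 * w 1 + p 2 * w 2 + p 3 * w 3) ^ 2 ≤
        (p 1 * p 1 + p 2 * p 2 + p 3 * p 3) * (w 1 * w 1 + w 2 * w 2 + w 3 * w 3) := by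
      nlinarith [sq_nonneg (p 1 * w 2 - p 2 * w 1), sq_nonneg (p 1 * w 3 - p 3 * w 1),
        sq_nonneg (p 2 * w 3 - p 3 * w 2)]
    rw [← e1] at cs
    have hw0 : 0 ≤ w 1 * w 1 + w 2 * w 2 + w 3 * w 3 := by
      nlinarith [mul_self_nonneg (w 1), mul_self_nonneg (w 2), mul_self_nonneg (w 3)]
    have hp0 : 0 < p 0 * p 0 := by positivity
    have : (p 0 * p 0) * (w 0 * w 0) ≤ (p 0 * p 0) * (w 1 * w 1 + w 2 * w 2 + w 3 * w 3) := by
      nlinarith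
    have := le_of_mul_le_mul_left this hp0
    linarith
  · simp only [cast_pos']
    nlinarith [mul_self_nonneg (w 0), mul_self_nonneg (w 1), mul_self_nonneg (w 2),
      mul_self_nonneg (w 3)]

/-- A unit tangent vector orthogonal to two given vectors. -/
lemma exists_unit_orthogonal {κ : SignType} {p : R4} (hp : p ∈ SpaceForm κ) (u v : R4) :
    ∃ w, coform κ p w = 0 ∧ form κ u w = 0 ∧ form κ v w = 0 ∧ form κ w w = 1 := by
  obtain ⟨w, hw, h1, h2, h3⟩ := exists_ne_zero_of_three
    ![p 0, (κ : ℝ) * p 1, (κ : ℝ) * p 2, (κ : ℝ) * p 3] ![(κ : ℝ) * u 0, u 1, u 2, u 3]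
    ![(κ : ℝ) * v 0, v 1, v 2, v 3]
  rw [← coform_eq_dotProduct] at h1
  rw [← form_eq_dotProduct] at h2 h3
  have hpos := form_self_pos hp h1 hw
  refine ⟨(√(form κ w w))⁻¹ • w, ?_, ?_, ?_, ?_⟩
  · rw [coform_smul_right, h1, mul_zero]
  · rw [form_smul_right, h2, mul_zero]
  · rw [form_smul_right, h3, mul_zero]
  · rw [form_smul_left, form_smul_right, ← mul_assoc, ← mul_inv, Real.mul_self_sqrt hpos.le,
      inv_mul_cancel₀ hpos.ne']

/-- Every unit tangent vector is the third vector of an adapted frame. -/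
lemma exists_isAdapted {κ : SignType} {p v : R4} (h : IsFrame κ p v) :
    ∃ A B, IsAdapted κ (p, A, v, B) := by
  obtain ⟨hp, hv, hu⟩ := h
  have hv : coform κ p v = 0 := hv
  obtain ⟨A, hA, hvA, -, hAA⟩ := exists_unit_orthogonal hp v v
  obtain ⟨B, hB, hAB, hvB, hBB⟩ := exists_unit_orthogonal hp A v
  have hAv := (form_comm _ _ _).trans hvA
  have hBA := (form_comm _ _ _).trans hAB
  have hBv := (form_comm _ _ _).trans hvB
  have hne : (Matrix.of ![p, A, v, B]).det ≠ 0 := by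
    intro h0
    obtain ⟨c, hc, h⟩ := Matrix.exists_vecMul_eq_zero_iff.2 h0
    have h : c 0 • p + c 1 • A + c 2 • v + c 3 • B = 0 := by
      rw [← h]; ext j; simp [Matrix.vecMul, dotProduct, Fin.sum_univ_four]
    have z : ∀ x, form κ x 0 = 0 := by intro x; simp [form]
    have z' : ∀ x, coform κ x 0 = 0 := by intro x; simp [coform]
    have c0 : c 0 = 0 := by
      have := z' p
      rw [← h] at this
      simpa only [coform_add_right, coform_smul_right, hp.1, hA, hv, hB, mul_zero, mul_one,
        add_zero] using this
    rw [c0, zero_smul, zero_add] at h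
    have c1 : c 1 = 0 := by
      have := z A
      rw [← h] at this
      simpa only [form_add_right, form_smul_right, hAA, hAv, hAB, mul_zero, mul_one,
        add_zero] using this
    have c2 : c 2 = 0 := by
      have := z v
      rw [← h] at this
      simpa only [form_add_right, form_smul_right, hvA, hu, hvB, mul_zero, mul_one,
        add_zero, zero_add] using this
    have c3 : c 3 = 0 := by
      have := z B
      rw [← h] at this
      simpa only [form_add_right, form_smul_right, hBA, hBv, hBB, mul_zero, mul_one,
        zero_add] using this
    exact hc (by ext i; fin_cases i <;> assumption)
  rcases lt_or_gt_of_ne hne with hlt | hgt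
  · refine ⟨A, (-1 : ℝ) • B, hp, hA, hv, ?_, hAA, hu, ?_, hAv, ?_, ?_, ?_⟩
    · simp only [coform_smul_right, hB, mul_zero]
    · simp only [form_smul_left, form_smul_right, hBB]; norm_num
    · simp only [form_smul_right, hAB, mul_zero]
    · simp only [form_smul_right, hvB, mul_zero]
    · have : (Matrix.of ![p, A, v, (-1 : ℝ) • B]).det = -(Matrix.of ![p, A, v, B]).det := by
        simp [Matrix.det_succ_row_zero, Fin.sum_univ_succ, Fin.succAbove]
        ring
      show 0 < (Matrix.of ![p, A, v, (-1 : ℝ) • B]).det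
      rw [this]; linarith
  · exact ⟨A, B, hp, hA, hv, hB, hAA, hu, hBB, hAv, hAB, hvB, hgt⟩

/-! ### Smooth curves in the space of oriented geodesics -/

lemma isFrame_standard (κ : SignType) : IsFrame κ ![1, 0, 0, 0] ![0, 1, 0, 0] :=
  ⟨by simp [SpaceForm, coform], by simp [TangentTo, coform], by simp [form]⟩

open Classical in
/-- The oriented geodesic with initial data `p, v`; a fixed geodesic if `p, v` are not the initial
data of a unit speed geodesic. -/
noncomputable def geodOf (κ : SignType) (p v : R4) : OrientedGeodesic κ :=
  if h : IsFrame κ p v then ofFrame h else ofFrame (isFrame_standard κ)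

lemma geodOf_eq {κ : SignType} {p v : R4} (h : IsFrame κ p v) : geodOf κ p v = ofFrame h :=
  dif_pos h

lemma exists_geodOf {κ : SignType} (ℓ : OrientedGeodesic κ) :
    ∃ p v, IsFrame κ p v ∧ geodOf κ p v = ℓ := by
  obtain ⟨p, v, h, rfl⟩ := exists_ofFrame ℓ
  exact ⟨p, v, h, geodOf_eq h⟩

lemma plucker_geodOf {κ : SignType} {p v : R4} (h : IsFrame κ p v) (Φ : R4 ≃ₗ[ℝ] R4) :
    plucker Φ (geodOf κ p v) = minor Φ p v := by
  rw [geodOf_eq h]; funext i j; exact plucker_ofFrame h Φ i j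

/-- The graph coordinates of the oriented plane spanned by a pair of vectors. -/
noncomputable def planeCoord (Φ : R4 ≃ₗ[ℝ] R4) (q : R4 × R4) : R4 := graphCoord (minor Φ q.1 q.2)

lemma contDiff_minor (Φ : R4 ≃ₗ[ℝ] R4) (i j : Fin 4) :
    ContDiff ℝ ∞ fun q : R4 × R4 => minor Φ q.1 q.2 i j := by
  have h : ContDiff ℝ ∞ Φ := (LinearMap.toContinuousLinearMap Φ.toLinearMap).contDiff
  have h1 : ContDiff ℝ ∞ fun q : R4 × R4 => Φ q.1 := h.comp contDiff_fst
  have h2 : ContDiff ℝ ∞ fun q : R4 × R4 => Φ q.2 := h.comp contDiff_snd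
  rw [contDiff_pi] at h1 h2
  exact ((h1 i).mul (h2 j)).sub ((h1 j).mul (h2 i))

lemma contDiffAt_planeCoord (Φ : R4 ≃ₗ[ℝ] R4) {q : R4 × R4} (hq : 0 < minor Φ q.1 q.2 0 1) :
    ContDiffAt ℝ ∞ (planeCoord Φ) q := by
  have hd := fun i j => (contDiff_minor Φ i j).contDiffAt.div
    (contDiff_minor Φ 0 1).contDiffAt hq.ne'
  refine contDiffAt_pi.2 fun i => ?_
  fin_cases i
  · exact hd 2 1
  · exact hd 3 1
  · exact hd 0 2
  · exact hd 0 3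

/-- The linear coordinates of the chart at `ℓ`. -/
noncomputable def chartBasis {κ : SignType} (ℓ : OrientedGeodesic κ) : R4 ≃ₗ[ℝ] R4 :=
  (exists_mem_graphChart_source ℓ).choose

lemma chartAt_apply {κ : SignType} (ℓ ℓ' : OrientedGeodesic κ) :
    chartAt R4 ℓ ℓ' = graphCoord (plucker (chartBasis ℓ) ℓ') := rfl

lemma chartAt_source {κ : SignType} (ℓ : OrientedGeodesic κ) :
    (chartAt R4 ℓ).source = (graphChart κ (chartBasis ℓ)).source := rfl

lemma minor_chartBasis_pos {κ : SignType} {p v : R4} (h : IsFrame κ p v) :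
    0 < minor (chartBasis (geodOf κ p v)) p v 0 1 := by
  have := (mem_chart_source R4 (geodOf κ p v))
  rw [chartAt_source] at this
  rw [← plucker_geodOf h]
  exact this.1

lemma chartAt_geodOf {κ : SignType} (ℓ : OrientedGeodesic κ) {p v : R4} (h : IsFrame κ p v) :
    chartAt R4 ℓ (geodOf κ p v) = planeCoord (chartBasis ℓ) (p, v) := by
  rw [chartAt_apply, plucker_geodOf h]; rfl

section

variable {X : Type*} [NormedAddCommGroup X] [NormedSpace ℝ X]

/-- A family of geodesics is smooth if its initial data are smooth. -/
lemma contMDiffAt_geodOf {κ : SignType} {q : X → R4 × R4} {x : X} {n : ℕ∞}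
    (hq : ContDiffAt ℝ n q x) (hF : ∀ y, IsFrame κ (q y).1 (q y).2) :
    ContMDiffAt 𝓘(ℝ, X) 𝓘(ℝ, R4) n (fun y => geodOf κ (q y).1 (q y).2) x := by
  have hpos := minor_chartBasis_pos (hF x)
  set ℓ := geodOf κ (q x).1 (q x).2 with hℓ
  have hn : ((n : ℕ∞) : WithTop ℕ∞) ≤ ∞ := by exact_mod_cast le_top
  have hy : ContDiffAt ℝ n (fun y => planeCoord (chartBasis ℓ) (q y)) x :=
    ((contDiffAt_planeCoord _ hpos).of_le hn).comp x hq
  have hx : planeCoord (chartBasis ℓ) (q x) ∈ (chartAt R4 ℓ).target := by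
    have := mem_chart_target R4 ℓ
    nth_rewrite 2 [hℓ] at this
    rwa [chartAt_geodOf _ (hF x)] at this
  have hev : (fun y => geodOf κ (q y).1 (q y).2) =ᶠ[nhds x]
      fun y => (chartAt R4 ℓ).symm (planeCoord (chartBasis ℓ) (q y)) := by
    have h1 := hy.continuousAt.eventually_mem ((chartAt R4 ℓ).open_target.mem_nhds hx)
    have h2 : ContinuousAt (fun y => minor (chartBasis ℓ) (q y).1 (q y).2 0 1) x :=
      ContinuousAt.comp (f := q) (contDiff_minor (chartBasis ℓ) 0 1).continuous.continuousAt
        hq.continuousAt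
    filter_upwards [h1, h2.eventually (lt_mem_nhds hpos)] with y hy1 hy2
    rw [← Prod.mk.eta (p := q y), ← chartAt_geodOf ℓ (hF y)]
    refine ((chartAt R4 ℓ).left_inv ?_).symm
    rw [chartAt_source]
    refine ⟨?_, ?_⟩
    · rw [plucker_geodOf (hF y)]; exact hy2
    · rw [plucker_geodOf (hF y)]; exact hy1
  refine ContMDiffAt.congr_of_eventuallyEq ?_ hev
  have hs : ContMDiffAt 𝓘(ℝ, R4) 𝓘(ℝ, R4) n (chartAt R4 ℓ).symm
      (planeCoord (chartBasis ℓ) (q x)) :=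
    ((contMDiffOn_chart_symm (I := 𝓘(ℝ, R4)) (n := ∞) (x := ℓ)).of_le hn).contMDiffAt
      ((chartAt R4 ℓ).open_target.mem_nhds hx)
  exact ContMDiffAt.comp x hs hy.contMDiffAt

/-- In the chart at the base point, the derivative of a family of geodesics is the derivative of
the graph coordinates of the planes spanned by the initial data. -/
lemma mfderiv_geodOf {κ : SignType} {q : X → R4 × R4} {x : X}
    (hq : ContDiffAt ℝ 1 q x) (hF : ∀ y, IsFrame κ (q y).1 (q y).2) :
    (mfderiv 𝓘(ℝ, X) 𝓘(ℝ, R4) (fun y => geodOf κ (q y).1 (q y).2) x : X →L[ℝ] R4) =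
      fderiv ℝ (fun y => planeCoord (chartBasis (geodOf κ (q x).1 (q x).2)) (q y)) x := by
  have h : MDifferentiableAt 𝓘(ℝ, X) 𝓘(ℝ, R4) (fun y => geodOf κ (q y).1 (q y).2) x :=
    (contMDiffAt_geodOf (n := 1) hq hF).mdifferentiableAt one_ne_zero
  rw [h.mfderiv]
  simp only [writtenInExtChartAt, mfld_simps, fderivWithin_univ]
  congr 1
  funext y
  exact chartAt_geodOf _ (hF y)

end

/-- The Plücker coordinates are smooth functions on the space of oriented geodesics. -/
lemma contMDiff_plucker {κ : SignType} (Ψ : R4 ≃ₗ[ℝ] R4) (i j : Fin 4) :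
    ContMDiff 𝓘(ℝ, R4) 𝓘(ℝ, ℝ) ∞ fun ℓ : OrientedGeodesic κ => plucker Ψ ℓ i j := by
  intro ℓ
  set Φ := chartBasis ℓ with hΦ
  have hA := contDiff_graphA Φ
  have hB := contDiff_graphB Φ
  have cf : ∀ f g : R4 → R4, ContDiff ℝ ∞ f → ContDiff ℝ ∞ g →
      ContDiff ℝ ∞ fun y => coform κ (f y) (g y) := by
    intro f g hf hg
    rw [contDiff_pi] at hf hg
    exact ((hf 0).mul (hg 0)).add (contDiff_const.mul
      ((((hf 1).mul (hg 1)).add ((hf 2).mul (hg 2))).add ((hf 3).mul (hg 3))))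
  have ff : ∀ f g : R4 → R4, ContDiff ℝ ∞ f → ContDiff ℝ ∞ g →
      ContDiff ℝ ∞ fun y => form κ (f y) (g y) := by
    intro f g hf hg
    rw [contDiff_pi] at hf hg
    exact (((contDiff_const.mul ((hf 0).mul (hg 0))).add ((hf 1).mul (hg 1))).add
      ((hf 2).mul (hg 2))).add ((hf 3).mul (hg 3))
  have hC : ContDiff ℝ ∞ (graphC κ Φ) :=
    ((cf _ _ hA hA).smul hB).sub ((cf _ _ hA hB).smul hA)
  have hS : ContDiffOn ℝ ∞ (fun y => minor Ψ
      ((√(coform κ (graphA Φ y) (graphA Φ y)))⁻¹ • graphA Φ y)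
      ((√(form κ (graphC κ Φ y) (graphC κ Φ y)))⁻¹ • graphC κ Φ y) i j) (graphTarget κ Φ) := by
    refine (contDiff_minor Ψ i j).comp_contDiffOn (ContDiffOn.prodMk ?_ ?_)
    · refine ContDiffOn.smul (ContDiffOn.inv (ContDiffOn.sqrt (cf _ _ hA hA).contDiffOn
        fun y hy => hy.1.ne') fun y hy => (Real.sqrt_pos.2 hy.1).ne') hA.contDiffOn
    · refine ContDiffOn.smul (ContDiffOn.inv (ContDiffOn.sqrt (ff _ _ hC hC).contDiffOn
        fun y hy => hy.2.1.ne') fun y hy => (Real.sqrt_pos.2 hy.2.1).ne') hC.contDiffOn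
  have hsrc := (chartAt R4 ℓ).open_source.mem_nhds (mem_chart_source R4 ℓ)
  have hev : (fun ℓ' : OrientedGeodesic κ => plucker Ψ ℓ' i j) =ᶠ[nhds ℓ]
      (fun y => minor Ψ ((√(coform κ (graphA Φ y) (graphA Φ y)))⁻¹ • graphA Φ y)
      ((√(form κ (graphC κ Φ y) (graphC κ Φ y)))⁻¹ • graphC κ Φ y) i j) ∘ chartAt R4 ℓ := by
    filter_upwards [hsrc] with ℓ' hℓ'
    have ht : chartAt R4 ℓ ℓ' ∈ graphTarget κ Φ := (chartAt R4 ℓ).map_source hℓ'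
    have e : ofFrame (isFrame_graph ht) = ℓ' := by
      have h1 : (graphChart κ Φ).symm (chartAt R4 ℓ ℓ') = ofFrame (isFrame_graph ht) := dif_pos ht
      rw [← h1]
      exact (graphChart κ Φ).left_inv hℓ'
    conv_lhs => rw [← e, plucker_ofFrame]
    rfl
  refine ContMDiffAt.congr_of_eventuallyEq ?_ hev
  have ht : chartAt R4 ℓ ℓ ∈ graphTarget κ Φ := mem_chart_target R4 ℓ
  refine ContMDiffAt.comp ℓ (hS.contDiffAt ((isOpen_graphTarget κ Φ).mem_nhds ht)).contMDiffAt ?_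
  exact (contMDiffOn_chart (I := 𝓘(ℝ, R4)) (n := ∞) (x := ℓ)).contMDiffAt hsrc

/-! ### Helicoidal curves -/

/-- The oriented geodesic through the point of a frame `(p, A, v, B)` with velocity `v`. -/
noncomputable def geo (κ : SignType) (f : Tetrad) : OrientedGeodesic κ := geodOf κ f.1 f.2.2.1

lemma Parametrizes.eq_geodOf {κ : SignType} {σ : ℝ → R4} {ℓ : OrientedGeodesic κ}
    (h : Parametrizes σ ℓ) : ℓ = geodOf κ (σ 0) (deriv σ 0) := by
  obtain ⟨hσ, rfl⟩ := h
  rw [geodOf_eq (hσ.isFrame 0)]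
  refine Quotient.sound ⟨0, fun t => ?_⟩
  rw [add_zero]
  exact (hσ.eq_formula t).1

lemma parametrizes_geod {κ : SignType} {p v : R4} (h : IsFrame κ p v) :
    Parametrizes (geod κ p v) (geodOf κ p v) :=
  ⟨isUnitGeodesic_geod h.1 h.2.1 h.2.2, (geodOf_eq h).symm⟩

/-- Parallel fields are determined by their initial values, since the form is definite on tangent
spaces. -/
lemma IsParallelAlong.unique {κ : SignType} {c V W : ℝ → R4} (hc : ∀ t, c t ∈ SpaceForm κ)
    (hV : IsParallelAlong κ c V) (hW : IsParallelAlong κ c W) (h0 : V 0 = W 0) : V = W := by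
  have dV : ∀ t, HasDerivAt V (deriv V t) t := fun t =>
    (hV.1.differentiable (by simp) t).hasDerivAt
  have dW : ∀ t, HasDerivAt W (deriv W t) t := fun t =>
    (hW.1.differentiable (by simp) t).hasDerivAt
  set U : ℝ → R4 := fun t => V t - W t with hU
  have dU : ∀ i t, HasDerivAt (fun t => U t i) ((deriv V t - deriv W t) i) t := fun i t =>
    hasDerivAt_pi.1 ((dV t).sub (dW t)) i
  have hT : ∀ t, coform κ (c t) (U t) = 0 := by
    intro t
    have h1 : coform κ (c t) (V t) = 0 := (hV.2 t).1
    have h2 : coform κ (c t) (W t) = 0 := (hW.2 t).1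
    have : coform κ (c t) (U t) = coform κ (c t) (V t) - coform κ (c t) (W t) := by
      simp only [hU, coform, Pi.sub_apply]; ring
    rw [this, h1, h2, sub_zero]
  -- the square length of a parallel field is constant
  have hd : ∀ t, HasDerivAt (fun t => form κ (U t) (U t)) 0 t := by
    intro t
    have h1 := (hV.2 t).2 _ (hT t)
    have h2 := (hW.2 t).2 _ (hT t)
    unfold form
    convert! (((((dU 0 t).mul (dU 0 t)).const_mul (κ : ℝ)).add ((dU 1 t).mul (dU 1 t))).add
      ((dU 2 t).mul (dU 2 t))).add ((dU 3 t).mul (dU 3 t)) using 1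
    simp only [form, Pi.sub_apply] at h1 h2 ⊢
    linear_combination 2 * h2 - 2 * h1
  funext t
  have hz : form κ (U t) (U t) = 0 := by
    rw [is_const_of_deriv_eq_zero (fun s => (hd s).differentiableAt) (fun s => (hd s).deriv) t 0]
    simp [hU, h0, form]
  exact sub_eq_zero.1 (eq_zero_of_form_self (hc t) (hT t) hz)

/-- A tangent vector orthogonal to a geodesic is, as a vector of `ℝ⁴`, constant under parallel
transport. -/
lemma isParallelAlong_const {κ : SignType} {p A w : R4} (h1 : coform κ p w = 0)
    (h2 : coform κ A w = 0) : IsParallelAlong κ (geod κ p A) fun _ => w := by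
  refine ⟨contDiff_const, fun t => ⟨?_, fun z _ => ?_⟩⟩
  · show coform κ _ _ = 0
    rw [geod, coform_add_left, coform_smul_left, coform_smul_left, h1, h2]; ring
  · simp [form]

/-- Helicoidal curves are the orbits of adapted frames under screw motions. -/
lemma IsHelicoidalCurve.exists_frame {κ : SignType} {α : ℝ} {ℓ : OrientedGeodesic κ} {p A : R4}
    {Γ : ℝ → OrientedGeodesic κ} (h : IsHelicoidalCurve κ α ℓ p A Γ) :
    ∃ f, IsAdapted κ f ∧ geo κ f = ℓ ∧ Γ = fun t => geo κ (helix κ α t f) := by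
  obtain ⟨φ, ⟨σ, c, V, W, B, hσ, rfl, hA, hAA, hAv, ⟨hB, hBA, hBv, hBB, hdet⟩, hc, hc0, hcA, hV, hV0,
    hW, hW0, hφ⟩, hΓ⟩ := h
  have hF := hσ.choose.isFrame 0
  have ha : IsAdapted κ (σ 0, A, deriv σ 0, B) :=
    ⟨hF.1, hA, hF.2.1, hB, hAA, hF.2.2, hBB, hAv, (form_comm _ _ _).trans hBA,
      (form_comm _ _ _).trans hBv, hdet⟩
  have hcg : c = geod κ (σ 0) A := by
    funext t; rw [(hc.eq_formula t).1, hc0, hcA]; rfl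
  have hVc : V = fun _ => deriv σ 0 := by
    refine IsParallelAlong.unique hc.1.2.1 hV ?_ hV0
    rw [hcg]
    exact isParallelAlong_const ha.tv (IsAdapted.coform_of_tangent ha.mem ha.tA ha.Av)
  have hWc : W = fun _ => B := by
    refine IsParallelAlong.unique hc.1.2.1 hW ?_ hW0
    rw [hcg]
    exact isParallelAlong_const ha.tB (IsAdapted.coform_of_tangent ha.mem ha.tA ha.AB)
  refine ⟨_, ha, hσ.eq_geodOf.symm, ?_⟩
  funext t
  rw [(hΓ t).eq_geodOf, (hφ t).2.1, (hφ t).2.2, hcg, hVc, hWc]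
  rfl

lemma isHelicoidalCurve_helix {κ : SignType} {f : Tetrad} (h : IsAdapted κ f) (α : ℝ) :
    IsHelicoidalCurve κ α (geo κ f) f.1 f.2.1 fun t => geo κ (helix κ α t f) := by
  have hF := fun t => (h.helix α t).isFrame
  refine ⟨fun s t => geod κ (helix κ α t f).1 (helix κ α t f).2.2.1 s,
    ⟨geod κ f.1 f.2.2.1, geod κ f.1 f.2.1, fun _ => f.2.2.1, fun _ => f.2.2.2, f.2.2.2,
      parametrizes_geod h.isFrame, geod_zero _ _ _, h.tA, h.AA, ?_, ?_,
      isUnitGeodesic_geod h.mem h.tA h.AA, geod_zero _ _ _, deriv_geod_zero _ _ _, ?_, ?_, ?_, rfl,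
      fun t => ⟨(isUnitGeodesic_geod (hF t).1 (hF t).2.1 (hF t).2.2).1, geod_zero _ _ _,
        deriv_geod_zero _ _ _⟩⟩, fun t => parametrizes_geod (hF t)⟩
  · rw [deriv_geod_zero]; exact h.Av
  · rw [deriv_geod_zero]
    exact ⟨h.tB, (form_comm _ _ _).trans h.AB, (form_comm _ _ _).trans h.vB, h.BB, h.det⟩
  · exact isParallelAlong_const h.tv (IsAdapted.coform_of_tangent h.mem h.tA h.Av)
  · rw [deriv_geod_zero]
  · exact isParallelAlong_const h.tB (IsAdapted.coform_of_tangent h.mem h.tA h.AB)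

lemma contDiff_screw (κ : SignType) {X : Type*} [NormedAddCommGroup X] [NormedSpace ℝ X]
    {s φ : X → ℝ} {f : X → Tetrad} (hs : ContDiff ℝ ∞ s) (hφ : ContDiff ℝ ∞ φ)
    (hf : ContDiff ℝ ∞ f) : ContDiff ℝ ∞ fun x => screw κ (s x) (φ x) (f x) := by
  have h1 := (contDiff_cosK κ).comp hs
  have h2 := (contDiff_sinK κ).comp hs
  have h3 := Real.contDiff_cos.comp hφ
  have h4 := Real.contDiff_sin.comp hφ
  have k1 : ContDiff ℝ ∞ fun x => (f x).1 := hf.fst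
  have k2 : ContDiff ℝ ∞ fun x => (f x).2.1 := hf.snd.fst
  have k3 : ContDiff ℝ ∞ fun x => (f x).2.2.1 := hf.snd.snd.fst
  have k4 : ContDiff ℝ ∞ fun x => (f x).2.2.2 := hf.snd.snd.snd
  exact ((h1.smul k1).add (h2.smul k2)).prodMk
    ((((contDiff_const.mul h2).neg.smul k1).add (h1.smul k2)).prodMk
      (((h3.smul k3).add (h4.smul k4)).prodMk ((h4.neg.smul k3).add (h3.smul k4))))

lemma contDiff_cyc {X : Type*} [NormedAddCommGroup X] [NormedSpace ℝ X]
    {f : X → Tetrad} (hf : ContDiff ℝ ∞ f) : ContDiff ℝ ∞ fun x => cyc (f x) :=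
  hf.fst.prodMk (hf.snd.snd.fst.prodMk (hf.snd.snd.snd.prodMk hf.snd.fst))

lemma contDiff_turn (κ : SignType) (s θ : ℝ) {X : Type*} [NormedAddCommGroup X] [NormedSpace ℝ X]
    {f : X → Tetrad} (hf : ContDiff ℝ ∞ f) : ContDiff ℝ ∞ fun x => turn κ s θ (f x) :=
  contDiff_cyc (contDiff_cyc (contDiff_screw κ contDiff_const contDiff_const (contDiff_cyc hf)))

lemma contDiff_helix (κ : SignType) (α : ℝ) {X : Type*} [NormedAddCommGroup X] [NormedSpace ℝ X]
    {t : X → ℝ} {f : X → Tetrad} (ht : ContDiff ℝ ∞ t) (hf : ContDiff ℝ ∞ f) :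
    ContDiff ℝ ∞ fun x => helix κ α (t x) (f x) :=
  contDiff_screw κ ht (contDiff_const.mul ht) hf

lemma contDiff_initial {X : Type*} [NormedAddCommGroup X] [NormedSpace ℝ X]
    {f : X → Tetrad} (hf : ContDiff ℝ ∞ f) : ContDiff ℝ ∞ fun x => ((f x).1, (f x).2.2.1) :=
  hf.fst.prodMk hf.snd.snd.fst

lemma contMDiff_geo {κ : SignType} {X : Type*} [NormedAddCommGroup X] [NormedSpace ℝ X]
    {f : X → Tetrad} (hf : ContDiff ℝ ∞ f) (ha : ∀ x, IsAdapted κ (f x)) :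
    ContMDiff 𝓘(ℝ, X) 𝓘(ℝ, R4) ∞ fun x => geo κ (f x) := fun _ =>
  contMDiffAt_geodOf (n := ⊤) (contDiff_initial hf).contDiffAt fun y => (ha y).isFrame

lemma contMDiff_helix {κ : SignType} {f : Tetrad} (h : IsAdapted κ f) (α c : ℝ) :
    ContMDiff 𝓘(ℝ, ℝ) 𝓘(ℝ, R4) ∞ fun t => geo κ (helix κ α (t - c) f) :=
  contMDiff_geo (contDiff_helix κ α (contDiff_id.sub contDiff_const) contDiff_const)
    fun _ => h.helix α _

lemma velocity_comp_sub {κ : SignType} {γ : ℝ → OrientedGeodesic κ} {t c : ℝ}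
    (h : MDifferentiableAt 𝓘(ℝ, ℝ) 𝓘(ℝ, R4) γ (t - c)) :
    velocity (E := R4) (fun s => γ (s - c)) t = velocity γ (t - c) := by
  have hd : HasMFDerivAt 𝓘(ℝ, ℝ) 𝓘(ℝ, ℝ) (fun s : ℝ => s - c) t (ContinuousLinearMap.id ℝ ℝ) :=
    ((hasFDerivAt_id t).sub_const c).hasMFDerivAt
  have hcomp := HasMFDerivAt.comp (f := fun s : ℝ => s - c) t h.hasMFDerivAt hd
  unfold velocity
  have e : (fun s => γ (s - c)) = γ ∘ fun s => s - c := rfl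
  rw [e, hcomp.mfderiv]
  rfl

/-- The curve in the space of geodesics that a frame traces under screw motions is admissible. -/
lemma isAdmissibleCurve_helix {κ : SignType} {f : Tetrad} (h : IsAdapted κ f) (α c : ℝ) :
    IsAdmissibleCurve (helicoidalSystem κ α) Set.univ fun t => geo κ (helix κ α (t - c) f) := by
  refine ⟨isOpen_univ, Set.ordConnected_univ, (contMDiff_helix h α c).contMDiffOn, fun t _ => ?_⟩
  refine ⟨_, _, _, _, isHelicoidalCurve_helix (h.helix α (t - c)) α, ?_⟩
  -- the orbit of the frame at time `t` is the same curve with its parameter shifted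
  have e : (fun s => geo κ (helix κ α (s - c) f)) =
      fun s => (fun r => geo κ (helix κ α r (helix κ α (t - c) f))) (s - t) := by
    funext s
    simp only [helix_helix]
    congr 2; ring
  have hm : MDifferentiable 𝓘(ℝ, ℝ) 𝓘(ℝ, R4)
      (fun r => geo κ (helix κ α r (helix κ α (t - c) f))) := by
    simpa using (contMDiff_helix (h.helix α (t - c)) α 0).mdifferentiable (by simp)
  rw [e, velocity_comp_sub (hm _), sub_self]

/-! ### Velocities of helicoidal curves span the tangent spaces -/

lemma planeCoord_comb (Φ : R4 ≃ₗ[ℝ] R4) (p v : R4) {a b c d : ℝ} (h : a * d - b * c ≠ 0) :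
    planeCoord Φ (a • p + b • v, c • p + d • v) = planeCoord Φ (p, v) := by
  have : minor Φ (a • p + b • v) (c • p + d • v) =
      fun i j => (a * d - b * c) * minor Φ p v i j := by
    funext i j; exact minor_comb Φ p v a b c d i j
  simp only [planeCoord, this, graphCoord_smul h]

lemma hasFDerivAt_planeCoord (Φ : R4 ≃ₗ[ℝ] R4) {q : R4 × R4} (hq : 0 < minor Φ q.1 q.2 0 1) :
    HasFDerivAt (planeCoord Φ) (fderiv ℝ (planeCoord Φ) q) q :=
  ((contDiffAt_planeCoord Φ hq).differentiableAt (by simp)).hasFDerivAt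

/-- Varying a pair of vectors within the plane that it spans does not change the plane. -/
lemma fderiv_planeCoord_comb (Φ : R4 ≃ₗ[ℝ] R4) {p v : R4} (h : 0 < minor Φ p v 0 1)
    (a b c d : ℝ) :
    fderiv ℝ (planeCoord Φ) (p, v) (a • p + b • v, c • p + d • v) = 0 := by
  have hl : HasDerivAt (fun t : ℝ => (p, v) + t • (a • p + b • v, c • p + d • v))
      (a • p + b • v, c • p + d • v) 0 := by
    simpa using ((hasDerivAt_id (0 : ℝ)).smul_const
      (a • p + b • v, c • p + d • v)).const_add (p, v)
  have h0 : (p, v) + (0 : ℝ) • (a • p + b • v, c • p + d • v) = (p, v) := by simp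
  have h1 := HasFDerivAt.comp_hasDerivAt (0 : ℝ) (h0.symm ▸ hasFDerivAt_planeCoord Φ h :
    HasFDerivAt (planeCoord Φ) (fderiv ℝ (planeCoord Φ) (p, v))
      ((p, v) + (0 : ℝ) • (a • p + b • v, c • p + d • v))) hl
  refine h1.unique ((hasDerivAt_const 0 (planeCoord Φ (p, v))).congr_of_eventuallyEq ?_)
  have hcont : Continuous fun t : ℝ => (1 + t * a) * (1 + t * d) - (t * b) * (t * c) := by
    fun_prop
  filter_upwards [(isOpen_ne_fun hcont continuous_const).mem_nhds
    (show (1 + (0 : ℝ) * a) * (1 + 0 * d) - (0 * b) * (0 * c) ≠ (0 : ℝ) by simp)] with t ht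
  rw [← planeCoord_comb Φ p v ht]
  simp only [Function.comp, Prod.smul_mk, Prod.mk_add_mk]
  congr 2 <;> module

/-- The graph coordinates are submersive, since the graphs themselves give a section. -/
lemma fderiv_planeCoord_surjective (Φ : R4 ≃ₗ[ℝ] R4) {p v : R4} (h : 0 < minor Φ p v 0 1) :
    Function.Surjective (fderiv ℝ (planeCoord Φ) (p, v)) := by
  have hA := contDiff_graphA Φ
  have hB := contDiff_graphB Φ
  set S : R4 → R4 × R4 := fun y => (Φ p 0 • graphA Φ y + Φ p 1 • graphB Φ y,
    Φ v 0 • graphA Φ y + Φ v 1 • graphB Φ y) with hS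
  have hSd : ContDiff ℝ ∞ S :=
    ((hA.const_smul (Φ p 0)).add (hB.const_smul (Φ p 1))).prodMk
      ((hA.const_smul (Φ v 0)).add (hB.const_smul (Φ v 1)))
  have hdet : Φ p 0 * Φ v 1 - Φ p 1 * Φ v 0 ≠ 0 := h.ne'
  have hsec : ∀ y, planeCoord Φ (S y) = y := fun y => by
    rw [hS, planeCoord_comb Φ _ _ hdet]
    exact graphCoord_minor Φ y
  have hS0 : S (planeCoord Φ (p, v)) = (p, v) := by
    have h' : minor Φ p v 0 1 ≠ 0 := h.ne'
    simp only [hS, planeCoord]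
    rw [(graph_of_minor Φ h).1, (graph_of_minor Φ h).2]
    have e : minor Φ p v 0 1 = Φ p 0 * Φ v 1 - Φ p 1 * Φ v 0 := rfl
    have k1 : ∀ x y : ℝ, x • ((Φ v 1 / minor Φ p v 0 1) • p + (-(Φ p 1) / minor Φ p v 0 1) • v) +
        y • ((-(Φ v 0) / minor Φ p v 0 1) • p + (Φ p 0 / minor Φ p v 0 1) • v) =
        ((x * Φ v 1 - y * Φ v 0) / minor Φ p v 0 1) • p +
          ((y * Φ p 0 - x * Φ p 1) / minor Φ p v 0 1) • v := by
      intro x y; module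
    rw [k1, k1]
    have e1 : Φ p 0 * Φ v 1 - Φ p 1 * Φ v 0 = minor Φ p v 0 1 := rfl
    have e2 : Φ v 1 * Φ p 0 - Φ v 0 * Φ p 1 = minor Φ p v 0 1 := by rw [e]; ring
    rw [e1, e2, div_self h', mul_comm (Φ v 0), sub_self, mul_comm (Φ p 1), sub_self]
    simp
  have hd := (hSd.differentiable (by simp) (planeCoord Φ (p, v))).hasFDerivAt
  have hL : HasFDerivAt (planeCoord Φ) (fderiv ℝ (planeCoord Φ) (p, v))
      (S (planeCoord Φ (p, v))) := by
    rw [hS0]; exact hasFDerivAt_planeCoord Φ h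
  have hc := hL.comp _ hd
  have hid : planeCoord Φ ∘ S = id := funext hsec
  rw [hid] at hc
  have := hc.unique (hasFDerivAt_id _)
  exact fun y => ⟨_, DFunLike.congr_fun this y⟩

/-- The initial velocity of the helicoidal curve of the frame `turn κ s θ (p, A, v, B)`, as a
variation of the initial data `(p, v)`. -/
noncomputable def helixVelocity (κ : SignType) (α s θ : ℝ) (f : Tetrad) : R4 × R4 :=
  (cosK κ s • (turn κ s θ f).2.1 - (α * sinK κ s) • (turn κ s θ f).2.2.2,
    ((κ : ℝ) * sinK κ s) • (turn κ s θ f).2.1 + (α * cosK κ s) • (turn κ s θ f).2.2.2)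

lemma planeCoord_turn (κ : SignType) (Φ : R4 ≃ₗ[ℝ] R4) (s θ : ℝ) (f : Tetrad) :
    planeCoord Φ ((turn κ s θ f).1, (turn κ s θ f).2.2.1) = planeCoord Φ (f.1, f.2.2.1) := by
  refine planeCoord_comb Φ _ _ ?_
  have := cosK_sq κ s
  rw [show cosK κ s * cosK κ s - sinK κ s * -((κ : ℝ) * sinK κ s) = 1 by linarith]
  exact one_ne_zero

lemma hasDerivAt_planeCoord_helix {κ : SignType} {Φ : R4 ≃ₗ[ℝ] R4} {f : Tetrad}
    (h : 0 < minor Φ f.1 f.2.2.1 0 1) (α s θ : ℝ) :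
    HasDerivAt (fun t => planeCoord Φ ((helix κ α t (turn κ s θ f)).1,
        (helix κ α t (turn κ s θ f)).2.2.1))
      (fderiv ℝ (planeCoord Φ) (f.1, f.2.2.1) (helixVelocity κ α s θ f)) 0 := by
  set g := turn κ s θ f with hg
  have hP : HasDerivAt (fun t => (helix κ α t g).1) g.2.1 0 := by
    have : HasDerivAt (geod κ g.1 g.2.1) g.2.1 0 := by
      simpa [sinK_zero, cosK_zero] using hasDerivAt_geod κ g.1 g.2.1 0
    exact this
  have hm : HasDerivAt (fun t : ℝ => α * t) α 0 := by
    simpa using (hasDerivAt_id (0 : ℝ)).const_mul α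
  have hV : HasDerivAt (fun t => (helix κ α t g).2.2.1) (α • g.2.2.2) 0 := by
    have := (hm.cos.smul_const g.2.2.1).add (hm.sin.smul_const g.2.2.2)
    convert! this using 1
    simp
  -- moving the initial point back to that of `f` does not change the geodesic
  have hR : HasDerivAt (fun t => ((turn κ (-s) 0 (helix κ α t g)).1,
      (turn κ (-s) 0 (helix κ α t g)).2.2.1)) (helixVelocity κ α s θ f) 0 := by
    have := ((hP.const_smul (cosK κ (-s))).add (hV.const_smul (sinK κ (-s)))).prodMk
      ((hP.const_smul (-((κ : ℝ) * sinK κ (-s)))).add (hV.const_smul (cosK κ (-s))))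
    convert! this using 1
    simp only [helixVelocity, ← hg, cosK_neg, sinK_neg, Prod.mk.injEq]
    constructor <;> module
  have h0 : ((turn κ (-s) 0 (helix κ α 0 g)).1, (turn κ (-s) 0 (helix κ α 0 g)).2.2.1) =
      (f.1, f.2.2.1) := by
    rw [helix_zero, hg, turn_turn, neg_add_cancel, zero_add]
    simp [turn, cosK_zero, sinK_zero]
  have hc := HasFDerivAt.comp_hasDerivAt (0 : ℝ) (h0.symm ▸ hasFDerivAt_planeCoord Φ h :
    HasFDerivAt (planeCoord Φ) (fderiv ℝ (planeCoord Φ) (f.1, f.2.2.1))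
      ((turn κ (-s) 0 (helix κ α 0 g)).1, (turn κ (-s) 0 (helix κ α 0 g)).2.2.1)) hR
  convert! hc using 1
  funext t
  exact (planeCoord_turn κ Φ (-s) 0 _).symm

lemma IsAdapted.exists_comb {κ : SignType} {f : Tetrad} (h : IsAdapted κ f) (x : R4) :
    ∃ a b c d : ℝ, x = a • f.1 + b • f.2.1 + c • f.2.2.1 + d • f.2.2.2 := by
  have hu : IsUnit (Matrix.of ![f.1, f.2.1, f.2.2.1, f.2.2.2]) :=
    (Matrix.isUnit_iff_isUnit_det _).2 h.det.ne'.isUnit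
  obtain ⟨c, hc⟩ := Matrix.vecMul_surjective_iff_isUnit.2 hu x
  refine ⟨c 0, c 1, c 2, c 3, ?_⟩
  rw [← hc]
  ext j
  simp [Matrix.vecMul, dotProduct, Fin.sum_univ_four]

/-- If `α² ≠ κ`, the velocities of four explicit helicoidal curves span the tangent space.

In terms of variations `(x, y)` of `(p, v)` the curves at `s = 0` give `(A, αB)` and `(-B, αA)`, and
those at `s = 1` add a non-zero multiple of `(-αB, κA)` and `(-αA, -κB)`, respectively, to a multiple
of these; the determinant of these four is `(κ - α²)²` up
to sign. -/
lemma eq_top_of_helixVelocity_mem {κ : SignType} {α : ℝ} (hα : α ^ 2 ≠ (κ : ℝ)) {f : Tetrad}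
    (hf : IsAdapted κ f) {Φ : R4 ≃ₗ[ℝ] R4} (h : 0 < minor Φ f.1 f.2.2.1 0 1)
    {W : Submodule ℝ R4}
    (h1 : fderiv ℝ (planeCoord Φ) (f.1, f.2.2.1) (helixVelocity κ α 0 0 f) ∈ W)
    (h2 : fderiv ℝ (planeCoord Φ) (f.1, f.2.2.1) (helixVelocity κ α 1 0 f) ∈ W)
    (h3 : fderiv ℝ (planeCoord Φ) (f.1, f.2.2.1) (helixVelocity κ α 1 (Real.pi / 2) f) ∈ W)
    (h4 : fderiv ℝ (planeCoord Φ) (f.1, f.2.2.1) (helixVelocity κ α 0 (Real.pi / 2) f) ∈ W) :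
    W = ⊤ := by
  set L := fderiv ℝ (planeCoord Φ) (f.1, f.2.2.1) with hL
  have hs := sinK_one_ne_zero κ
  have hk : (κ : ℝ) - α ^ 2 ≠ 0 := sub_ne_zero.2 hα.symm
  obtain ⟨p, A, v, B⟩ := f
  simp only [helixVelocity, turn, cosK_zero, sinK_zero, Real.cos_zero, Real.sin_zero,
    Real.cos_pi_div_two, Real.sin_pi_div_two] at h1 h2 h3 h4
  have spl : ∀ a b c d : ℝ, L (a • A + b • B, c • A + d • B) =
      a • L (A, 0) + b • L (B, 0) + c • L (0, A) + d • L (0, B) := by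
    intro a b c d
    simp only [← map_smul, ← map_add]
    congr 1
    ext <;> simp
  have e1 : L (A, 0) + α • L (0, B) ∈ W := by
    convert h1 using 1
    have := spl 1 0 0 α
    simp only [one_smul, zero_smul, add_zero] at this
    rw [← this]; congr 2 <;> module
  have e4 : -L (B, 0) + α • L (0, A) ∈ W := by
    convert h4 using 1
    have := spl 0 (-1) α 0
    rw [show -L (B, 0) + α • L (0, A) = (0 : ℝ) • L (A, 0) + (-1 : ℝ) • L (B, 0) + α • L (0, A) +
      (0 : ℝ) • L (0, B) by module, ← this]
    congr 2 <;> module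
  have e2 : -(α • L (B, 0)) + (κ : ℝ) • L (0, A) ∈ W := by
    have := W.smul_mem (sinK κ 1)⁻¹ (W.sub_mem h2 (W.smul_mem (cosK κ 1) e1))
    convert this using 1
    have k := spl (cosK κ 1) (-(α * sinK κ 1)) (κ * sinK κ 1) (α * cosK κ 1)
    rw [eq_inv_smul_iff₀ hs, eq_sub_iff_add_eq]
    refine Eq.trans ?_ (k.symm.trans ?_)
    · module
    · congr 2 <;> module
  have e3 : -(α • L (A, 0)) - (κ : ℝ) • L (0, B) ∈ W := by
    have := W.smul_mem (sinK κ 1)⁻¹ (W.sub_mem h3 (W.smul_mem (cosK κ 1) e4))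
    convert this using 1
    have k := spl (-(α * sinK κ 1)) (-cosK κ 1) (α * cosK κ 1) (-(κ * sinK κ 1))
    rw [eq_inv_smul_iff₀ hs, eq_sub_iff_add_eq]
    refine Eq.trans ?_ (k.symm.trans ?_)
    · module
    · congr 2 <;> module
  have mA : L (0, A) ∈ W := by
    have := W.smul_mem ((κ : ℝ) - α ^ 2)⁻¹ (W.sub_mem e2 (W.smul_mem α e4))
    convert this using 1
    rw [eq_inv_smul_iff₀ hk]; module
  have mB : L (0, B) ∈ W := by
    have := W.smul_mem ((κ : ℝ) - α ^ 2)⁻¹ (W.neg_mem (W.add_mem e3 (W.smul_mem α e1)))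
    convert this using 1
    rw [eq_inv_smul_iff₀ hk]; module
  have lA : L (A, 0) ∈ W := by
    have := W.sub_mem e1 (W.smul_mem α mB)
    convert this using 1; module
  have lB : L (B, 0) ∈ W := by
    have := W.sub_mem (W.smul_mem α mA) e4
    convert this using 1; module
  rw [eq_top_iff]
  intro y _
  obtain ⟨⟨x, z⟩, rfl⟩ := fderiv_planeCoord_surjective Φ h y
  obtain ⟨a, b, c, d, rfl⟩ := hf.exists_comb x
  obtain ⟨a', b', c', d', rfl⟩ := hf.exists_comb z
  have e := fderiv_planeCoord_comb Φ h a c a' c'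
  rw [← hL] at e ⊢
  simp only at e ⊢
  have : L (a • p + b • A + c • v + d • B, a' • p + b' • A + c' • v + d' • B) =
      L (a • p + c • v, a' • p + c' • v) + L (b • A + d • B, b' • A + d' • B) := by
    rw [← map_add]; congr 1
    ext <;> simp <;> ring
  rw [this, e, zero_add, spl]
  exact W.add_mem (W.add_mem (W.add_mem (W.smul_mem _ lA) (W.smul_mem _ lB)) (W.smul_mem _ mA))
    (W.smul_mem _ mB)

lemma geo_turn {κ : SignType} {f : Tetrad} (h : IsAdapted κ f) (s θ : ℝ) :
    geo κ (turn κ s θ f) = geo κ f := by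
  unfold geo
  rw [geodOf_eq h.isFrame, geodOf_eq (h.turn s θ).isFrame]
  refine ofFrame_eq _ _ one_pos fun i j => ?_
  have := cosK_sq κ s
  simp only [turn, Pi.add_apply, Pi.smul_apply, smul_eq_mul]
  linear_combination (f.1 i * f.2.2.1 j - f.1 j * f.2.2.1 i) * this

lemma minor_chartBasis_geo_pos {κ : SignType} {f : Tetrad} (h : IsAdapted κ f) :
    0 < minor (chartBasis (geo κ f)) f.1 f.2.2.1 0 1 := minor_chartBasis_pos h.isFrame

/-- The velocities of the helicoidal curves of all turned frames lie in the fiber. -/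
lemma helixVelocity_mem_fiber {κ : SignType} {f : Tetrad} (h : IsAdapted κ f) (α s θ : ℝ) :
    (fderiv ℝ (planeCoord (chartBasis (geo κ f))) (f.1, f.2.2.1) (helixVelocity κ α s θ f) : R4) ∈
      (helicoidalFiber κ α (geo κ f) : Set R4) := by
  have ht := h.turn s θ
  refine ⟨_, _, _, _, isHelicoidalCurve_helix ht α, ?_⟩
  have hq : ContDiff ℝ ∞ fun t => ((helix κ α t (turn κ s θ f)).1,
      (helix κ α t (turn κ s θ f)).2.2.1) :=
    contDiff_initial (contDiff_helix κ α contDiff_id contDiff_const)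
  have hm := mfderiv_geodOf (κ := κ) (x := (0 : ℝ)) (hq.of_le (by exact_mod_cast le_top)).contDiffAt
    fun t => (ht.helix α t).isFrame
  have h0 : geo κ (helix κ α 0 (turn κ s θ f)) = geo κ f := by rw [helix_zero, geo_turn h]
  have key : ∀ (ℓ ℓ' : OrientedGeodesic κ) (w : R4), ℓ = ℓ' →
      (⟨ℓ, w⟩ : TangentBundle 𝓘(ℝ, R4) (OrientedGeodesic κ)) = ⟨ℓ', w⟩ := by
    rintro ℓ _ w rfl; rfl
  refine (key _ _ _ h0.symm).trans ?_
  unfold velocity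
  congr 1
  have hb : chartBasis (geodOf κ (helix κ α 0 (turn κ s θ f)).1
      (helix κ α 0 (turn κ s θ f)).2.2.1) = chartBasis (geo κ f) := congrArg chartBasis h0
  rw [hb] at hm
  have hL : fderiv ℝ (planeCoord (chartBasis (geo κ f))) (f.1, f.2.2.1)
      (helixVelocity κ α s θ f) = fderiv ℝ (fun t => planeCoord (chartBasis (geo κ f))
        ((helix κ α t (turn κ s θ f)).1, (helix κ α t (turn κ s θ f)).2.2.1)) 0 1 := by
    rw [(hasDerivAt_planeCoord_helix (minor_chartBasis_geo_pos h) α s θ).hasFDerivAt.fderiv]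
    simp
  exact hL.trans (DFunLike.congr_fun hm (1 : ℝ)).symm

/-- The fibers of the control system are substantial if `α² ≠ κ`. -/
theorem isSubstantial_helicoidalFiber {κ : SignType} {α : ℝ} (hα : α ^ 2 ≠ (κ : ℝ))
    (ℓ : OrientedGeodesic κ) : IsSubstantial (helicoidalFiber κ α ℓ) := by
  obtain ⟨p, v, hF, rfl⟩ := exists_geodOf ℓ
  obtain ⟨A, B, hf⟩ := exists_isAdapted hF
  intro Q hQ
  have hmem := fun s θ => hQ (helixVelocity_mem_fiber hf α s θ)
  set L := fderiv ℝ (planeCoord (chartBasis (geo κ (p, A, v, B)))) (p, v) with hL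
  -- opposite frames have opposite velocities, so the affine subspace contains `0`
  have hneg : ∀ s θ, helixVelocity κ α s (θ + Real.pi) (p, A, v, B) =
      -helixVelocity κ α s θ (p, A, v, B) := by
    intro s θ
    simp only [helixVelocity, turn, Real.cos_add_pi, Real.sin_add_pi]
    ext1
    · simp only [Prod.fst_neg]; module
    · simp only [Prod.snd_neg]; module
  let Q' : AffineSubspace ℝ R4 := Q
  have hmem : ∀ s θ, L (helixVelocity κ α s θ (p, A, v, B)) ∈ Q' := hmem
  have h0 : (0 : R4) ∈ Q' := by
    have h1 := hmem 0 0
    have h2 := hmem 0 (0 + Real.pi)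
    rw [hneg, map_neg] at h2
    have := AffineMap.lineMap_mem (1 / 2 : ℝ) h1 h2
    rw [AffineMap.lineMap_apply] at this
    convert this using 1
    simp only [vsub_eq_sub, vadd_eq_add]
    module
  have hd : ∀ s θ, L (helixVelocity κ α s θ (p, A, v, B)) ∈ Q'.direction := by
    intro s θ
    have := AffineSubspace.vsub_mem_direction (hmem s θ) h0
    simpa using this
  have htop := eq_top_of_helixVelocity_mem hα hf (minor_chartBasis_geo_pos hf)
    (hd 0 0) (hd 1 0) (hd 1 _) (hd 0 _)
  exact (AffineSubspace.direction_eq_top_iff_of_nonempty ⟨0, h0⟩).1 htop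

/-! ### Controllability -/

/-- Turning the frame by a half turn reverses its helicoidal curve. -/
lemma geo_helix_neg (κ : SignType) (α t : ℝ) (f : Tetrad) :
    geo κ (helix κ α (-t) f) = geo κ (helix κ α t (turn κ 0 Real.pi f)) := by
  simp [geo, helix, screw, turn, cosK_zero, sinK_zero, cosK_neg, sinK_neg]

section

variable {κ : SignType} {α : ℝ} {x : OrientedGeodesic κ} {f : Tetrad}

/-- A piecewise admissible curve can be continued by an arc of a helicoidal curve. -/
lemma PiecewiseJoined.helix_of_pos (hf : IsAdapted κ f)
    (h : PiecewiseJoined (helicoidalSystem κ α) x (geo κ f)) {T : ℝ} (hT : 0 < T) :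
    PiecewiseJoined (helicoidalSystem κ α) x (geo κ (helix κ α T f)) := by
  obtain ⟨n, t, γ, hn, ht, hc, h0, h1, hs⟩ := h
  have hmono : ∀ j, j ≤ n → ∀ i ≤ j, t i ≤ t j := by
    intro j
    induction j with
    | zero => intro _ i hi; rw [Nat.le_zero.1 hi]
    | succ j ih =>
      intro hj i hi
      rcases Nat.lt_or_ge i (j + 1) with h | h
      · exact (ih (by omega) i (by omega)).trans (ht j (by omega)).le
      · rw [le_antisymm hi h]
  set δ : ℝ → OrientedGeodesic κ := fun s => geo κ (helix κ α (s - t n) f) with hδ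
  have hδn : δ (t n) = γ (t n) := by simp only [hδ, sub_self, helix_zero, h1]
  set γ' : ℝ → OrientedGeodesic κ := fun s => if s ≤ t n then γ s else δ s with hγ'
  have e1 : ∀ s, s ≤ t n → γ' s = γ s := fun s hs => if_pos hs
  have e2 : ∀ s, t n ≤ s → γ' s = δ s := fun s hs => by
    rcases hs.eq_or_lt with h | h
    · rw [e1 s h.symm.le, ← h, hδn]
    · exact if_neg (not_le.2 h)
  refine ⟨n + 1, fun i => if i ≤ n then t i else t n + T, γ', Nat.succ_pos n, ?_, ?_, ?_, ?_, ?_⟩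
  · intro i hi
    rcases Nat.lt_or_ge i n with h | h
    · simp only [h.le, Nat.succ_le_of_lt h, if_true]; exact ht i h
    · have : i = n := by omega
      subst this
      simp [hT]
  · have hn' : ¬ n + 1 ≤ n := by omega
    simp only [Nat.zero_le, if_true, hn', if_false]
    have h3 : ContinuousOn γ' (Set.Icc (t 0) (t n)) := hc.congr fun s hs => e1 s hs.2
    have h4 : ContinuousOn γ' (Set.Icc (t n) (t n + T)) :=
      (contMDiff_helix hf α (t n)).continuous.continuousOn.congr fun s hs => e2 s hs.1
    refine (h3.union_of_isClosed h4 isClosed_Icc isClosed_Icc).mono fun s hs => ?_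
    rcases le_total s (t n) with h | h
    · exact Or.inl ⟨hs.1, h⟩
    · exact Or.inr ⟨h, hs.2⟩
  · simp only [Nat.zero_le, if_true]
    rw [e1 _ (hmono n le_rfl 0 (Nat.zero_le _)), h0]
  · have hn' : ¬ n + 1 ≤ n := by omega
    simp only [hn', if_false]
    rw [e2 _ (by linarith)]
    simp only [hδ, add_sub_cancel_left]
  · intro i hi
    rcases Nat.lt_or_ge i n with h | h
    · simp only [h.le, Nat.succ_le_of_lt h, if_true]
      obtain ⟨I, ε, hI, hsub, heq⟩ := hs i h
      exact ⟨I, ε, hI, hsub, fun s hs => (e1 s (hs.2.trans (hmono n le_rfl _ h))).trans (heq hs)⟩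
    · have : i = n := by omega
      subst this
      have hn' : ¬ i + 1 ≤ i := by omega
      simp only [le_refl, if_true, hn', if_false]
      exact ⟨Set.univ, δ, isAdmissibleCurve_helix hf α (t i), Set.subset_univ _,
        fun s hs => e2 s hs.1⟩

lemma PiecewiseJoined.helix (hf : IsAdapted κ f)
    (h : PiecewiseJoined (helicoidalSystem κ α) x (geo κ f)) (T : ℝ) :
    PiecewiseJoined (helicoidalSystem κ α) x (geo κ (helix κ α T f)) := by
  rcases lt_trichotomy T 0 with hT | rfl | hT
  · rw [← neg_neg T, geo_helix_neg]
    rw [← geo_turn hf 0 Real.pi] at h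
    exact h.helix_of_pos (hf.turn _ _) (neg_pos.2 hT)
  · rwa [helix_zero]
  · exact h.helix_of_pos hf hT

lemma piecewiseJoined_helix_iff (hf : IsAdapted κ f) (T : ℝ) :
    PiecewiseJoined (helicoidalSystem κ α) x (geo κ (helix κ α T f)) ↔
      PiecewiseJoined (helicoidalSystem κ α) x (geo κ f) := by
  refine ⟨fun h => ?_, fun h => h.helix hf T⟩
  have := h.helix (hf.helix α T) (-T)
  rwa [helix_helix, neg_add_cancel, helix_zero] at this

lemma piecewiseJoined_refl (hf : IsAdapted κ f) :
    PiecewiseJoined (helicoidalSystem κ α) (geo κ f) (geo κ f) := by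
  refine (piecewiseJoined_helix_iff hf 1).1 ?_
  refine ⟨1, fun i => i, fun t => geo κ (Helicoidal.helix κ α (t - 0) f), one_pos, fun i _ => by simp,
    (contMDiff_helix hf α 0).continuous.continuousOn, by simp [helix_zero], by simp,
    fun i _ => ⟨Set.univ, _, isAdmissibleCurve_helix hf α 0, Set.subset_univ _, fun _ _ => rfl⟩⟩

/-- The frame obtained by moving along four helicoidal curves, for the times `t 0, …, t 3`, with
turns of the frame in between.  The turns are those for which the four curves have, at `t = 0`,
the velocities `helixVelocity κ α s θ f` with `(s, θ) = (0, 0), (1, 0), (1, π/2), (0, π/2)`. -/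
noncomputable def fourHelices (κ : SignType) (α : ℝ) (f : Tetrad) (t : R4) : Tetrad :=
  helix κ α (t 3) (turn κ (-1) 0 (helix κ α (t 2) (turn κ 0 (Real.pi / 2)
    (helix κ α (t 1) (turn κ 1 0 (helix κ α (t 0) f))))))

lemma isAdapted_fourHelices (hf : IsAdapted κ f) (t : R4) : IsAdapted κ (fourHelices κ α f t) :=
  ((((((hf.helix _ _).turn _ _).helix _ _).turn _ _).helix _ _).turn _ _).helix _ _

lemma contDiff_fourHelices (κ : SignType) (α : ℝ) (f : Tetrad) :
    ContDiff ℝ ∞ (fourHelices κ α f) := by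
  have h := fun i => contDiff_apply ℝ ℝ (n := ∞) (i : Fin 4)
  exact contDiff_helix κ α (h 3) (contDiff_turn κ _ _ (contDiff_helix κ α (h 2)
    (contDiff_turn κ _ _ (contDiff_helix κ α (h 1) (contDiff_turn κ _ _
      (contDiff_helix κ α (h 0) contDiff_const))))))

lemma piecewiseJoined_fourHelices_iff (hf : IsAdapted κ f) (t : R4) :
    PiecewiseJoined (helicoidalSystem κ α) x (geo κ (fourHelices κ α f t)) ↔
      PiecewiseJoined (helicoidalSystem κ α) x (geo κ f) := by
  have h0 := hf.helix α (t 0)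
  have h1 := (h0.turn 1 0).helix α (t 1)
  have h2 := (h1.turn 0 (Real.pi / 2)).helix α (t 2)
  rw [fourHelices, piecewiseJoined_helix_iff (h2.turn _ _), geo_turn h2,
    piecewiseJoined_helix_iff (h1.turn _ _), geo_turn h1,
    piecewiseJoined_helix_iff (h0.turn _ _), geo_turn h0, piecewiseJoined_helix_iff hf]

/-- If `α² ≠ κ`, the composition of four helicoidal curves is a local submersion at time `0`. -/
lemma map_nhds_fourHelices (hα : α ^ 2 ≠ (κ : ℝ)) (hf : IsAdapted κ f) {Φ : R4 ≃ₗ[ℝ] R4}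
    (h : 0 < minor Φ f.1 f.2.2.1 0 1) :
    Filter.map (fun t => planeCoord Φ ((fourHelices κ α f t).1, (fourHelices κ α f t).2.2.1))
      (nhds 0) = nhds (planeCoord Φ (f.1, f.2.2.1)) := by
  have h0 : fourHelices κ α f 0 = turn κ 0 (Real.pi / 2) f := by
    simp [fourHelices, helix_zero, turn_turn]
  have hq0 : ((fourHelices κ α f 0).1, (fourHelices κ α f 0).2.2.1) = (f.1, f.2.2.1) := by
    rw [h0]; simp [turn, cosK_zero, sinK_zero]
  set F : R4 → R4 :=
    fun t => planeCoord Φ ((fourHelices κ α f t).1, (fourHelices κ α f t).2.2.1) with hF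
  have hFs : ContDiffAt ℝ ∞ F 0 := by
    refine ContDiffAt.comp (g := planeCoord Φ) 0 ?_
      (contDiff_initial (contDiff_fourHelices κ α f)).contDiffAt
    rw [hq0]
    exact contDiffAt_planeCoord Φ h
  have hst := hFs.hasStrictFDerivAt (by simp)
  have hline : ∀ i : Fin 4, HasDerivAt (fun u : ℝ => F (u • Pi.single i 1))
      (fderiv ℝ F 0 (Pi.single i 1)) 0 := by
    intro i
    have hl : HasDerivAt (fun u : ℝ => u • (Pi.single i 1 : R4)) (Pi.single i 1) 0 := by
      simpa using (hasDerivAt_id (0 : ℝ)).smul_const (Pi.single i 1 : R4)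
    have h0 : (0 : ℝ) • (Pi.single i 1 : R4) = 0 := zero_smul _ _
    exact HasFDerivAt.comp_hasDerivAt (0 : ℝ) (h0.symm ▸ hst.hasFDerivAt :
      HasFDerivAt F (fderiv ℝ F 0) ((0 : ℝ) • (Pi.single i 1 : R4))) hl
  have hcol : ∀ (i : Fin 4) (s θ : ℝ),
      (∀ u : ℝ, F (u • Pi.single i 1) = planeCoord Φ ((helix κ α u (turn κ s θ f)).1,
        (helix κ α u (turn κ s θ f)).2.2.1)) →
      fderiv ℝ (planeCoord Φ) (f.1, f.2.2.1) (helixVelocity κ α s θ f) ∈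
        (fderiv ℝ F 0 : R4 →L[ℝ] R4).range := by
    intro i s θ hi
    refine ⟨Pi.single i 1, ?_⟩
    have h1 := hline i
    rw [funext hi] at h1
    exact h1.unique (hasDerivAt_planeCoord_helix h α s θ)
  have htop : (fderiv ℝ F 0 : R4 →L[ℝ] R4).range = ⊤ := by
    refine eq_top_of_helixVelocity_mem hα hf h (hcol 0 _ _ fun u => ?_) (hcol 1 _ _ fun u => ?_)
      (hcol 2 _ _ fun u => ?_) (hcol 3 _ _ fun u => ?_)
    · simp [hF, fourHelices, helix_zero, planeCoord_turn, turn_zero]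
    · simp [hF, fourHelices, helix_zero, planeCoord_turn]
    · simp [hF, fourHelices, helix_zero, planeCoord_turn, turn_turn]
    · simp [hF, fourHelices, helix_zero, turn_turn]
  have := hst.map_nhds_eq_of_surj htop
  rw [this, hF]
  simp only [hq0]

/-- If `α² ≠ κ`, the sets of points that are joined to a given point are open and closed. -/
lemma isClopen_piecewiseJoined (hα : α ^ 2 ≠ (κ : ℝ)) (x : OrientedGeodesic κ) :
    IsClopen {ℓ | PiecewiseJoined (helicoidalSystem κ α) x ℓ} := by
  have key : ∀ ℓ, ∀ᶠ ℓ' in nhds ℓ, PiecewiseJoined (helicoidalSystem κ α) x ℓ' ↔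
      PiecewiseJoined (helicoidalSystem κ α) x ℓ := by
    intro ℓ
    obtain ⟨p, v, hF, rfl⟩ := exists_geodOf ℓ
    obtain ⟨A, B, hf⟩ := exists_isAdapted hF
    change ∀ᶠ ℓ' in nhds (geo κ (p, A, v, B)), _ ↔ PiecewiseJoined _ x (geo κ (p, A, v, B))
    set f : Tetrad := (p, A, v, B)
    set e := chartAt R4 (geo κ f) with he
    have hmap := map_nhds_fourHelices hα hf (minor_chartBasis_geo_pos hf)
    have hsrc : geo κ f ∈ e.source := mem_chart_source R4 (geo κ f)
    have h1 := e.symm.map_nhds_eq (x := e (geo κ f)) (e.map_source hsrc)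
    rw [e.left_inv hsrc] at h1
    have h2 : e (geo κ f) = planeCoord (chartBasis (geo κ f)) (f.1, f.2.2.1) :=
      chartAt_geodOf _ hf.isFrame
    rw [← h1, h2, ← hmap, Filter.map_map, Filter.eventually_map]
    have hcont := (contMDiff_geo (contDiff_fourHelices κ α f)
      fun t => isAdapted_fourHelices hf t).continuous
    have h0 : geo κ (fourHelices κ α f 0) = geo κ f := by
      simp [fourHelices, helix_zero, turn_turn, geo_turn hf]
    have hev := hcont.continuousAt.eventually_mem (x := 0)
      (e.open_source.mem_nhds (h0.symm ▸ hsrc : geo κ (fourHelices κ α f 0) ∈ e.source))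
    filter_upwards [hev] with t ht
    have h3 : planeCoord (chartBasis (geo κ f)) ((fourHelices κ α f t).1,
        (fourHelices κ α f t).2.2.1) = e (geo κ (fourHelices κ α f t)) :=
      (chartAt_geodOf _ (isAdapted_fourHelices hf t).isFrame).symm
    simp only [Function.comp]
    rw [h3, e.left_inv ht]
    exact piecewiseJoined_fourHelices_iff hf t
  refine ⟨⟨isOpen_iff_mem_nhds.2 fun ℓ hℓ => ?_⟩, isOpen_iff_mem_nhds.2 fun ℓ hℓ => ?_⟩
  · filter_upwards [key ℓ] with ℓ' h' using fun hm => hℓ (h'.1 hm)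
  · filter_upwards [key ℓ] with ℓ' h' using h'.2 hℓ

end

/-! ### Connectedness of the space of oriented geodesics -/

lemma exists_cosK_sinK {κ : SignType} {c n : ℝ} (h : c ^ 2 + (κ : ℝ) * n ^ 2 = 1)
    (hc : κ ≠ 1 → 0 < c) : ∃ s, cosK κ s = c ∧ sinK κ s = n := by
  cases κ
  · have : 0 < c := hc (by decide)
    refine ⟨n, ?_, rfl⟩
    simp only [cast_zero'] at h
    show 1 = c
    nlinarith
  · have h0 : 0 < c := hc (by decide)
    simp only [cast_neg'] at h
    refine ⟨Real.arsinh n, ?_, Real.sinh_arsinh n⟩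
    show Real.cosh _ = c
    rw [Real.cosh_arsinh, ← Real.sqrt_sq h0.le]
    congr 1; linarith
  · simp only [cast_pos', one_mul] at h
    have hn : ‖(⟨c, n⟩ : ℂ)‖ = 1 := by
      rw [Complex.norm_eq_sqrt_sq_add_sq, h, Real.sqrt_one]
    have hne : (⟨c, n⟩ : ℂ) ≠ 0 := by
      intro h; rw [h] at hn; simp at hn
    refine ⟨Complex.arg ⟨c, n⟩, ?_, ?_⟩
    · show Real.cos _ = c
      rw [Complex.cos_arg hne, hn]; simp
    · show Real.sin _ = n
      rw [Complex.sin_arg, hn]; simp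

lemma exists_cos_sin {c n : ℝ} (h : c ^ 2 + n ^ 2 = 1) : ∃ s, Real.cos s = c ∧ Real.sin s = n :=
  exists_cosK_sinK (κ := SignType.pos) (by simpa [cast_pos'] using h) fun h => absurd rfl h

lemma smul_inv_sqrt_smul {a : ℝ} (ha : 0 < a) (u : R4) : √a • (√a)⁻¹ • u = u := by
  rw [smul_smul, mul_inv_cancel₀ (Real.sqrt_pos.2 ha).ne', one_smul]

/-- A unit tangent vector arises from another one by a rotation. -/
lemma exists_rotation {κ : SignType} {p v v' : R4} (h : IsFrame κ p v) (h' : IsFrame κ p v') :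
    ∃ (w : R4) (t : ℝ), coform κ p w = 0 ∧ form κ v w = 0 ∧ form κ w w = 1 ∧
      v' = Real.cos t • v + Real.sin t • w := by
  obtain ⟨hp, hv, hu⟩ := h
  obtain ⟨-, hv', hu'⟩ := h'
  have hv : coform κ p v = 0 := hv
  have hv' : coform κ p v' = 0 := hv'
  set c := form κ v v' with hc
  set u := v' + (-c) • v with hu0
  have hv'e : v' = c • v + u := by rw [hu0]; module
  have hpu : coform κ p u = 0 := by
    rw [hu0, coform_add_right, coform_smul_right, hv, hv']; ring
  have hvu : form κ v u = 0 := by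
    rw [hu0, form_add_right, form_smul_right, hu, ← hc]; ring
  have huu : c ^ 2 + form κ u u = 1 := by
    have huv := (form_comm _ _ _).trans hvu
    rw [hv'e] at hu'
    simp only [form_add_left, form_add_right, form_smul_left, form_smul_right, hu, hvu, huv] at hu'
    linarith
  by_cases h0 : u = 0
  · obtain ⟨w, hw, hvw, -, hww⟩ := exists_unit_orthogonal hp v v
    have hz : form κ u u = 0 := by rw [h0]; simp [form]
    obtain ⟨t, ht1, ht2⟩ := exists_cos_sin (c := c) (n := 0) (by rw [← huu, hz]; ring)
    refine ⟨w, t, hw, hvw, hww, ?_⟩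
    rw [ht1, ht2, hv'e, h0]; module
  · have hpos := form_self_pos hp hpu h0
    obtain ⟨t, ht1, ht2⟩ := exists_cos_sin (c := c) (n := √(form κ u u))
      (by rw [Real.sq_sqrt hpos.le]; exact huu)
    refine ⟨(√(form κ u u))⁻¹ • u, t, ?_, ?_, ?_, ?_⟩
    · rw [coform_smul_right, hpu, mul_zero]
    · rw [form_smul_right, hvu, mul_zero]
    · rw [form_smul_left, form_smul_right, ← mul_assoc, ← mul_inv, Real.mul_self_sqrt hpos.le,
        inv_mul_cancel₀ hpos.ne']
    · rw [ht1, ht2, smul_inv_sqrt_smul hpos]; exact hv'e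

/-- Any two points lie on a geodesic. -/
lemma exists_geod {κ : SignType} {p p' : R4} (h : p ∈ SpaceForm κ) (h' : p' ∈ SpaceForm κ) :
    ∃ (u : R4) (s : ℝ), IsFrame κ p u ∧ p' = geod κ p u s := by
  set c := coform κ p p' with hc
  set u := p' + (-c) • p with hu0
  have hp'e : p' = c • p + u := by rw [hu0]; module
  have hpu : coform κ p u = 0 := by
    rw [hu0, coform_add_right, coform_smul_right, h.1, ← hc]; ring
  have huu : c ^ 2 + (κ : ℝ) * form κ u u = 1 := by
    have hup := (coform_comm _ _ _).trans hpu
    have := h'.1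
    rw [hp'e] at this
    simp only [coform_add_left, coform_add_right, coform_smul_left, coform_smul_right, h.1, hpu,
      hup, coform_self_of_tangent h hpu] at this
    linarith
  have hcpos : κ ≠ 1 → 0 < c := by
    intro hκ
    have h1 := h.2 hκ
    have h2 := h'.2 hκ
    cases κ
    · simpa [hc, coform, cast_zero'] using mul_pos h1 h2
    · exact coform_neg_pos h1 h2 h.1 h'.1
    · exact absurd rfl hκ
  by_cases h0 : u = 0
  · obtain ⟨w, hw, -, -, hww⟩ := exists_unit_orthogonal h p p
    have hz : form κ u u = 0 := by rw [h0]; simp [form]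
    obtain ⟨t, ht1, ht2⟩ := exists_cosK_sinK (κ := κ) (c := c) (n := 0)
      (by rw [← huu, hz]; ring) hcpos
    refine ⟨w, t, ⟨h, hw, hww⟩, ?_⟩
    rw [geod, ht1, ht2, hp'e, h0]; module
  · have hpos := form_self_pos h hpu h0
    obtain ⟨t, ht1, ht2⟩ := exists_cosK_sinK (κ := κ) (c := c) (n := √(form κ u u))
      (by rw [Real.sq_sqrt hpos.le]; exact huu) hcpos
    refine ⟨(√(form κ u u))⁻¹ • u, t, ⟨h, ?_, ?_⟩, ?_⟩
    · show coform κ _ _ = 0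
      rw [coform_smul_right, hpu, mul_zero]
    · rw [form_smul_left, form_smul_right, ← mul_assoc, ← mul_inv, Real.mul_self_sqrt hpos.le,
        inv_mul_cancel₀ hpos.ne']
    · rw [geod, ht1, ht2, smul_inv_sqrt_smul hpos]; exact hp'e

/-- The geodesics through a point form a connected set: a rotation of the initial velocity is a
continuous curve. -/
lemma mem_of_isClopen_of_rotation {κ : SignType} {C : Set (OrientedGeodesic κ)} (hC : IsClopen C)
    {p v v' : R4} (h : IsFrame κ p v) (h' : IsFrame κ p v') (hm : geodOf κ p v ∈ C) :
    geodOf κ p v' ∈ C := by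
  obtain ⟨w, t, hw, hvw, hww, rfl⟩ := exists_rotation h h'
  have hwv := (form_comm _ _ _).trans hvw
  have hF : ∀ s : ℝ, IsFrame κ p (Real.cos s • v + Real.sin s • w) := by
    intro s
    have hv : coform κ p v = 0 := h.2.1
    refine ⟨h.1, ?_, ?_⟩
    · show coform κ _ _ = 0
      rw [coform_add_right, coform_smul_right, coform_smul_right, hv, hw]; ring
    · simp only [form_add_left, form_add_right, form_smul_left, form_smul_right, h.2.2, hvw, hwv,
        hww]
      linear_combination Real.sin_sq_add_cos_sq s
  have hq : ContDiff ℝ ∞ fun s : ℝ => (p, Real.cos s • v + Real.sin s • w) :=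
    contDiff_const.prodMk ((Real.contDiff_cos.smul contDiff_const).add
      (Real.contDiff_sin.smul contDiff_const))
  have hcont : Continuous fun s : ℝ => geodOf κ p (Real.cos s • v + Real.sin s • w) :=
    continuous_iff_continuousAt.2 fun s =>
      (contMDiffAt_geodOf (n := ⊤) hq.contDiffAt hF).continuousAt
  have := (hC.preimage hcont).eq_univ ⟨0, by simpa using hm⟩
  exact Set.eq_univ_iff_forall.1 this t

/-- The space of oriented geodesics is connected: the geodesic from a point of `x` to a point of `y`
is reached from `x` by a rotation, and `y` is reached from it by another one. -/
lemma mem_of_isClopen {κ : SignType} {C : Set (OrientedGeodesic κ)} (hC : IsClopen C)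
    {x : OrientedGeodesic κ} (hx : x ∈ C) (y : OrientedGeodesic κ) : y ∈ C := by
  obtain ⟨p, v, h, rfl⟩ := exists_geodOf x
  obtain ⟨p', v', h', rfl⟩ := exists_geodOf y
  obtain ⟨u, s, hu, rfl⟩ := exists_geod h.1 h'.1
  have hm := mem_of_isClopen_of_rotation hC h hu hx
  obtain ⟨A, B, hf⟩ := exists_isAdapted hu
  have hm : geo κ (p, A, u, B) ∈ C := hm
  rw [← geo_turn hf s 0] at hm
  exact mem_of_isClopen_of_rotation hC (hf.turn s 0).isFrame h' hm

/-- The control system is controllable if `α² ≠ κ`. -/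
theorem isControllable_helicoidalSystem {κ : SignType} {α : ℝ} (hα : α ^ 2 ≠ (κ : ℝ)) :
    IsControllable (helicoidalSystem κ α) := by
  intro x y
  refine mem_of_isClopen (isClopen_piecewiseJoined hα x) (x := x) ?_ y
  obtain ⟨p, v, hF, rfl⟩ := exists_geodOf x
  obtain ⟨A, B, hf⟩ := exists_isAdapted hF
  exact piecewiseJoined_refl hf

/-! ### Conserved quantities in the degenerate cases -/

/-- The `j`-th component of `m - α ⋆m`, where `m = p ∧ v` is the bivector of the geodesic with
initial data `p, v`, and `⋆` is the Hodge operator of `ℝ⁴`. -/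
noncomputable def dualityDefect {κ : SignType} (α : ℝ) (j : Fin 3) (ℓ : OrientedGeodesic κ) : ℝ :=
  plucker (LinearEquiv.refl ℝ R4) ℓ 0 j.succ -
    α * plucker (LinearEquiv.refl ℝ R4) ℓ (j + 1).succ (j + 2).succ

lemma contMDiff_dualityDefect {κ : SignType} (α : ℝ) (j : Fin 3) :
    ContMDiff 𝓘(ℝ, R4) 𝓘(ℝ, ℝ) ∞ (dualityDefect (κ := κ) α j) :=
  (contMDiff_plucker _ _ _).sub (contMDiff_const.mul (contMDiff_plucker _ _ _))

lemma dualityDefect_geodOf {κ : SignType} {p v : R4} (h : IsFrame κ p v) (α : ℝ) (j : Fin 3) :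
    dualityDefect α j (geodOf κ p v) = p 0 * v j.succ - p j.succ * v 0 -
      α * (p (j + 1).succ * v (j + 2).succ - p (j + 2).succ * v (j + 1).succ) := by
  rw [dualityDefect, plucker_geodOf h]; rfl

/-- In a positively oriented orthonormal basis `p, A, v, B` of `ℝ⁴`, the bivectors `A ∧ v` and
`p ∧ B` are dual to each other. -/
lemma IsAdapted.hodge {f : Tetrad} (h : IsAdapted SignType.pos f) (j : Fin 3) :
    f.2.1 0 * f.2.2.1 j.succ - f.2.1 j.succ * f.2.2.1 0 =
      f.1 (j + 1).succ * f.2.2.2 (j + 2).succ - f.1 (j + 2).succ * f.2.2.2 (j + 1).succ ∧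
    f.2.1 (j + 1).succ * f.2.2.1 (j + 2).succ - f.2.1 (j + 2).succ * f.2.2.1 (j + 1).succ =
      f.1 0 * f.2.2.2 j.succ - f.1 j.succ * f.2.2.2 0 := by
  obtain ⟨p, A, v, B⟩ := f
  obtain ⟨⟨h1, -⟩, h2, h3, h4, h5, h6, h7, h8, h9, h10, h11⟩ := h
  simp only [coform, form, cast_pos', one_mul] at *
  set M : Matrix (Fin 4) (Fin 4) ℝ := Matrix.of ![p, A, v, B] with hM
  have hMM : M * M.transpose = 1 := by
    ext i k
    fin_cases i <;> fin_cases k <;>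
      simp [hM, Matrix.mul_apply, Fin.sum_univ_four] <;> linarith
  have hdet : M.det = 1 := by
    have := congrArg Matrix.det hMM
    rw [Matrix.det_mul, Matrix.det_transpose, Matrix.det_one] at this
    nlinarith
  have hadj : M.adjugate = M.transpose := by
    calc M.adjugate = M.adjugate * (M * M.transpose) := by rw [hMM, mul_one]
      _ = M.transpose := by rw [← mul_assoc, Matrix.adjugate_mul, hdet, one_smul, one_mul]
  have hB : ∀ i, B i = M.adjugate i 3 := fun i => by rw [hadj]; rfl
  have b0 := hB 0
  have b1 := hB 1
  have b2 := hB 2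
  have b3 := hB 3
  rw [Matrix.adjugate_fin_succ_eq_det_submatrix, Matrix.det_fin_three] at b0 b1 b2 b3
  simp [hM, Fin.succAbove] at b0 b1 b2 b3
  -- `B` is the cross product of `p, A, v`: both claims are the expansion of `p ∧ ⋆(p ∧ A ∧ v)`
  fin_cases j <;> refine ⟨?_, ?_⟩ <;>
    simp only [Fin.reduceFinMk, Fin.zero_eta, Fin.mk_one, Fin.isValue, Fin.reduceAdd, zero_add,
    Fin.reduceSucc, Fin.succ_zero_eq_one, Fin.succ_one_eq_two]
  · linear_combination -(A 0 * v 1 - A 1 * v 0) * h1 + (p 0 * v 1 - p 1 * v 0) * h2 -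
      (p 0 * A 1 - p 1 * A 0) * h3 - p 2 * b3 + p 3 * b2
  · linear_combination -(A 2 * v 3 - A 3 * v 2) * h1 + (p 2 * v 3 - p 3 * v 2) * h2 -
      (p 2 * A 3 - p 3 * A 2) * h3 - p 0 * b1 + p 1 * b0
  · linear_combination -(A 0 * v 2 - A 2 * v 0) * h1 + (p 0 * v 2 - p 2 * v 0) * h2 -
      (p 0 * A 2 - p 2 * A 0) * h3 - p 3 * b1 + p 1 * b3
  · linear_combination -(A 3 * v 1 - A 1 * v 3) * h1 + (p 3 * v 1 - p 1 * v 3) * h2 -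
      (p 3 * A 1 - p 1 * A 3) * h3 - p 0 * b2 + p 2 * b0
  · linear_combination -(A 0 * v 3 - A 3 * v 0) * h1 + (p 0 * v 3 - p 3 * v 0) * h2 -
      (p 0 * A 3 - p 3 * A 0) * h3 - p 1 * b2 + p 2 * b1
  · linear_combination -(A 1 * v 2 - A 2 * v 1) * h1 + (p 1 * v 2 - p 2 * v 1) * h2 -
      (p 1 * A 2 - p 2 * A 1) * h3 - p 0 * b3 + p 3 * b0

/-- If `α² = κ`, the bivectors of the rays of a helicoidal curve have constant duality defect to
first order. -/
lemma hasDerivAt_dualityDefect_helix {κ : SignType} {α : ℝ} (hα : α ^ 2 = (κ : ℝ)) {f : Tetrad}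
    (h : IsAdapted κ f) (j : Fin 3) :
    HasDerivAt (fun t => dualityDefect α j (geo κ (helix κ α t f))) 0 0 := by
  have hP : ∀ i, HasDerivAt (fun t => (helix κ α t f).1 i) (f.2.1 i) 0 := by
    refine hasDerivAt_pi.1 ?_
    have : HasDerivAt (geod κ f.1 f.2.1) f.2.1 0 := by
      simpa [sinK_zero, cosK_zero] using hasDerivAt_geod κ f.1 f.2.1 0
    exact this
  have hm : HasDerivAt (fun t : ℝ => α * t) α 0 := by
    simpa using (hasDerivAt_id (0 : ℝ)).const_mul α
  have hV : ∀ i, HasDerivAt (fun t => (helix κ α t f).2.2.1 i) (α * f.2.2.2 i) 0 := by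
    intro i
    have := (hm.cos.mul_const (f.2.2.1 i)).add (hm.sin.mul_const (f.2.2.2 i))
    convert! this using 1
    simp
  have e : (fun t => dualityDefect α j (geo κ (helix κ α t f))) = fun t =>
      (helix κ α t f).1 0 * (helix κ α t f).2.2.1 j.succ -
        (helix κ α t f).1 j.succ * (helix κ α t f).2.2.1 0 -
      α * ((helix κ α t f).1 (j + 1).succ * (helix κ α t f).2.2.1 (j + 2).succ -
        (helix κ α t f).1 (j + 2).succ * (helix κ α t f).2.2.1 (j + 1).succ) :=
    funext fun t => dualityDefect_geodOf (h.helix α t).isFrame α j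
  rw [e]
  have := (((hP 0).mul (hV j.succ)).sub ((hP j.succ).mul (hV 0))).sub
    ((((hP (j + 1).succ).mul (hV (j + 2).succ)).sub
      ((hP (j + 2).succ).mul (hV (j + 1).succ))).const_mul α)
  convert! this using 1
  rw [helix_zero]
  cases κ
  · rw [cast_zero', sq_eq_zero_iff] at hα
    have h0 : f.1 0 ≠ 0 := (h.mem.2 (by decide)).ne'
    have hA : f.2.1 0 = 0 := by
      have := h.tA
      simp only [coform, cast_zero', zero_mul, add_zero] at this
      exact (mul_eq_zero.1 this).resolve_left h0
    have hv : f.2.2.1 0 = 0 := by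
      have := h.tv
      simp only [coform, cast_zero', zero_mul, add_zero] at this
      exact (mul_eq_zero.1 this).resolve_left h0
    rw [hα, hA, hv]; ring
  · rw [cast_neg'] at hα
    nlinarith [sq_nonneg α]
  · rw [cast_pos'] at hα
    obtain ⟨k1, k2⟩ := h.hodge j
    linear_combination (f.1 (j + 1).succ * f.2.2.2 (j + 2).succ -
      f.1 (j + 2).succ * f.2.2.2 (j + 1).succ) * hα - k1 + α * k2

lemma mfderiv_comp_curve {κ : SignType} {g : OrientedGeodesic κ → ℝ}
    (hg : ContMDiff 𝓘(ℝ, R4) 𝓘(ℝ, ℝ) ∞ g) {γ : ℝ → OrientedGeodesic κ} {t : ℝ}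
    (hγ : MDifferentiableAt 𝓘(ℝ, ℝ) 𝓘(ℝ, R4) γ t) :
    HasDerivAt (g ∘ γ)
      (mfderiv 𝓘(ℝ, R4) 𝓘(ℝ, ℝ) g (γ t) (mfderiv 𝓘(ℝ, ℝ) 𝓘(ℝ, R4) γ t (1 : ℝ)) : ℝ) t := by
  have h := HasMFDerivAt.comp t (hg.mdifferentiable (by simp) (γ t)).hasMFDerivAt hγ.hasMFDerivAt
  let D : ℝ →L[ℝ] ℝ := ContinuousLinearMap.comp
    (mfderiv 𝓘(ℝ, R4) 𝓘(ℝ, ℝ) g (γ t) : R4 →L[ℝ] ℝ) (mfderiv 𝓘(ℝ, ℝ) 𝓘(ℝ, R4) γ t : ℝ →L[ℝ] R4)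
  have hD : HasFDerivAt (g ∘ γ) D t := h.hasFDerivAt
  exact hD.hasDerivAt

/-- If `α² = κ`, the differentials of the duality defects vanish on the control system. -/
lemma mfderiv_dualityDefect {κ : SignType} {α : ℝ} (hα : α ^ 2 = (κ : ℝ)) (j : Fin 3)
    {X : TangentBundle 𝓘(ℝ, R4) (OrientedGeodesic κ)} (hX : X ∈ helicoidalSystem κ α) :
    (mfderiv 𝓘(ℝ, R4) 𝓘(ℝ, ℝ) (dualityDefect (κ := κ) α j) X.1 X.2 : ℝ) = 0 := by
  obtain ⟨ℓ, p, A, Γ, hΓ, rfl⟩ := hX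
  obtain ⟨f, hf, -, rfl⟩ := hΓ.exists_frame
  have hm : MDifferentiable 𝓘(ℝ, ℝ) 𝓘(ℝ, R4) fun t => geo κ (helix κ α t f) := by
    simpa using (contMDiff_helix hf α 0).mdifferentiable (by simp)
  exact (mfderiv_comp_curve (contMDiff_dualityDefect α j) (hm 0)).unique
    (hasDerivAt_dualityDefect_helix hα hf j)

/-- If `α² = κ`, the duality defects are constant along admissible curves. -/
lemma IsAdmissibleCurve.dualityDefect_eq {κ : SignType} {α : ℝ} (hα : α ^ 2 = (κ : ℝ)) {I : Set ℝ}
    {γ : ℝ → OrientedGeodesic κ} (h : IsAdmissibleCurve (helicoidalSystem κ α) I γ) (j : Fin 3)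
    {s t : ℝ} (hs : s ∈ I) (ht : t ∈ I) :
    dualityDefect α j (γ s) = dualityDefect α j (γ t) := by
  obtain ⟨hI, hc, hγ, hv⟩ := h
  have hd : ∀ r ∈ I, HasDerivAt (dualityDefect α j ∘ γ) 0 r := by
    intro r hr
    have := mfderiv_comp_curve (contMDiff_dualityDefect α j)
      ((hγ.contMDiffAt (hI.mem_nhds hr)).mdifferentiableAt (by simp))
    exact this.congr_deriv (mfderiv_dualityDefect hα j (hv r hr))
  exact hI.is_const_of_deriv_eq_zero hc.isPreconnected
    (fun r hr => (hd r hr).differentiableAt.differentiableWithinAt)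
    (fun r hr => (hd r hr).deriv) hs ht

lemma PiecewiseJoined.dualityDefect_eq {κ : SignType} {α : ℝ} (hα : α ^ 2 = (κ : ℝ))
    {x y : OrientedGeodesic κ} (h : PiecewiseJoined (helicoidalSystem κ α) x y) (j : Fin 3) :
    dualityDefect α j x = dualityDefect α j y := by
  obtain ⟨n, t, γ, -, ht, -, rfl, rfl, hs⟩ := h
  have : ∀ i ≤ n, dualityDefect α j (γ (t 0)) = dualityDefect α j (γ (t i)) := by
    intro i
    induction i with
    | zero => intro _; rfl
    | succ i ih =>
      intro hi
      obtain ⟨I, δ, hδ, hsub, heq⟩ := hs i hi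
      have h1 := Set.left_mem_Icc.2 (ht i hi).le
      have h2 := Set.right_mem_Icc.2 (ht i hi).le
      rw [ih (by omega), heq h1, heq h2]
      exact hδ.dualityDefect_eq hα j (hsub h1) (hsub h2)
  exact this n le_rfl

lemma isFrame_rotate (κ : SignType) (s : ℝ) :
    IsFrame κ ![1, 0, 0, 0] ![0, Real.cos s, Real.sin s, 0] := by
  refine ⟨by simp [SpaceForm, coform], by simp [TangentTo, coform], ?_⟩
  simp only [form, Matrix.cons_val]
  linear_combination Real.sin_sq_add_cos_sq s

lemma dualityDefect_rotate (κ : SignType) (α s : ℝ) :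
    dualityDefect α 0 (geodOf κ ![1, 0, 0, 0] ![0, Real.cos s, Real.sin s, 0]) = Real.cos s := by
  rw [dualityDefect_geodOf (isFrame_rotate κ s)]
  simp

/-- The system is not controllable if `α² = κ`: two opposite geodesics through a point have
different duality defects. -/
theorem IsControllable.ne {κ : SignType} {α : ℝ} (h : IsControllable (helicoidalSystem κ α)) :
    α ^ 2 ≠ (κ : ℝ) := by
  intro hα
  have := (h (geodOf κ ![1, 0, 0, 0] ![0, Real.cos 0, Real.sin 0, 0])
    (geodOf κ ![1, 0, 0, 0] ![0, Real.cos Real.pi, Real.sin Real.pi, 0])).dualityDefect_eq hα 0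
  rw [dualityDefect_rotate, dualityDefect_rotate, Real.cos_zero, Real.cos_pi] at this
  norm_num at this

/-- If all fibers are substantial then `α² ≠ κ`, since otherwise the duality defects would be
locally constant. -/
theorem ne_of_isSubstantial {κ : SignType} {α : ℝ}
    (h : ∀ ℓ : OrientedGeodesic κ, IsSubstantial (helicoidalFiber κ α ℓ)) : α ^ 2 ≠ (κ : ℝ) := by
  intro hα
  have hz : ∀ ℓ : OrientedGeodesic κ, ∀ v : TangentSpace 𝓘(ℝ, R4) ℓ,
      (mfderiv 𝓘(ℝ, R4) 𝓘(ℝ, ℝ) (dualityDefect (κ := κ) α 0) ℓ v : ℝ) = 0 := by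
    intro ℓ v
    let D : TangentSpace 𝓘(ℝ, R4) ℓ →ₗ[ℝ] ℝ :=
      (mfderiv 𝓘(ℝ, R4) 𝓘(ℝ, ℝ) (dualityDefect (κ := κ) α 0) ℓ : R4 →L[ℝ] ℝ).toLinearMap
    have := h ℓ (LinearMap.ker D).toAffineSubspace fun w hw => mfderiv_dualityDefect hα 0 hw
    have hv : v ∈ (LinearMap.ker D).toAffineSubspace := this ▸ AffineSubspace.mem_top ℝ _ v
    exact hv
  have hq : ContDiff ℝ ∞ fun s : ℝ =>
      ((![1, 0, 0, 0], ![0, Real.cos s, Real.sin s, 0]) : R4 × R4) := by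
    refine contDiff_const.prodMk (contDiff_pi.2 fun i => ?_)
    fin_cases i
    · exact contDiff_const
    · exact Real.contDiff_cos
    · exact Real.contDiff_sin
    · exact contDiff_const
  have hd := mfderiv_comp_curve (contMDiff_dualityDefect (κ := κ) α 0)
    ((contMDiffAt_geodOf (n := ⊤) hq.contDiffAt (x := Real.pi / 2)
      fun s => isFrame_rotate κ s).mdifferentiableAt (by simp))
  rw [hz] at hd
  have e : (dualityDefect (κ := κ) α 0 ∘
      fun s : ℝ => geodOf κ ![1, 0, 0, 0] ![0, Real.cos s, Real.sin s, 0]) = Real.cos :=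
    funext fun s => dualityDefect_rotate κ α s
  have hcos := Real.hasDerivAt_cos (Real.pi / 2)
  rw [← e] at hcos
  have : (0 : ℝ) = -Real.sin (Real.pi / 2) := hd.unique hcos
  rw [Real.sin_pi_div_two] at this
  norm_num at this

/-- Two lines with the same duality defect for `α = 0` have the same direction. -/
lemma areParallel_of_dualityDefect_eq {ℓ ℓ' : OrientedGeodesic 0}
    (h : ∀ j, dualityDefect 0 j ℓ = dualityDefect 0 j ℓ') : AreParallel ℓ ℓ' := by
  obtain ⟨p, v, hF, rfl⟩ := exists_geodOf ℓ
  obtain ⟨p', v', hF', rfl⟩ := exists_geodOf ℓ'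
  have key : ∀ q w : R4, IsFrame 0 q w → q 0 = 1 ∧ w 0 = 0 := by
    rintro q w ⟨⟨h1, h2⟩, h3, -⟩
    have h0 : 0 < q 0 := h2 (by decide)
    simp only [TangentTo, Set.mem_ofPred_eq, coform, SignType.coe_zero, zero_mul, add_zero] at h1 h3
    exact ⟨by nlinarith, (mul_eq_zero.1 h3).resolve_left h0.ne'⟩
  refine ⟨_, _, parametrizes_geod hF, parametrizes_geod hF', ?_⟩
  rw [deriv_geod_zero, deriv_geod_zero]
  have hj : ∀ j : Fin 3, v j.succ = v' j.succ := by
    intro j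
    have := h j
    rw [dualityDefect_geodOf hF, dualityDefect_geodOf hF', (key p v hF).1, (key p v hF).2,
      (key p' v' hF').1, (key p' v' hF').2] at this
    linarith
  funext i
  refine Fin.cases ?_ hj i
  rw [(key p v hF).2, (key p' v' hF').2]

/-! ### Hopf fibrations -/

/-- The left (`α = -1`) or right (`α = 1`) multiplication of the quaternion `x` by the imaginary
quaternion `a`.  It is the contraction of `x` with the bivector `n` for which `n₀ⱼ = aⱼ` and
`⋆n = -α n`. -/
def quaternionMul (α : ℝ) (a : Fin 3 → ℝ) (x : R4) : R4 :=
  ![-(x 1 * a 0 + x 2 * a 1 + x 3 * a 2), x 0 * a 0 + α * (x 2 * a 2 - x 3 * a 1),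
    x 0 * a 1 + α * (x 3 * a 0 - x 1 * a 2), x 0 * a 2 + α * (x 1 * a 1 - x 2 * a 0)]

/-- A great circle of `S³` is an orbit of the complex structure given by its duality defect. -/
lemma eq_quaternionMul {α : ℝ} (hα : α ^ 2 = 1) {p v : R4} (h : IsFrame 1 p v) {a : Fin 3 → ℝ}
    (ha : ∀ j, dualityDefect α j (geodOf 1 p v) = a j) : v = quaternionMul α a p := by
  obtain ⟨⟨h1, -⟩, h2, -⟩ := id h
  have a0 := ha 0
  have a1 := ha 1
  have a2 := ha 2
  rw [dualityDefect_geodOf h] at a0 a1 a2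
  simp only [TangentTo, Set.mem_ofPred_eq, coform, SignType.coe_one, one_mul] at h1 h2
  simp only [Fin.isValue, Fin.reduceAdd, zero_add, Fin.reduceSucc, Fin.succ_zero_eq_one,
    Fin.succ_one_eq_two] at a0 a1 a2
  ext i
  fin_cases i <;> simp [quaternionMul, ← a0, ← a1, ← a2]
  · linear_combination -v 0 * h1 + p 0 * h2
  · linear_combination -v 1 * h1 + p 1 * h2 -
      (p 2 * (p 2 * v 1 - p 1 * v 2) + p 3 * (p 3 * v 1 - p 1 * v 3)) * hα
  · linear_combination -v 2 * h1 + p 2 * h2 -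
      (p 3 * (p 3 * v 2 - p 2 * v 3) + p 1 * (p 1 * v 2 - p 2 * v 1)) * hα
  · linear_combination -v 3 * h1 + p 3 * h2 -
      (p 1 * (p 1 * v 3 - p 3 * v 1) + p 2 * (p 2 * v 3 - p 3 * v 2)) * hα

lemma quaternionMul_quaternionMul {α : ℝ} (hα : α ^ 2 = 1) {a : Fin 3 → ℝ}
    (ha : a 0 ^ 2 + a 1 ^ 2 + a 2 ^ 2 = 1) (x : R4) :
    quaternionMul α a (quaternionMul α a x) = -x := by
  ext i
  fin_cases i <;> simp [quaternionMul]
  · linear_combination -x 0 * ha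
  · linear_combination -x 1 * ha +
      (-x 1 * (a 1 ^ 2 + a 2 ^ 2) + x 2 * a 0 * a 1 + x 3 * a 0 * a 2) * hα
  · linear_combination -x 2 * ha +
      (-x 2 * (a 0 ^ 2 + a 2 ^ 2) + x 1 * a 0 * a 1 + x 3 * a 1 * a 2) * hα
  · linear_combination -x 3 * ha +
      (-x 3 * (a 0 ^ 2 + a 1 ^ 2) + x 1 * a 0 * a 2 + x 2 * a 1 * a 2) * hα

lemma quaternionMul_dotProduct (α : ℝ) (a : Fin 3 → ℝ) (x y : R4) :
    quaternionMul α a x ⬝ᵥ y = -(x ⬝ᵥ quaternionMul α a y) := by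
  simp [quaternionMul, dotProduct, Fin.sum_univ_four]; ring

/-- The duality defect of a great circle is a unit vector. -/
lemma sum_dualityDefect_sq {α : ℝ} (hα : α ^ 2 = 1) (ℓ : OrientedGeodesic 1) :
    dualityDefect α 0 ℓ ^ 2 + dualityDefect α 1 ℓ ^ 2 + dualityDefect α 2 ℓ ^ 2 = 1 := by
  obtain ⟨p, v, h, rfl⟩ := exists_geodOf ℓ
  obtain ⟨⟨h1, -⟩, h2, h3⟩ := id h
  rw [dualityDefect_geodOf h, dualityDefect_geodOf h, dualityDefect_geodOf h]
  simp only [TangentTo, Set.mem_ofPred_eq, coform, form, SignType.coe_one, one_mul] at h1 h2 h3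
  simp only [Fin.isValue, Fin.reduceAdd, zero_add, Fin.reduceSucc, Fin.succ_zero_eq_one,
    Fin.succ_one_eq_two]
  linear_combination (v 0 * v 0 + v 1 * v 1 + v 2 * v 2 + v 3 * v 3) * h1 + h3 -
    (p 0 * v 0 + p 1 * v 1 + p 2 * v 2 + p 3 * v 3) * h2 +
    ((p 2 * v 3 - p 3 * v 2) ^ 2 + (p 3 * v 1 - p 1 * v 3) ^ 2 + (p 1 * v 2 - p 2 * v 1) ^ 2) * hα

lemma form_one_eq (x y : R4) : form 1 x y = x ⬝ᵥ y := by
  simp [form, dotProduct, Fin.sum_univ_four]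

lemma coform_one_eq (x y : R4) : coform 1 x y = x ⬝ᵥ y := by
  simp [coform, dotProduct, Fin.sum_univ_four]; ring

/-- The great circles with a given duality defect belong to a Hopf fibration. -/
lemma exists_isHopfFibration {α : ℝ} (hα : α ^ 2 = 1) (ℓ₀ : OrientedGeodesic 1) :
    ∃ H, IsHopfFibration H ∧
      ∀ ℓ : OrientedGeodesic 1, (∀ j, dualityDefect α j ℓ = dualityDefect α j ℓ₀) → ℓ ∈ H := by
  set a : Fin 3 → ℝ := fun j => dualityDefect α j ℓ₀ with ha
  have hJJ := quaternionMul_quaternionMul hα (a := a) (sum_dualityDefect_sq hα ℓ₀)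
  have hJd := quaternionMul_dotProduct α a
  obtain ⟨p, v, hF, hℓ₀⟩ := exists_geodOf ℓ₀
  have hv : v = quaternionMul α a p := eq_quaternionMul hα hF fun j => by rw [hℓ₀]
  obtain ⟨A, B, hf⟩ := exists_isAdapted hF
  set J := quaternionMul α a with hJ
  have hpp : p ⬝ᵥ p = 1 := by rw [← coform_one_eq]; exact hf.mem.1
  have hAA : A ⬝ᵥ A = 1 := by rw [← form_one_eq]; exact hf.AA
  have hpA : p ⬝ᵥ A = 0 := by rw [← coform_one_eq]; exact hf.tA
  have hAJp : A ⬝ᵥ J p = 0 := by rw [← form_one_eq, ← hv]; exact hf.Av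
  have hJ0 : ∀ x, x ⬝ᵥ J x = 0 := fun x => by
    have := hJd x x
    rw [dotProduct_comm] at this
    linarith
  have hJJd : ∀ x y, J x ⬝ᵥ J y = x ⬝ᵥ y := fun x y => by
    rw [hJd, hJJ, dotProduct_neg, neg_neg]
  have hAp := (dotProduct_comm _ _).trans hpA
  have hJpA := (dotProduct_comm _ _).trans hAJp
  have hpJA : p ⬝ᵥ J A = 0 := by
    have := hJd p A
    rw [hJpA] at this; linarith
  have hJ0' : ∀ x, J x ⬝ᵥ x = 0 := fun x => (dotProduct_comm _ _).trans (hJ0 x)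
  have hJAp := (dotProduct_comm _ _).trans hpJA
  -- a unitary basis for the complex structure `J`
  set N : Matrix (Fin 4) (Fin 4) ℝ := Matrix.of ![p, J p, A, J A] with hN
  have hNN : N * N.transpose = 1 := by
    have e : ∀ i k, (N * N.transpose) i k =
        (![p, J p, A, J A] : Fin 4 → R4) i ⬝ᵥ (![p, J p, A, J A] : Fin 4 → R4) k := fun i k => rfl
    ext i k
    rw [e]
    fin_cases i <;> fin_cases k <;>
      simp [hpp, hAA, hpA, hAJp, hJ0, hJ0', hJJd, hAp, hJpA, hpJA, hJAp]
  have hNT : N.transpose * N = 1 := mul_eq_one_comm.1 hNN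
  have hg : N.transpose ∈ Matrix.orthogonalGroup (Fin 4) ℝ := by
    rw [Matrix.mem_orthogonalGroup_iff]
    simpa [Matrix.star_eq_conjTranspose] using hNT
  refine ⟨_, ⟨N.transpose, hg, rfl⟩, fun ℓ hℓ => ?_⟩
  obtain ⟨x, w, hx, rfl⟩ := exists_geodOf ℓ
  have hw : w = J x := eq_quaternionMul hα hx hℓ
  set q : R4 := N.mulVec x with hq
  have hqx : N.transpose.mulVec q = x := by
    rw [hq, Matrix.mulVec_mulVec, hNT, Matrix.one_mulVec]
  have hcomb : ∀ y : R4, N.transpose.mulVec y = y 0 • p + y 1 • J p + y 2 • A + y 3 • J A := by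
    intro y
    ext i
    simp [hN, Matrix.mulVec, dotProduct, Fin.sum_univ_four, mul_comm]
  have hJlin : ∀ (b c d e : ℝ) (x y z u : R4), J (b • x + c • y + d • z + e • u) =
      b • J x + c • J y + d • J z + e • J u := by
    intro b c d e x y z u
    ext i
    fin_cases i <;> simp [hJ, quaternionMul] <;> ring
  have hJx : J x = q 0 • J p - q 1 • p + q 2 • J A - q 3 • A := by
    rw [← hqx, hcomb, hJlin, hJJ, hJJ]; module
  refine ⟨q, ⟨?_, fun h => absurd rfl h⟩, ?_⟩
  · rw [coform_one_eq, hq, Matrix.dotProduct_mulVec, Matrix.vecMul_mulVec,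
      ← Matrix.dotProduct_mulVec, hNT, Matrix.one_mulVec, ← coform_one_eq]
    exact hx.1.1
  · convert! parametrizes_geod hx using 1
    funext s
    rw [geod, hw, hJx]
    nth_rewrite 1 [← hqx]
    rw [hcomb, hcomb]
    have hc : cosK 1 s = Real.cos s := rfl
    have hs : sinK 1 s = Real.sin s := rfl
    simp only [complexMul, Complex.exp_ofReal_mul_I_re, Complex.exp_ofReal_mul_I_im, hc, hs,
      Matrix.cons_val]
    module

end Helicoidal

theorem theorem2 (α : ℝ) :
    (∀ κ : SignType,
      List.TFAE
        [IsControllable (helicoidalSystem κ α),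
         α ^ 2 ≠ (κ : ℝ),
         ∀ ℓ : OrientedGeodesic κ, IsSubstantial (helicoidalFiber κ α ℓ)]) ∧
    (α = 0 → ∀ (I : Set ℝ) (γ : ℝ → OrientedGeodesic 0),
      IsAdmissibleCurve (helicoidalSystem 0 α) I γ →
        ∀ s ∈ I, ∀ t ∈ I, AreParallel (γ s) (γ t)) ∧
    (α = 1 ∨ α = -1 → ∀ (I : Set ℝ) (γ : ℝ → OrientedGeodesic 1),
      IsAdmissibleCurve (helicoidalSystem 1 α) I γ →
        ∃ H : Set (OrientedGeodesic 1), IsHopfFibration H ∧ γ '' I ⊆ H) := by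
  refine ⟨fun κ => ?_, ?_, ?_⟩
  · tfae_have 1 → 2 := IsControllable.ne
    tfae_have 2 → 1 := isControllable_helicoidalSystem
    tfae_have 2 → 3 := isSubstantial_helicoidalFiber
    tfae_have 3 → 2 := ne_of_isSubstantial
    tfae_finish
  · rintro rfl I γ h s hs t ht
    exact areParallel_of_dualityDefect_eq fun j => h.dualityDefect_eq (by simp) j hs ht
  · intro hα I γ h
    have hα : α ^ 2 = 1 := by rcases hα with rfl | rfl <;> norm_num
    rcases I.eq_empty_or_nonempty with rfl | ⟨t, ht⟩
    · obtain ⟨H, hH, -⟩ := exists_isHopfFibration hα (γ 0)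
      exact ⟨H, hH, by simp⟩
    · obtain ⟨H, hH, hmem⟩ := exists_isHopfFibration hα (γ t)
      refine ⟨H, hH, ?_⟩
      rintro _ ⟨s, hs, rfl⟩
      exact hmem _ fun j => h.dualityDefect_eq (by simpa using hα) j hs ht
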